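/- Let $k$ be an algebraically closed field whose characteristic is not $2$. Let $H_8$ be the ($8$-dimensional) Kac–Paljutkin algebra over $k$: the $k$-algebra generated by $x_{ij}$, $i,j\in\{1,2\}$, with the relations $$x_{11}^2=x_{22}^2,\quad x_{12}^2=x_{21}^2,\quad x_{ij}x_{lm}=0 \text{ if } i-j\not\equiv l-m \pmod 2,\quad x_{11}^2+x_{12}^2=1,\quad x_{11}x_{22}=x_{22}x_{11},\quad x_{12}x_{21}=-x_{21}x_{12},$$ with comultiplication $\Delta(x_{ij})=x_{i1}\otimes x_{1j}+x_{i2}\otimes x_{2j}$, counit $\varepsilon(x_{ij})=\delta_{ij}$ and antipode $S(x_{ij})=x_{ji}$. A *braiding* of a Hopf algebra $A$ is a linear functional $\sigma$ on $A\otimes A$, invertible for the convolution product, such that for all $x,y,z\in A$ $$\sum\sigma(x_{(1)},y_{(1)})\,x_{(2)}y_{(2)}=\sum\sigma(x_{(2)},y_{(2)})\,y_{(1)}x_{(1)},$$ $$\sigma(xy,z)=\sum\sigma(x,z_{(1)})\,\sigma(y,z_{(2)}),\qquad \sigma(x,yz)=\sum\sigma(x_{(1)},z)\,\sigma(x_{(2)},y);$$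 the pair $(A,\sigma)$ is then called a *braided Hopf algebra*. If $A$ is finite-dimensional, then $\sigma$, regarded as an element of $A^*\otimes A^*\cong(A\otimes A)^*$, is a universal $R$-matrix of the dual Hopf algebra $A^*$. Two finite-dimensional braided Hopf algebras $(A,\sigma)$ and $(B,\sigma')$ are *braided Morita equivalent* if the categories of left $A^*$-modules and of left $B^*$-modules, with the braidings $m\otimes n\mapsto\sum R^{(2)}n\otimes R^{(1)}m$ given by $R=\sigma$ and $R=\sigma'$ respectively, are equivalent as $k$-linear braided monoidal categories. For $\gamma,\delta\in\{1,-1\}$ let $\tau^-_{\gamma,\delta}$ be the braiding of $H_8$ determined by $$\tau^-_{\gamma,\delta}(x_{11},x_{11})=\tau^-_{\gamma,\delta}(x_{22},x_{22})=\gamma,\quad \tau^-_{\gamma,\delta}(x_{11},x_{22})=\delta,\quad \tau^-_{\gamma,\delta}(x_{22},x_{11})=-\delta,$$ and by the value $0$ on all other pairs of generators. Let $\sigma,\sigma'$ be braidings of $H_8$. Then $(H_8,\sigma)$ and $(H_8,\sigma')$ are braided Morita equivalent if and only if one of the following holds: 1. $\sigma=\sigma'$; 2. $\{\sigma,\sigma'\}=\{\tau^-_{1,1},\tau^-_{1,-1}\}$;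 3. $\{\sigma,\sigma'\}=\{\tau^-_{-1,1},\tau^-_{-1,-1}\}$. Moreover, there are exactly $6$ braided Morita equivalence classes of braidings of $H_8$. -/

import Mathlib

open CategoryTheory TensorProduct
universe u

noncomputable section

/-- A universal `R`-matrix of a bialgebra `A`: an invertible element `R` of `A ⊗ A` with
`Δᵒᵖ(a) R = R Δ(a)`, `(Δ ⊗ id)(R) = R₁₃ R₂₃` and `(id ⊗ Δ)(R) = R₁₃ R₁₂`. The element `R₁₃` is
obtained by applying `a ↦ a ⊗ 1` to the first leg of `R` (inside `(A ⊗ A) ⊗ A`), or `b ↦ 1 ⊗ b` to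
the second leg (inside `A ⊗ (A ⊗ A)`), and similarly for `R₂₃` and `R₁₂`. -/
@[ext]
structure RMatrix (k : Type u) [Field k] (A : Type u) [Ring A] [Bialgebra k A] where
  elt : A ⊗[k] A
  isUnit : IsUnit elt
  comul_op : ∀ a : A,
    Algebra.TensorProduct.comm k A A (Bialgebra.comulAlgHom k A a) * elt =
      elt * Bialgebra.comulAlgHom k A a
  comul_left :
    Algebra.TensorProduct.map (Bialgebra.comulAlgHom k A) (AlgHom.id k A) elt =
      Algebra.TensorProduct.map
          (Algebra.TensorProduct.includeLeft : A →ₐ[k] A ⊗[k] A) (AlgHom.id k A) elt *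
        Algebra.TensorProduct.map
          (Algebra.TensorProduct.includeRight : A →ₐ[k] A ⊗[k] A) (AlgHom.id k A) elt
  comul_right :
    Algebra.TensorProduct.map (AlgHom.id k A) (Bialgebra.comulAlgHom k A) elt =
      Algebra.TensorProduct.map (AlgHom.id k A)
          (Algebra.TensorProduct.includeRight : A →ₐ[k] A ⊗[k] A) elt *
        Algebra.TensorProduct.map (AlgHom.id k A)
          (Algebra.TensorProduct.includeLeft : A →ₐ[k] A ⊗[k] A) elt

/-- A left module over the quasitriangular bialgebra `(A, R)`: a `k`-vector space `V` with an
algebra homomorphism from `A` to the linear endomorphisms of `V`. (The matrix `R` plays no role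
for objects and morphisms; it is an index that selects the braiding below.) -/
structure QTMod {k : Type u} [Field k] {A : Type u} [Ring A] [Bialgebra k A]
    (R : RMatrix k A) where
  V : Type u
  [addCommGroup : AddCommGroup V]
  [module : Module k V]
  ρ : A →ₐ[k] Module.End k V

namespace QTMod

attribute [instance] QTMod.addCommGroup QTMod.module

variable {k : Type u} [Field k] {A : Type u} [Ring A] [Bialgebra k A] {R : RMatrix k A}

/-- `A`-linear maps. -/
@[ext]
structure Hom (M N : QTMod R) where
  lin : M.V →ₗ[k] N.V
  comm : ∀ a m, lin (M.ρ a m) = N.ρ a (lin m)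

namespace Hom

variable {M N : QTMod R}

instance : Zero (Hom M N) := ⟨⟨0, fun _ _ => by simp⟩⟩
instance : Add (Hom M N) := ⟨fun f g => ⟨f.lin + g.lin, fun a m => by simp [f.comm, g.comm]⟩⟩
instance : Neg (Hom M N) := ⟨fun f => ⟨-f.lin, fun a m => by simp [f.comm]⟩⟩
instance : Sub (Hom M N) := ⟨fun f g => ⟨f.lin - g.lin, fun a m => by simp [f.comm, g.comm]⟩⟩
instance : SMul k (Hom M N) := ⟨fun c f => ⟨c • f.lin, fun a m => by simp [f.comm]⟩⟩
instance : SMul ℕ (Hom M N) := ⟨fun c f => ⟨c • f.lin, fun a m => by simp [f.comm]⟩⟩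
instance : SMul ℤ (Hom M N) := ⟨fun c f => ⟨c • f.lin, fun a m => by simp [f.comm]⟩⟩

theorem lin_injective : Function.Injective (Hom.lin : Hom M N → (M.V →ₗ[k] N.V)) :=
  fun _ _ h => Hom.ext h

instance : AddCommGroup (Hom M N) :=
  lin_injective.addCommGroup _ rfl (fun _ _ => rfl) (fun _ => rfl) (fun _ _ => rfl)
    (fun _ _ => rfl) (fun _ _ => rfl)

/-- Taking the underlying linear map, as an additive homomorphism. -/
def linAddHom : Hom M N →+ (M.V →ₗ[k] N.V) where
  toFun := Hom.lin
  map_zero' := rfl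
  map_add' _ _ := rfl

instance : Module k (Hom M N) := lin_injective.module k linAddHom (fun _ _ => rfl)

end Hom

instance : Category (QTMod R) where
  Hom M N := Hom M N
  id M := ⟨LinearMap.id, fun _ _ => rfl⟩
  comp f g := ⟨g.lin ∘ₗ f.lin, fun a m => by simp [f.comm, g.comm]⟩

@[ext]
theorem hom_ext {M N : QTMod R} {f g : M ⟶ N} (h : f.lin = g.lin) : f = g := Hom.ext h

@[simp] theorem id_lin (M : QTMod R) : Hom.lin (𝟙 M) = LinearMap.id := rfl

@[simp] theorem comp_lin {M N P : QTMod R} (f : M ⟶ N) (g : N ⟶ P) :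
    (f ≫ g).lin = g.lin ∘ₗ f.lin := rfl

instance : Preadditive (QTMod R) where
  homGroup M N := inferInstanceAs (AddCommGroup (Hom M N))
  add_comp _ _ _ f f' g := hom_ext <| LinearMap.ext fun x => map_add g.lin (f.lin x) (f'.lin x)
  comp_add _ _ _ _ _ _ := rfl

instance : Linear k (QTMod R) where
  homModule M N := inferInstanceAs (Module k (Hom M N))
  smul_comp _ _ _ r f g := hom_ext <| LinearMap.ext fun x => map_smul g.lin r (f.lin x)
  comp_smul _ _ _ _ _ _ := rfl

@[simp] theorem add_lin {M N : QTMod R} (f g : M ⟶ N) : (f + g).lin = f.lin + g.lin := rfl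
@[simp] theorem zero_lin {M N : QTMod R} : (0 : M ⟶ N).lin = 0 := rfl
@[simp] theorem smul_lin {M N : QTMod R} (c : k) (f : M ⟶ N) : (c • f).lin = c • f.lin := rfl

/-- The action of `A ⊗ A` on `V ⊗ W`. -/
def tensorAct {B C V W : Type u} [Ring B] [Algebra k B] [Ring C] [Algebra k C]
    [AddCommGroup V] [Module k V] [AddCommGroup W] [Module k W]
    (ρ : B →ₐ[k] Module.End k V) (σ : C →ₐ[k] Module.End k W) :
    B ⊗[k] C →ₐ[k] Module.End k (V ⊗[k] W) :=
  Module.endTensorEndAlgHom.comp (Algebra.TensorProduct.map ρ σ)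

@[simp]
theorem tensorAct_tmul {B C V W : Type u} [Ring B] [Algebra k B] [Ring C] [Algebra k C]
    [AddCommGroup V] [Module k V] [AddCommGroup W] [Module k W]
    (ρ : B →ₐ[k] Module.End k V) (σ : C →ₐ[k] Module.End k W) (a : B) (b : C) (v : V) (w : W) :
    tensorAct ρ σ (a ⊗ₜ b) (v ⊗ₜ w) = ρ a v ⊗ₜ σ b w := rfl

/-- The tensor product of two modules, with `A` acting through the comultiplication. -/
def tensor (M N : QTMod R) : QTMod R where
  V := M.V ⊗[k] N.V
  ρ := (tensorAct M.ρ N.ρ).comp (Bialgebra.comulAlgHom k A)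

/-- The trivial module `k`, with `A` acting through the counit. -/
def unit : QTMod R where
  V := k
  ρ := (Algebra.lsmul k k k).comp (Bialgebra.counitAlgHom k A)

/-- An isomorphism of modules from a linear equivalence that commutes with the action. -/
def mkIso {M N : QTMod R} (e : M.V ≃ₗ[k] N.V) (h : ∀ a m, e (M.ρ a m) = N.ρ a (e m)) :
    M ≅ N where
  hom := ⟨e.toLinearMap, h⟩
  inv := ⟨e.symm.toLinearMap, fun a m => by
    apply e.injective
    simp [h]⟩
  hom_inv_id := by ext; simp
  inv_hom_id := by ext; simp

@[simp] theorem mkIso_hom_lin {M N : QTMod R} (e : M.V ≃ₗ[k] N.V)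
    (h : ∀ a m, e (M.ρ a m) = N.ρ a (e m)) : (mkIso e h).hom.lin = e.toLinearMap := rfl

@[simp] theorem mkIso_inv_lin {M N : QTMod R} (e : M.V ≃ₗ[k] N.V)
    (h : ∀ a m, e (M.ρ a m) = N.ρ a (e m)) : (mkIso e h).inv.lin = e.symm.toLinearMap := rfl

theorem map_tensorAct {B C V W V' W' : Type u} [Ring B] [Algebra k B] [Ring C] [Algebra k C]
    [AddCommGroup V] [Module k V] [AddCommGroup W] [Module k W]
    [AddCommGroup V'] [Module k V'] [AddCommGroup W'] [Module k W']
    {ρ : B →ₐ[k] Module.End k V} {σ : C →ₐ[k] Module.End k W}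
    {ρ' : B →ₐ[k] Module.End k V'} {σ' : C →ₐ[k] Module.End k W'}
    (f : V →ₗ[k] V') (g : W →ₗ[k] W') (hf : ∀ a v, f (ρ a v) = ρ' a (f v))
    (hg : ∀ a v, g (σ a v) = σ' a (g v)) (t : B ⊗[k] C) (x : V ⊗[k] W) :
    TensorProduct.map f g (tensorAct ρ σ t x) = tensorAct ρ' σ' t (TensorProduct.map f g x) := by
  induction t with
  | zero => simp
  | add s t hs ht => simp [hs, ht]
  | tmul a b =>
    induction x with
    | zero => simp
    | add s t hs ht => simp only [map_add, hs, ht]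
    | tmul v w => simp [hf, hg]

/-- The tensor product of two morphisms. -/
def tensorMap {M N M' N' : QTMod R} (f : M ⟶ M') (g : N ⟶ N') : tensor M N ⟶ tensor M' N' :=
  ⟨TensorProduct.map f.lin g.lin, fun a x => map_tensorAct f.lin g.lin f.comm g.comm _ x⟩

theorem assoc_tensorAct {U V W : Type u} [AddCommGroup U] [Module k U]
    [AddCommGroup V] [Module k V] [AddCommGroup W] [Module k W] (ρ : A →ₐ[k] Module.End k U)
    (σ : A →ₐ[k] Module.End k V) (τ : A →ₐ[k] Module.End k W) (t : (A ⊗[k] A) ⊗[k] A)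
    (x : (U ⊗[k] V) ⊗[k] W) :
    TensorProduct.assoc k U V W (tensorAct (tensorAct ρ σ) τ t x) =
      tensorAct ρ (tensorAct σ τ) (TensorProduct.assoc k A A A t)
        (TensorProduct.assoc k U V W x) := by
  induction t with
  | zero => simp
  | add s t hs ht => simp only [map_add, hs, ht, LinearMap.add_apply]
  | tmul s c =>
    induction s with
    | zero => simp
    | add s t hs ht => simp only [map_add, add_tmul, hs, ht, LinearMap.add_apply]
    | tmul a b =>
      induction x with
      | zero => simp
      | add s t hs ht => simp only [map_add, hs, ht]
      | tmul y w =>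
        induction y with
        | zero => simp
        | add s t hs ht => simp only [map_add, add_tmul, hs, ht]
        | tmul u v => simp

theorem tensorAct_comp {B C B' C' V W : Type u} [Ring B] [Algebra k B] [Ring C] [Algebra k C]
    [Ring B'] [Algebra k B'] [Ring C'] [Algebra k C']
    [AddCommGroup V] [Module k V] [AddCommGroup W] [Module k W]
    (ρ : B →ₐ[k] Module.End k V) (σ : C →ₐ[k] Module.End k W) (f : B' →ₐ[k] B) (g : C' →ₐ[k] C)
    (t : B' ⊗[k] C') :
    tensorAct (ρ.comp f) (σ.comp g) t = tensorAct ρ σ (Algebra.TensorProduct.map f g t) := by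
  induction t with
  | zero => simp
  | add s t hs ht => simp only [map_add, hs, ht]
  | tmul => rfl

theorem assoc_comul {U V W : Type u} [AddCommGroup U] [Module k U]
    [AddCommGroup V] [Module k V] [AddCommGroup W] [Module k W] (ρ : A →ₐ[k] Module.End k U)
    (σ : A →ₐ[k] Module.End k V) (τ : A →ₐ[k] Module.End k W) (a : A) (x : (U ⊗[k] V) ⊗[k] W) :
    TensorProduct.assoc k U V W (tensorAct ((tensorAct ρ σ).comp (Bialgebra.comulAlgHom k A)) τ
        (Bialgebra.comulAlgHom k A a) x) =
      tensorAct ρ ((tensorAct σ τ).comp (Bialgebra.comulAlgHom k A)) (Bialgebra.comulAlgHom k A a)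
        (TensorProduct.assoc k U V W x) := by
  have h1 := tensorAct_comp (tensorAct ρ σ) τ (Bialgebra.comulAlgHom k A) (AlgHom.id k A)
    (Bialgebra.comulAlgHom k A a)
  have h2 := tensorAct_comp ρ (tensorAct σ τ) (AlgHom.id k A) (Bialgebra.comulAlgHom k A)
    (Bialgebra.comulAlgHom k A a)
  rw [AlgHom.comp_id] at h1 h2
  rw [h1, h2, assoc_tensorAct]
  congr 2
  exact Coalgebra.coassoc_apply (R := k) a

theorem lid_tensorAct {V : Type u} [AddCommGroup V] [Module k V] (ρ : A →ₐ[k] Module.End k V)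
    (t : A ⊗[k] A) (y : k ⊗[k] V) :
    TensorProduct.lid k V
        (tensorAct ((Algebra.lsmul k k k).comp (Bialgebra.counitAlgHom k A)) ρ t y) =
      ρ (TensorProduct.lid k A (LinearMap.rTensor A Coalgebra.counit t))
        (TensorProduct.lid k V y) := by
  induction t with
  | zero => simp
  | add s t hs ht => simp only [map_add, hs, ht, LinearMap.add_apply]
  | tmul a b =>
    induction y with
    | zero => simp
    | add s t hs ht => simp only [map_add, hs, ht]
    | tmul c m => simp [mul_smul, smul_comm c]

theorem rid_tensorAct {V : Type u} [AddCommGroup V] [Module k V] (ρ : A →ₐ[k] Module.End k V)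
    (t : A ⊗[k] A) (y : V ⊗[k] k) :
    TensorProduct.rid k V
        (tensorAct ρ ((Algebra.lsmul k k k).comp (Bialgebra.counitAlgHom k A)) t y) =
      ρ (TensorProduct.rid k A (LinearMap.lTensor A Coalgebra.counit t))
        (TensorProduct.rid k V y) := by
  induction t with
  | zero => simp
  | add s t hs ht => simp only [map_add, hs, ht, LinearMap.add_apply]
  | tmul a b =>
    induction y with
    | zero => simp
    | add s t hs ht => simp only [map_add, hs, ht]
    | tmul c m => simp [mul_smul, smul_comm m]

/-- The associativity isomorphism `(L ⊗ M) ⊗ N ≅ L ⊗ (M ⊗ N)`. -/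
def assocIso (L M N : QTMod R) : tensor (tensor L M) N ≅ tensor L (tensor M N) :=
  mkIso (TensorProduct.assoc k L.V M.V N.V) fun a x => assoc_comul L.ρ M.ρ N.ρ a x

/-- The left unit isomorphism `k ⊗ M ≅ M`. -/
def leftUnitIso (M : QTMod R) : tensor unit M ≅ M :=
  mkIso (TensorProduct.lid k M.V) fun a x => by
    refine (lid_tensorAct M.ρ (Bialgebra.comulAlgHom k A a) x).trans ?_
    have h := Coalgebra.rTensor_counit_comul (R := k) a
    rw [Bialgebra.comulAlgHom_apply, h, TensorProduct.lid_tmul, one_smul]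
    rfl

/-- The right unit isomorphism `M ⊗ k ≅ M`. -/
def rightUnitIso (M : QTMod R) : tensor M unit ≅ M :=
  mkIso (TensorProduct.rid k M.V) fun a x => by
    refine (rid_tensorAct M.ρ (Bialgebra.comulAlgHom k A a) x).trans ?_
    have h := Coalgebra.lTensor_counit_comul (R := k) a
    rw [Bialgebra.comulAlgHom_apply, h, TensorProduct.rid_tmul, one_smul]
    rfl

instance : MonoidalCategoryStruct (QTMod R) where
  tensorObj := tensor
  tensorUnit := unit
  tensorHom f g := tensorMap f g
  whiskerLeft M _ _ f := tensorMap (𝟙 M) f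
  whiskerRight f N := tensorMap f (𝟙 N)
  associator := assocIso
  leftUnitor := leftUnitIso
  rightUnitor := rightUnitIso

section simp_lemmas
open MonoidalCategory

@[simp] theorem tensorHom_lin {M N M' N' : QTMod R} (f : M ⟶ M') (g : N ⟶ N') :
    (f ⊗ₘ g).lin = TensorProduct.map f.lin g.lin := rfl
@[simp] theorem whiskerLeft_lin (M : QTMod R) {N N' : QTMod R} (g : N ⟶ N') :
    (M ◁ g).lin = TensorProduct.map LinearMap.id g.lin := rfl
@[simp] theorem whiskerRight_lin {M M' : QTMod R} (f : M ⟶ M') (N : QTMod R) :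
    (f ▷ N).lin = TensorProduct.map f.lin LinearMap.id := rfl
@[simp] theorem associator_hom_lin (L M N : QTMod R) :
    (α_ L M N).hom.lin = (TensorProduct.assoc k L.V M.V N.V).toLinearMap := rfl
@[simp] theorem associator_inv_lin (L M N : QTMod R) :
    (α_ L M N).inv.lin = (TensorProduct.assoc k L.V M.V N.V).symm.toLinearMap := rfl
@[simp] theorem leftUnitor_hom_lin (M : QTMod R) :
    (λ_ M).hom.lin = (TensorProduct.lid k M.V).toLinearMap := rfl
@[simp] theorem rightUnitor_hom_lin (M : QTMod R) :
    (ρ_ M).hom.lin = (TensorProduct.rid k M.V).toLinearMap := rfl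

end simp_lemmas

instance : MonoidalCategory (QTMod R) where
  tensorHom_def f g := hom_ext <| TensorProduct.ext' fun x y => rfl
  id_tensorHom_id M N := hom_ext <| TensorProduct.ext' fun x y => rfl
  tensorHom_comp_tensorHom f g f' g' := hom_ext <| TensorProduct.ext' fun x y => rfl
  whiskerLeft_id M N := hom_ext <| TensorProduct.ext' fun x y => rfl
  id_whiskerRight M N := hom_ext <| TensorProduct.ext' fun x y => rfl
  associator_naturality f g h := hom_ext <| TensorProduct.ext_threefold fun x y z => rfl
  leftUnitor_naturality {X Y} f := hom_ext <| TensorProduct.ext' fun (x : k) y => by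
    exact (map_smul f.lin x y).symm
  rightUnitor_naturality f := hom_ext <| TensorProduct.ext' fun y (x : k) => by
    exact (map_smul f.lin x y).symm
  pentagon W X Y Z := hom_ext <| TensorProduct.ext_fourfold fun w x y z => rfl
  triangle X Y := hom_ext <| TensorProduct.ext_threefold fun x (c : k) y => by
    exact (TensorProduct.smul_tmul c x y).symm

theorem comm_tensorAct {V W : Type u} [AddCommGroup V] [Module k V] [AddCommGroup W] [Module k W]
    (ρ : A →ₐ[k] Module.End k V) (σ : A →ₐ[k] Module.End k W) (t : A ⊗[k] A) (x : V ⊗[k] W) :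
    TensorProduct.comm k V W (tensorAct ρ σ t x) =
      tensorAct σ ρ (Algebra.TensorProduct.comm k A A t) (TensorProduct.comm k V W x) := by
  induction t with
  | zero => simp
  | add s t hs ht => simp only [map_add, hs, ht, LinearMap.add_apply]
  | tmul a b =>
    induction x with
    | zero => simp
    | add s t hs ht => simp only [map_add, hs, ht]
    | tmul v w => simp

/-- The action of `R` on `M ⊗ N` as a linear automorphism. -/
def actR (M N : QTMod R) : (M.V ⊗[k] N.V) ≃ₗ[k] (M.V ⊗[k] N.V) :=
  LinearMap.GeneralLinearGroup.generalLinearEquiv k _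
    ((R.isUnit.map (tensorAct M.ρ N.ρ)).unit)

@[simp] theorem actR_apply (M N : QTMod R) (x : M.V ⊗[k] N.V) :
    actR M N x = tensorAct M.ρ N.ρ R.elt x := rfl

theorem braid_comul (R : RMatrix k A) {V W : Type u} [AddCommGroup V] [Module k V]
    [AddCommGroup W] [Module k W]
    (ρ : A →ₐ[k] Module.End k V) (σ : A →ₐ[k] Module.End k W) (a : A) (x : V ⊗[k] W) :
    TensorProduct.comm k V W (tensorAct ρ σ R.elt
        (tensorAct ρ σ (Bialgebra.comulAlgHom k A a) x)) =
      tensorAct σ ρ (Bialgebra.comulAlgHom k A a)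
        (TensorProduct.comm k V W (tensorAct ρ σ R.elt x)) := by
  rw [← Module.End.mul_apply, ← map_mul, ← R.comul_op, map_mul, Module.End.mul_apply,
    comm_tensorAct]
  congr 2
  exact (TensorProduct.comm k A A).apply_symm_apply _

/-- The braiding `m ⊗ n ↦ ∑ R⁽²⁾ n ⊗ R⁽¹⁾ m`: act by `R` on `M ⊗ N` and flip. -/
def braid (M N : QTMod R) : tensor M N ≅ tensor N M :=
  mkIso ((actR M N).trans (TensorProduct.comm k M.V N.V)) (braid_comul R M.ρ N.ρ)

section hexagon

variable {U V W : Type u} [AddCommGroup U] [Module k U] [AddCommGroup V] [Module k V]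
  [AddCommGroup W] [Module k W] (ρ : A →ₐ[k] Module.End k U) (σ : A →ₐ[k] Module.End k V)
  (τ : A →ₐ[k] Module.End k W)

theorem act_right_left (t : A ⊗[k] A) (p : U ⊗[k] V) (w : W) :
    tensorAct ρ (tensorAct σ τ) (Algebra.TensorProduct.map (AlgHom.id k A)
        (Algebra.TensorProduct.includeLeft : A →ₐ[k] A ⊗[k] A) t)
        (TensorProduct.assoc k U V W (p ⊗ₜ w)) =
      TensorProduct.assoc k U V W (tensorAct ρ σ t p ⊗ₜ w) := by
  induction t with
  | zero => simp
  | add s t hs ht => simp only [map_add, hs, ht, LinearMap.add_apply, add_tmul]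
  | tmul a b =>
    induction p with
    | zero => simp
    | add s t hs ht => simp only [map_add, hs, ht, add_tmul]
    | tmul u v => simp

theorem act_right_right (t : A ⊗[k] A) (p : U ⊗[k] V) (w : W) :
    TensorProduct.assoc k V W U (TensorProduct.comm k U (V ⊗[k] W)
      (tensorAct ρ (tensorAct σ τ) (Algebra.TensorProduct.map (AlgHom.id k A)
        (Algebra.TensorProduct.includeRight : A →ₐ[k] A ⊗[k] A) t)
        (TensorProduct.assoc k U V W (p ⊗ₜ w)))) =
      TensorProduct.map LinearMap.id
        ((TensorProduct.comm k U W).toLinearMap ∘ₗ tensorAct ρ τ t)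
        (TensorProduct.assoc k V U W (TensorProduct.comm k U V p ⊗ₜ w)) := by
  induction p with
  | zero => simp
  | add s t hs ht => simp only [map_add, hs, ht, add_tmul]
  | tmul u v =>
    induction t with
    | zero => simp
    | add s t hs ht =>
      simp only [map_add, hs, ht, LinearMap.add_apply]
      simp [tmul_add]
    | tmul a b => simp

theorem act_left_right (t : A ⊗[k] A) (u : U) (q : V ⊗[k] W) :
    tensorAct (tensorAct ρ σ) τ (Algebra.TensorProduct.map
        (Algebra.TensorProduct.includeRight : A →ₐ[k] A ⊗[k] A) (AlgHom.id k A) t)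
        ((TensorProduct.assoc k U V W).symm (u ⊗ₜ q)) =
      (TensorProduct.assoc k U V W).symm (u ⊗ₜ tensorAct σ τ t q) := by
  induction t with
  | zero => simp
  | add s t hs ht => simp only [map_add, hs, ht, LinearMap.add_apply, tmul_add]
  | tmul a b =>
    induction q with
    | zero => simp
    | add s t hs ht => simp only [map_add, hs, ht, tmul_add]
    | tmul v w => simp

theorem act_left_left (t : A ⊗[k] A) (u : U) (q : V ⊗[k] W) :
    (TensorProduct.assoc k W U V).symm (TensorProduct.comm k (U ⊗[k] V) W
      (tensorAct (tensorAct ρ σ) τ (Algebra.TensorProduct.map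
        (Algebra.TensorProduct.includeLeft : A →ₐ[k] A ⊗[k] A) (AlgHom.id k A) t)
        ((TensorProduct.assoc k U V W).symm (u ⊗ₜ q)))) =
      TensorProduct.map ((TensorProduct.comm k U W).toLinearMap ∘ₗ tensorAct ρ τ t)
        LinearMap.id ((TensorProduct.assoc k U W V).symm (u ⊗ₜ TensorProduct.comm k V W q)) := by
  induction q with
  | zero => simp
  | add s t hs ht => simp only [map_add, hs, ht, tmul_add]
  | tmul v w =>
    induction t with
    | zero => simp
    | add s t hs ht =>
      simp only [map_add, hs, ht, LinearMap.add_apply]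
      simp [add_tmul]
    | tmul a b => simp

theorem hexagon_right (R : RMatrix k A) (p : U ⊗[k] V) (w : W) :
    TensorProduct.assoc k V W U (TensorProduct.comm k U (V ⊗[k] W)
      (tensorAct ρ ((tensorAct σ τ).comp (Bialgebra.comulAlgHom k A)) R.elt
        (TensorProduct.assoc k U V W (p ⊗ₜ w)))) =
      TensorProduct.map LinearMap.id
        ((TensorProduct.comm k U W).toLinearMap ∘ₗ tensorAct ρ τ R.elt)
        (TensorProduct.assoc k V U W (TensorProduct.comm k U V (tensorAct ρ σ R.elt p) ⊗ₜ w)) := by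
  have h := tensorAct_comp ρ (tensorAct σ τ) (AlgHom.id k A) (Bialgebra.comulAlgHom k A) R.elt
  rw [AlgHom.comp_id] at h
  rw [h, R.comul_right, map_mul, Module.End.mul_apply, act_right_left, act_right_right]

theorem hexagon_left (R : RMatrix k A) (u : U) (q : V ⊗[k] W) :
    (TensorProduct.assoc k W U V).symm (TensorProduct.comm k (U ⊗[k] V) W
      (tensorAct ((tensorAct ρ σ).comp (Bialgebra.comulAlgHom k A)) τ R.elt
        ((TensorProduct.assoc k U V W).symm (u ⊗ₜ q)))) =
      TensorProduct.map ((TensorProduct.comm k U W).toLinearMap ∘ₗ tensorAct ρ τ R.elt)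
        LinearMap.id ((TensorProduct.assoc k U W V).symm
          (u ⊗ₜ TensorProduct.comm k V W (tensorAct σ τ R.elt q))) := by
  have h := tensorAct_comp (tensorAct ρ σ) τ (Bialgebra.comulAlgHom k A) (AlgHom.id k A) R.elt
  rw [AlgHom.comp_id] at h
  rw [h, R.comul_left, map_mul, Module.End.mul_apply, act_left_right, act_left_left]

end hexagon

theorem comm_map {V W V' W' : Type u} [AddCommGroup V] [Module k V] [AddCommGroup W] [Module k W]
    [AddCommGroup V'] [Module k V'] [AddCommGroup W'] [Module k W'] (f : V →ₗ[k] V')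
    (g : W →ₗ[k] W') (x : V ⊗[k] W) :
    TensorProduct.comm k V' W' (TensorProduct.map f g x) =
      TensorProduct.map g f (TensorProduct.comm k V W x) := by
  induction x with
  | zero => simp
  | add s t hs ht => simp only [map_add, hs, ht]
  | tmul v w => rfl

theorem braid_natural {M N M' N' : QTMod R} (f : M ⟶ M') (g : N ⟶ N') :
    tensorMap f g ≫ (braid M' N').hom = (braid M N).hom ≫ tensorMap g f :=
  hom_ext <| LinearMap.ext fun x => by
    change TensorProduct.comm k M'.V N'.V (tensorAct M'.ρ N'.ρ R.elt
        (TensorProduct.map f.lin g.lin x)) =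
      TensorProduct.map g.lin f.lin (TensorProduct.comm k M.V N.V (tensorAct M.ρ N.ρ R.elt x))
    exact (congrArg _ (map_tensorAct f.lin g.lin f.comm g.comm R.elt x).symm).trans
      (comm_map f.lin g.lin _)

instance : BraidedCategory (QTMod R) where
  braiding := braid
  braiding_naturality_left f N := braid_natural f (𝟙 N)
  braiding_naturality_right M _ _ g := braid_natural (𝟙 M) g
  hexagon_forward L M N := hom_ext <| TensorProduct.ext' fun p n =>
    (hexagon_right L.ρ M.ρ N.ρ R p n).trans <| by rfl
  hexagon_reverse L M N := hom_ext <| TensorProduct.ext' fun l q =>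
    (hexagon_left L.ρ M.ρ N.ρ R l q).trans <| by rfl

@[simp] theorem braiding_hom_lin (M N : QTMod R) :
    (β_ M N).hom.lin =
      (TensorProduct.comm k M.V N.V).toLinearMap ∘ₗ tensorAct M.ρ N.ρ R.elt := rfl

end QTMod

/-- Two quasitriangular bialgebras are braided Morita equivalent if their categories of left
modules are equivalent as `k`-linear braided monoidal categories. -/
def BraidedMoritaEquivalent {k : Type u} [Field k] {A B : Type u} [Ring A] [Bialgebra k A]
    [Ring B] [Bialgebra k B] (R : RMatrix k A) (R' : RMatrix k B) : Prop :=
  ∃ F : QTMod R ⥤ QTMod R', F.IsEquivalence ∧ F.Additive ∧ F.Linear k ∧ Nonempty F.Braided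

theorem nonempty_braided_inverse {C : Type*} {D : Type*} [Category* C] [Category* D]
    [MonoidalCategory C] [MonoidalCategory D] [BraidedCategory C] [BraidedCategory D] (e : C ≌ D)
    (h : e.functor.Braided) : Nonempty e.inverse.Braided := by
  let _ : e.inverse.Monoidal := e.inverseMonoidal
  have hm : e.IsMonoidal := ⟨rfl, fun _ _ => rfl⟩
  refine ⟨⟨fun X Y => ?_⟩⟩
  apply e.functor.map_injective
  rw [← cancel_epi (Functor.LaxMonoidal.μ e.functor (e.inverse.obj X) (e.inverse.obj Y)),
    ← cancel_mono (e.counit.app (MonoidalCategoryStruct.tensorObj Y X))]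
  have key : ∀ X Y : D,
      Functor.LaxMonoidal.μ e.functor (e.inverse.obj X) (e.inverse.obj Y) ≫
        e.functor.map (Functor.LaxMonoidal.μ e.inverse X Y) ≫
          e.counit.app (MonoidalCategoryStruct.tensorObj X Y) =
        MonoidalCategoryStruct.tensorHom (e.counit.app X) (e.counit.app Y) := fun X Y => by
    rw [Equivalence.functor_map_μ_inverse_comp_counit_app_tensor, Functor.Monoidal.μ_δ_assoc]
  have nat := e.counit.naturality (BraidedCategory.braiding X Y).hom
  simp only [Functor.comp_map, Functor.id_map] at nat
  simp only [Functor.map_comp, Category.assoc]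
  rw [nat, reassoc_of% (key X Y), Functor.LaxBraided.braided_assoc, key Y X]
  simp

namespace BraidedMoritaEquivalent

variable {k : Type u} [Field k] {A B C : Type u} [Ring A] [Bialgebra k A]
  [Ring B] [Bialgebra k B] [Ring C] [Bialgebra k C]
  {R : RMatrix k A} {R' : RMatrix k B} {R'' : RMatrix k C}

theorem refl (R : RMatrix k A) : BraidedMoritaEquivalent R R :=
  ⟨𝟭 _, inferInstance, inferInstance, inferInstance, ⟨inferInstance⟩⟩

theorem trans (h : BraidedMoritaEquivalent R R') (h' : BraidedMoritaEquivalent R' R'') :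
    BraidedMoritaEquivalent R R'' := by
  obtain ⟨F, _, _, _, ⟨_⟩⟩ := h
  obtain ⟨G, _, _, _, ⟨_⟩⟩ := h'
  exact ⟨F ⋙ G, inferInstance, inferInstance, inferInstance, ⟨inferInstance⟩⟩

theorem symm (h : BraidedMoritaEquivalent R R') : BraidedMoritaEquivalent R' R := by
  obtain ⟨F, _, ha, hl, ⟨hb⟩⟩ := h
  have : F.asEquivalence.functor.Additive := ha
  have : F.asEquivalence.functor.Linear k := hl
  exact ⟨F.asEquivalence.inverse, inferInstance, inferInstance, inferInstance,
    nonempty_braided_inverse F.asEquivalence hb⟩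

end BraidedMoritaEquivalent
end

noncomputable section

/-- The dual space `A* = Hom(A, k)`, with the convolution product. -/
abbrev DualAlg (k : Type u) [Field k] (A : Type u) [Ring A] [Bialgebra k A] : Type u :=
  WithConv (A →ₗ[k] k)

namespace DualAlg

variable {k : Type u} [Field k] {A : Type u} [Ring A] [Bialgebra k A]

theorem conv_tensor {B : Type u} [Ring B] [Bialgebra k B] (f f' : A →ₗ[k] k) (g g' : B →ₗ[k] k)
    (s : A ⊗[k] A) (t : B ⊗[k] B) :
    LinearMap.mul' k k (TensorProduct.map (TensorProduct.dualDistrib k A B (f ⊗ₜ g))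
      (TensorProduct.dualDistrib k A B (f' ⊗ₜ g'))
        (AlgebraTensorModule.tensorTensorTensorComm k k k k A A B B (s ⊗ₜ t))) =
      LinearMap.mul' k k (TensorProduct.map f f' s) *
        LinearMap.mul' k k (TensorProduct.map g g' t) := by
  induction s with
  | zero => simp
  | add s s' hs hs' => simp only [map_add, add_tmul, hs, hs', add_mul]
  | tmul a b =>
    induction t with
    | zero => simp
    | add t t' ht ht' => simp only [map_add, tmul_add, ht, ht', mul_add]
    | tmul c d => simp; ring

theorem conv_mul (f g : A →ₗ[k] k) (s t : A ⊗[k] A) :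
    LinearMap.mul' k k (TensorProduct.map (f ∘ₗ LinearMap.mul' k A) (g ∘ₗ LinearMap.mul' k A)
        (AlgebraTensorModule.tensorTensorTensorComm k k k k A A A A (s ⊗ₜ t))) =
      LinearMap.mul' k k (TensorProduct.map f g (s * t)) := by
  induction s with
  | zero => simp
  | add s s' hs hs' => simp only [map_add, add_tmul, hs, hs', add_mul]
  | tmul a b =>
    induction t with
    | zero => simp
    | add t t' ht ht' => simp only [map_add, tmul_add, ht, ht', mul_add]
    | tmul c d => simp

/-- The pairing `(f ⊗ g)(a ⊗ b) = f(a) g(b)`, as an algebra homomorphism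
`A* ⊗ A* → (A ⊗ A)*` (both sides with their convolution products). -/
def pairHom (k : Type u) [Field k] (A : Type u) [Ring A] [Bialgebra k A]
    (B : Type u) [Ring B] [Bialgebra k B] :
    DualAlg k A ⊗[k] DualAlg k B →ₐ[k] DualAlg k (A ⊗[k] B) :=
  Algebra.TensorProduct.algHomOfLinearMapTensorProduct
    ((WithConv.linearEquiv k _).symm.toLinearMap ∘ₗ TensorProduct.dualDistrib k A B ∘ₗ
      TensorProduct.map (WithConv.linearEquiv k _).toLinearMap
        (WithConv.linearEquiv k _).toLinearMap)
    (fun f f' g g' => WithConv.ext (TensorProduct.ext' fun a b =>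
      (conv_tensor f.ofConv f'.ofConv g.ofConv g'.ofConv (Coalgebra.comul a)
        (Coalgebra.comul b)).symm))
    (by
      refine WithConv.ext (TensorProduct.ext' fun a b => ?_)
      simp [LinearMap.convOne_def, mul_comm])

@[simp] theorem pairHom_tmul_tmul {B : Type u} [Ring B] [Bialgebra k B] (f : DualAlg k A)
    (g : DualAlg k B) (a : A) (b : B) : pairHom k A B (f ⊗ₜ g) (a ⊗ₜ b) = f a * g b := by rfl

theorem pairHom_bijective {B : Type u} [Ring B] [Bialgebra k B] [Module.Finite k A]
    [Module.Finite k B] : Function.Bijective (pairHom k A B) := by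
  have h : ⇑(pairHom k A B) = (TensorProduct.congr (WithConv.linearEquiv k _)
      (WithConv.linearEquiv k _) ≪≫ₗ TensorProduct.dualDistribEquiv k A B ≪≫ₗ
        (WithConv.linearEquiv k _).symm) := by
    ext1 t
    induction t with
    | zero => simp
    | add s t hs ht => simp only [map_add, hs, ht]
    | tmul a b => rfl
  rw [h]
  exact LinearEquiv.bijective _

/-- For finite-dimensional `A`, `B`, the algebra isomorphism `A* ⊗ B* ≅ (A ⊗ B)*`. -/
def pairEquiv (k : Type u) [Field k] (A : Type u) [Ring A] [Bialgebra k A]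
    (B : Type u) [Ring B] [Bialgebra k B] [Module.Finite k A] [Module.Finite k B] :
    DualAlg k A ⊗[k] DualAlg k B ≃ₐ[k] DualAlg k (A ⊗[k] B) :=
  AlgEquiv.ofBijective (pairHom k A B) pairHom_bijective

/-- Restriction along the multiplication of `A`, `f ↦ (a ⊗ b ↦ f (a b))`. -/
def mulDual (k : Type u) [Field k] (A : Type u) [Ring A] [Bialgebra k A] :
    DualAlg k A →ₐ[k] DualAlg k (A ⊗[k] A) :=
  AlgHom.ofLinearMap
    ((WithConv.linearEquiv k _).symm.toLinearMap ∘ₗ LinearMap.lcomp k k (LinearMap.mul' k A) ∘ₗ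
      (WithConv.linearEquiv k _).toLinearMap)
    (by
      refine WithConv.ext (TensorProduct.ext' fun a b => ?_)
      simp [LinearMap.convOne_def, mul_comm])
    (fun f g => WithConv.ext (TensorProduct.ext' fun a b =>
      (congrArg (fun z => LinearMap.mul' k k (TensorProduct.map f.ofConv g.ofConv z))
        (Bialgebra.comul_mul a b)).trans
        (conv_mul f.ofConv g.ofConv (Coalgebra.comul a) (Coalgebra.comul b)).symm))

@[simp] theorem mulDual_tmul (f : DualAlg k A) (a b : A) :
  mulDual k A f (a ⊗ₜ b) = f (a * b) := rfl

/-- Evaluation at `1`, the counit of `A*`. -/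
def evalOne (k : Type u) [Field k] (A : Type u) [Ring A] [Bialgebra k A] : DualAlg k A →ₐ[k] k :=
  AlgHom.ofLinearMap (LinearMap.applyₗ (1 : A) ∘ₗ (WithConv.linearEquiv k _).toLinearMap)
    (by simp [LinearMap.convOne_def])
    (fun f g => by simp [Algebra.TensorProduct.one_def])

theorem pairHom_assoc (t : (DualAlg k A ⊗[k] DualAlg k A) ⊗[k] DualAlg k A) (a b c : A) :
    pairHom k A (A ⊗[k] A) (Algebra.TensorProduct.map (AlgHom.id k _) (pairHom k A A)
      (Algebra.TensorProduct.assoc k k k _ _ _ t)) (a ⊗ₜ (b ⊗ₜ c)) =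
    pairHom k (A ⊗[k] A) A (Algebra.TensorProduct.map (pairHom k A A) (AlgHom.id k _) t)
      ((a ⊗ₜ b) ⊗ₜ c) := by
  induction t with
  | zero => simp
  | add s t hs ht =>
    simp only [map_add, WithConv.ofConv_add, LinearMap.add_apply, hs, ht]
  | tmul s h =>
    induction s with
    | zero => simp
    | add s t hs ht =>
      simp only [map_add, add_tmul, WithConv.ofConv_add, LinearMap.add_apply, hs, ht]
    | tmul f g => simp [mul_assoc]

theorem evalOne_left (t : DualAlg k A ⊗[k] DualAlg k A) (a : A) :
    (TensorProduct.lid k _ (Algebra.TensorProduct.map (evalOne k A) (AlgHom.id k _) t)).ofConv a =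
      pairHom k A A t (1 ⊗ₜ a) := by
  induction t with
  | zero => simp
  | add s t hs ht => simp only [map_add, WithConv.ofConv_add, LinearMap.add_apply, hs, ht]
  | tmul f g => simp [evalOne]

theorem evalOne_right (t : DualAlg k A ⊗[k] DualAlg k A) (a : A) :
    (TensorProduct.rid k _ (Algebra.TensorProduct.map (AlgHom.id k _) (evalOne k A) t)).ofConv a =
      pairHom k A A t (a ⊗ₜ 1) := by
  induction t with
  | zero => simp
  | add s t hs ht => simp only [map_add, WithConv.ofConv_add, LinearMap.add_apply, hs, ht]
  | tmul f g => simp [evalOne, mul_comm]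

section finite

variable [Module.Finite k A]

/-- The comultiplication of `A*`: `Δ(f)(a ⊗ b) = f(a b)` under `A* ⊗ A* ≅ (A ⊗ A)*`. -/
def comulHom (k : Type u) [Field k] (A : Type u) [Ring A] [Bialgebra k A] [Module.Finite k A] :
    DualAlg k A →ₐ[k] DualAlg k A ⊗[k] DualAlg k A :=
  (pairEquiv k A A).symm.toAlgHom.comp (mulDual k A)

theorem pairHom_comulHom (f : DualAlg k A) : pairHom k A A (comulHom k A f) = mulDual k A f :=
  (pairEquiv k A A).apply_symm_apply _

theorem pairHom_comulHom_tmul (f : DualAlg k A) (a b : A) :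
    pairHom k A A (comulHom k A f) (a ⊗ₜ b) = f (a * b) := by
  rw [pairHom_comulHom, mulDual_tmul]

theorem pairHom_comul_left (t : DualAlg k A ⊗[k] DualAlg k A) (a b c : A) :
    pairHom k (A ⊗[k] A) A (Algebra.TensorProduct.map (pairHom k A A) (AlgHom.id k _)
      (Algebra.TensorProduct.map (comulHom k A) (AlgHom.id k _) t)) ((a ⊗ₜ b) ⊗ₜ c) =
      pairHom k A A t ((a * b) ⊗ₜ c) := by
  induction t with
  | zero => simp
  | add s t hs ht =>
    simp only [map_add, WithConv.ofConv_add, LinearMap.add_apply, hs, ht]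
  | tmul f g =>
    simp [pairHom_comulHom_tmul]

theorem pairHom_comul_right (t : DualAlg k A ⊗[k] DualAlg k A) (a b c : A) :
    pairHom k A (A ⊗[k] A) (Algebra.TensorProduct.map (AlgHom.id k _) (pairHom k A A)
      (Algebra.TensorProduct.map (AlgHom.id k _) (comulHom k A) t)) (a ⊗ₜ (b ⊗ₜ c)) =
      pairHom k A A t (a ⊗ₜ (b * c)) := by
  induction t with
  | zero => simp
  | add s t hs ht =>
    simp only [map_add, WithConv.ofConv_add, LinearMap.add_apply, hs, ht]
  | tmul f g =>
    simp [pairHom_comulHom_tmul]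

theorem ext_pair {t s : DualAlg k A ⊗[k] DualAlg k A}
    (h : ∀ a b, pairHom k A A t (a ⊗ₜ b) = pairHom k A A s (a ⊗ₜ b)) : t = s := by
  apply pairHom_bijective.1
  exact WithConv.ext (TensorProduct.ext' h)

theorem ext_pair_right {t s : DualAlg k A ⊗[k] (DualAlg k A ⊗[k] DualAlg k A)}
    (h : ∀ a b c,
      pairHom k A (A ⊗[k] A) (Algebra.TensorProduct.map (AlgHom.id k _) (pairHom k A A) t)
        (a ⊗ₜ (b ⊗ₜ c)) =
      pairHom k A (A ⊗[k] A) (Algebra.TensorProduct.map (AlgHom.id k _) (pairHom k A A) s)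
        (a ⊗ₜ (b ⊗ₜ c))) : t = s := by
  apply (Algebra.TensorProduct.congr (AlgEquiv.refl : DualAlg k A ≃ₐ[k] _)
    (pairEquiv k A A)).injective
  apply pairHom_bijective.1
  exact WithConv.ext (TensorProduct.ext (LinearMap.ext fun a => TensorProduct.ext' (h a)))

theorem ext_pair_left {t s : (DualAlg k A ⊗[k] DualAlg k A) ⊗[k] DualAlg k A}
    (h : ∀ a b c,
      pairHom k (A ⊗[k] A) A (Algebra.TensorProduct.map (pairHom k A A) (AlgHom.id k _) t)
        ((a ⊗ₜ b) ⊗ₜ c) =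
      pairHom k (A ⊗[k] A) A (Algebra.TensorProduct.map (pairHom k A A) (AlgHom.id k _) s)
        ((a ⊗ₜ b) ⊗ₜ c)) : t = s := by
  apply (Algebra.TensorProduct.congr (pairEquiv k A A)
    (AlgEquiv.refl : DualAlg k A ≃ₐ[k] _)).injective
  apply pairHom_bijective.1
  exact WithConv.ext (TensorProduct.ext_threefold h)

/-- The dual bialgebra of a finite-dimensional bialgebra: convolution product, comultiplication
dual to the multiplication, counit the evaluation at `1`. -/
instance : Bialgebra k (DualAlg k A) :=
  Bialgebra.ofAlgHom (comulHom k A) (evalOne k A)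
    (AlgHom.ext fun f => ext_pair_right fun a b c => by
      refine (pairHom_assoc _ a b c).trans ((pairHom_comul_left _ a b c).trans ?_)
      refine Eq.trans ?_ (pairHom_comul_right _ a b c).symm
      refine (pairHom_comulHom_tmul f (a * b) c).trans ?_
      exact (congrArg _ (mul_assoc a b c)).trans (pairHom_comulHom_tmul f a (b * c)).symm)
    (AlgHom.ext fun f => (TensorProduct.lid k _).injective <| WithConv.ext <|
      LinearMap.ext fun a => by
        simp only [AlgHom.comp_apply]
        rw [evalOne_left, pairHom_comulHom_tmul]
        simp)
    (AlgHom.ext fun f => (TensorProduct.rid k _).injective <| WithConv.ext <|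
      LinearMap.ext fun a => by
        simp only [AlgHom.comp_apply]
        rw [evalOne_right, pairHom_comulHom_tmul]
        simp)

theorem comulAlgHom_eq : Bialgebra.comulAlgHom k (DualAlg k A) = comulHom k A := rfl

theorem counit_apply (f : DualAlg k A) : Coalgebra.counit (R := k) f = f 1 := rfl

end finite

end DualAlg
end

noncomputable section

/-- A braiding of a bialgebra `A`: a linear functional `σ : A ⊗ A → k`, invertible for the
convolution product, such that for all `x, y, z`
* `∑ σ(x₁, y₁) x₂ y₂ = ∑ σ(x₂, y₂) y₁ x₁`,
* `σ(x y, z) = ∑ σ(x, z₁) σ(y, z₂)`,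
* `σ(x, y z) = ∑ σ(x₁, z) σ(x₂, y)`.
In the first condition the comultiplication is that of the coalgebra `A ⊗ A`, which sends `x ⊗ y`
to `∑ (x₁ ⊗ y₁) ⊗ (x₂ ⊗ y₂)`. -/
@[ext]
structure Braiding (k : Type u) [Field k] (A : Type u) [Ring A] [Bialgebra k A] where
  form : A ⊗[k] A →ₗ[k] k
  isUnit : IsUnit (WithConv.toConv form)
  comm : ∀ x y : A,
    TensorProduct.lid k A
        (TensorProduct.map form (LinearMap.mul' k A) (Coalgebra.comul (x ⊗ₜ[k] y))) =
      TensorProduct.rid k A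
        (TensorProduct.map (LinearMap.mul' k A ∘ₗ (TensorProduct.comm k A A).toLinearMap) form
          (Coalgebra.comul (x ⊗ₜ[k] y)))
  mul_left : ∀ x y z : A,
    form ((x * y) ⊗ₜ z) =
      LinearMap.mul' k k (TensorProduct.map (form ∘ₗ TensorProduct.mk k A A x)
        (form ∘ₗ TensorProduct.mk k A A y) (Coalgebra.comul z))
  mul_right : ∀ x y z : A,
    form (x ⊗ₜ (y * z)) =
      LinearMap.mul' k k (TensorProduct.map (form ∘ₗ (TensorProduct.mk k A A).flip z)
        (form ∘ₗ (TensorProduct.mk k A A).flip y) (Coalgebra.comul x))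

namespace Braiding

open DualAlg

variable {k : Type u} [Field k] {A : Type u} [Ring A] [Bialgebra k A]

theorem pairHom_flip (t : DualAlg k A ⊗[k] DualAlg k A) (a b : A) :
    pairHom k A A (Algebra.TensorProduct.comm k _ _ t) (a ⊗ₜ b) = pairHom k A A t (b ⊗ₜ a) := by
  induction t with
  | zero => simp
  | add s t hs ht => simp only [map_add, WithConv.ofConv_add, LinearMap.add_apply, hs, ht]
  | tmul f g => simp [mul_comm]

/-- `A* ⊗ A* ⊗ A*` evaluates on `a ⊗ b ⊗ c`: the product `R₁₃ R₂₃`. -/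
theorem pair_left_mul (t s : DualAlg k A ⊗[k] DualAlg k A) (a b c : A) :
    pairHom k (A ⊗[k] A) A (Algebra.TensorProduct.map (pairHom k A A) (AlgHom.id k _)
      (Algebra.TensorProduct.map (Algebra.TensorProduct.includeLeft :
          DualAlg k A →ₐ[k] DualAlg k A ⊗[k] DualAlg k A) (AlgHom.id k _) t *
        Algebra.TensorProduct.map (Algebra.TensorProduct.includeRight :
          DualAlg k A →ₐ[k] DualAlg k A ⊗[k] DualAlg k A) (AlgHom.id k _) s)) ((a ⊗ₜ b) ⊗ₜ c) =
      LinearMap.mul' k k (TensorProduct.map ((pairHom k A A t).ofConv ∘ₗ TensorProduct.mk k A A a)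
        ((pairHom k A A s).ofConv ∘ₗ TensorProduct.mk k A A b) (Coalgebra.comul c)) := by
  induction t with
  | zero => simp
  | add t t' ht ht' =>
    simp only [map_add, add_mul, WithConv.ofConv_add, LinearMap.add_apply, ht, ht',
      LinearMap.add_comp, TensorProduct.map_add_left]
  | tmul f g =>
    induction s with
    | zero => simp
    | add t t' ht ht' =>
      simp only [map_add, mul_add, WithConv.ofConv_add, LinearMap.add_apply, ht, ht',
        LinearMap.add_comp, TensorProduct.map_add_right]
    | tmul f' g' =>
      have h1 : (pairHom k A A (f ⊗ₜ g)).ofConv ∘ₗ TensorProduct.mk k A A a = f a • g.ofConv := by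
        ext; simp
      have h2 : (pairHom k A A (f' ⊗ₜ g')).ofConv ∘ₗ TensorProduct.mk k A A b =
          f' b • g'.ofConv := by
        ext; simp
      rw [h1, h2]
      simp [TensorProduct.map_smul_left, TensorProduct.map_smul_right]
      ring

/-- `A* ⊗ A* ⊗ A*` evaluates on `a ⊗ b ⊗ c`: the product `R₁₃ R₁₂`. -/
theorem pair_right_mul (t s : DualAlg k A ⊗[k] DualAlg k A) (a b c : A) :
    pairHom k A (A ⊗[k] A) (Algebra.TensorProduct.map (AlgHom.id k _) (pairHom k A A)
      (Algebra.TensorProduct.map (AlgHom.id k _) (Algebra.TensorProduct.includeRight :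
          DualAlg k A →ₐ[k] DualAlg k A ⊗[k] DualAlg k A) t *
        Algebra.TensorProduct.map (AlgHom.id k _) (Algebra.TensorProduct.includeLeft :
          DualAlg k A →ₐ[k] DualAlg k A ⊗[k] DualAlg k A) s)) (a ⊗ₜ (b ⊗ₜ c)) =
      LinearMap.mul' k k (TensorProduct.map
        ((pairHom k A A t).ofConv ∘ₗ (TensorProduct.mk k A A).flip c)
        ((pairHom k A A s).ofConv ∘ₗ (TensorProduct.mk k A A).flip b) (Coalgebra.comul a)) := by
  induction t with
  | zero => simp
  | add t t' ht ht' =>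
    simp only [map_add, add_mul, WithConv.ofConv_add, LinearMap.add_apply, ht, ht',
      LinearMap.add_comp, TensorProduct.map_add_left]
  | tmul f g =>
    induction s with
    | zero => simp
    | add t t' ht ht' =>
      simp only [map_add, mul_add, WithConv.ofConv_add, LinearMap.add_apply, ht, ht',
        LinearMap.add_comp, TensorProduct.map_add_right]
    | tmul f' g' =>
      have h1 : (pairHom k A A (f ⊗ₜ g)).ofConv ∘ₗ (TensorProduct.mk k A A).flip c =
          g c • f.ofConv := by
        ext; simp [mul_comm]
      have h2 : (pairHom k A A (f' ⊗ₜ g')).ofConv ∘ₗ (TensorProduct.mk k A A).flip b =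
          g' b • f'.ofConv := by
        ext; simp [mul_comm]
      rw [h1, h2]
      simp [TensorProduct.map_smul_left, TensorProduct.map_smul_right]
      ring

variable [Module.Finite k A]

/-- A braiding `σ` of a finite-dimensional bialgebra `A`, regarded as an element of
`A* ⊗ A* ≅ (A ⊗ A)*`, is a universal `R`-matrix of the dual bialgebra `A*`. -/
def toRMatrix (σ : Braiding k A) : RMatrix k (DualAlg k A) where
  elt := (pairEquiv k A A).symm (WithConv.toConv σ.form)
  isUnit := σ.isUnit.map (pairEquiv k A A).symm
  comul_op f := by
    have hσ : pairHom k A A ((pairEquiv k A A).symm (WithConv.toConv σ.form)) =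
      WithConv.toConv σ.form := (pairEquiv k A A).apply_symm_apply _
    apply ext_pair
    intro a b
    rw [map_mul, map_mul, hσ, comulAlgHom_eq]
    have h1 : pairHom k A A (Algebra.TensorProduct.comm k _ _ (comulHom k A f)) =
        WithConv.toConv
          (f.ofConv ∘ₗ LinearMap.mul' k A ∘ₗ (TensorProduct.comm k A A).toLinearMap) :=
      WithConv.ext (TensorProduct.ext' fun x y => by
        rw [pairHom_flip, pairHom_comulHom_tmul]; simp)
    have h2 : pairHom k A A (comulHom k A f) =
        WithConv.toConv (f.ofConv ∘ₗ LinearMap.mul' k A) :=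
      WithConv.ext (TensorProduct.ext' fun x y => by
        rw [pairHom_comulHom_tmul]; simp)
    have e1 : ∀ t : (A ⊗[k] A) ⊗[k] (A ⊗[k] A),
        LinearMap.mul' k k (TensorProduct.map
          (f.ofConv ∘ₗ LinearMap.mul' k A ∘ₗ (TensorProduct.comm k A A).toLinearMap) σ.form t) =
        f (TensorProduct.rid k A
        (TensorProduct.map (LinearMap.mul' k A ∘ₗ (TensorProduct.comm k A A).toLinearMap) σ.form
          t)) := by
      intro t
      induction t with
      | zero => simp
      | add t t' ht ht' => simp only [map_add, ht, ht']
      | tmul x y => simp [mul_comm]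
    have e2 : ∀ t : (A ⊗[k] A) ⊗[k] (A ⊗[k] A),
        LinearMap.mul' k k (TensorProduct.map σ.form (f.ofConv ∘ₗ LinearMap.mul' k A) t) =
        f (TensorProduct.lid k A (TensorProduct.map σ.form (LinearMap.mul' k A) t)) := by
      intro t
      induction t with
      | zero => simp
      | add t t' ht ht' => simp only [map_add, ht, ht']
      | tmul x y => simp
    rw [h1, h2, LinearMap.convMul_apply, LinearMap.convMul_apply]
    simp only
    rw [e1, e2, σ.comm]
  comul_left := by
    have hσ : pairHom k A A ((pairEquiv k A A).symm (WithConv.toConv σ.form)) =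
      WithConv.toConv σ.form := (pairEquiv k A A).apply_symm_apply _
    apply ext_pair_left
    intro a b c
    rw [pair_left_mul, comulAlgHom_eq, pairHom_comul_left, hσ]
    exact σ.mul_left a b c
  comul_right := by
    have hσ : pairHom k A A ((pairEquiv k A A).symm (WithConv.toConv σ.form)) =
      WithConv.toConv σ.form := (pairEquiv k A A).apply_symm_apply _
    apply ext_pair_right
    intro a b c
    rw [pair_right_mul, comulAlgHom_eq, pairHom_comul_right, hσ]
    exact σ.mul_right a b c

/-- The braided Hopf algebras `(A, σ)` and `(B, σ')`, with `A` and `B` finite-dimensional, are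
braided Morita equivalent if the quasitriangular Hopf algebras `(A*, σ)` and `(B*, σ')` are. -/
def MoritaEquivalent {B : Type u} [Ring B] [Bialgebra k B] [Module.Finite k B]
    (σ : Braiding k A) (σ' : Braiding k B) : Prop :=
  BraidedMoritaEquivalent σ.toRMatrix σ'.toRMatrix

/-- Braided Morita equivalence as an equivalence relation on the set of braidings of `A`. -/
def moritaSetoid (k : Type u) [Field k] (A : Type u) [Ring A] [Bialgebra k A]
    [Module.Finite k A] : Setoid (Braiding k A) where
  r σ σ' := MoritaEquivalent σ σ'
  iseqv := ⟨fun _ => .refl _, fun h => h.symm, fun h h' => h.trans h'⟩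

end Braiding
end

noncomputable section

/-- The defining relations of the Kac–Paljutkin algebra, on generators `X i j` with
`i, j ∈ {0, 1}`. -/
inductive H8.Rel (k : Type u) [Field k] :
    FreeAlgebra k (Fin 2 × Fin 2) → FreeAlgebra k (Fin 2 × Fin 2) → Prop
  | sq_diag : Rel k (FreeAlgebra.ι k (0, 0) ^ 2) (FreeAlgebra.ι k (1, 1) ^ 2)
  | sq_offdiag : Rel k (FreeAlgebra.ι k (0, 1) ^ 2) (FreeAlgebra.ι k (1, 0) ^ 2)
  | mixed (i j l m : Fin 2) (h : i - j ≠ l - m) :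
      Rel k (FreeAlgebra.ι k (i, j) * FreeAlgebra.ι k (l, m)) 0
  | unit : Rel k (FreeAlgebra.ι k (0, 0) ^ 2 + FreeAlgebra.ι k (0, 1) ^ 2) 1
  | comm : Rel k (FreeAlgebra.ι k (0, 0) * FreeAlgebra.ι k (1, 1))
      (FreeAlgebra.ι k (1, 1) * FreeAlgebra.ι k (0, 0))
  | anticomm : Rel k (FreeAlgebra.ι k (0, 1) * FreeAlgebra.ι k (1, 0) +
      FreeAlgebra.ι k (1, 0) * FreeAlgebra.ι k (0, 1)) 0

/-- The Kac–Paljutkin algebra `H₈` over `k`: the algebra generated by `x i j`, `i, j ∈ {0, 1}`,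
with the relations `x₀₀² = x₁₁²`, `x₀₁² = x₁₀²`, `x i j * x l m = 0` for `i - j ≢ l - m` mod 2,
`x₀₀² + x₀₁² = 1`, `x₀₀ x₁₁ = x₁₁ x₀₀` and `x₀₁ x₁₀ + x₁₀ x₀₁ = 0`. -/
def H8 (k : Type u) [Field k] : Type u := RingQuot (H8.Rel k)

namespace H8

variable (k : Type u) [Field k]

instance : Ring (H8 k) := inferInstanceAs (Ring (RingQuot (H8.Rel k)))
instance : Algebra k (H8 k) := inferInstanceAs (Algebra k (RingQuot (H8.Rel k)))

/-- The quotient map from the free algebra. -/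
def proj : FreeAlgebra k (Fin 2 × Fin 2) →ₐ[k] H8 k := RingQuot.mkAlgHom k (H8.Rel k)

/-- The generators of `H₈`. -/
def x (i j : Fin 2) : H8 k := proj k (FreeAlgebra.ι k (i, j))

variable {k}

theorem proj_rel {a b : FreeAlgebra k (Fin 2 × Fin 2)} (h : Rel k a b) : proj k a = proj k b :=
  RingQuot.mkAlgHom_rel k h

theorem proj_surjective : Function.Surjective (proj k) := RingQuot.mkAlgHom_surjective k (Rel k)

theorem sq_diag : x k 1 1 * x k 1 1 = x k 0 0 * x k 0 0 := by
  have := proj_rel (Rel.sq_diag (k := k))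
  simp only [pow_two, map_mul] at this
  exact this.symm

theorem sq_offdiag : x k 1 0 * x k 1 0 = x k 0 1 * x k 0 1 := by
  have := proj_rel (Rel.sq_offdiag (k := k))
  simp only [pow_two, map_mul] at this
  exact this.symm

theorem mixed {i j l m : Fin 2} (h : i - j ≠ l - m) : x k i j * x k l m = 0 := by
  have := proj_rel (Rel.mixed (k := k) i j l m h)
  rwa [map_mul, map_zero] at this

theorem unit_rel : x k 0 0 * x k 0 0 + x k 0 1 * x k 0 1 = 1 := by
  have := proj_rel (Rel.unit (k := k))
  simp only [pow_two, map_add, map_mul, map_one] at this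
  exact this

theorem comm_rel : x k 1 1 * x k 0 0 = x k 0 0 * x k 1 1 := by
  have := proj_rel (Rel.comm (k := k))
  simp only [map_mul] at this
  exact this.symm

theorem anticomm_rel : x k 1 0 * x k 0 1 = -(x k 0 1 * x k 1 0) := by
  have := proj_rel (Rel.anticomm (k := k))
  simp only [map_add, map_mul, map_zero] at this
  exact eq_neg_of_add_eq_zero_right this

/-- The universal property of `H₈`. -/
def lift {B : Type u} [Ring B] [Algebra k B] (f : Fin 2 → Fin 2 → B)
    (h1 : f 0 0 * f 0 0 = f 1 1 * f 1 1) (h2 : f 0 1 * f 0 1 = f 1 0 * f 1 0)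
    (h3 : ∀ i j l m, i - j ≠ l - m → f i j * f l m = 0)
    (h4 : f 0 0 * f 0 0 + f 0 1 * f 0 1 = 1) (h5 : f 0 0 * f 1 1 = f 1 1 * f 0 0)
    (h6 : f 0 1 * f 1 0 + f 1 0 * f 0 1 = 0) : H8 k →ₐ[k] B :=
  RingQuot.liftAlgHom k ⟨FreeAlgebra.lift k fun p => f p.1 p.2, by
    intro a b hab
    cases hab with
    | sq_diag => simpa [pow_two] using h1
    | sq_offdiag => simpa [pow_two] using h2
    | mixed i j l m h => simpa using h3 i j l m h
    | unit => simpa [pow_two] using h4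
    | comm => simpa using h5
    | anticomm => simpa using h6⟩

@[simp]
theorem lift_x {B : Type u} [Ring B] [Algebra k B] (f : Fin 2 → Fin 2 → B)
    (h1 h2 h3 h4 h5 h6) (i j : Fin 2) : lift (k := k) f h1 h2 h3 h4 h5 h6 (x k i j) = f i j := by
  refine (RingQuot.liftAlgHom_mkAlgHom_apply k _ _ _).trans ?_
  rw [FreeAlgebra.lift_ι_apply]

theorem algHom_ext {B : Type u} [Ring B] [Algebra k B] {f g : H8 k →ₐ[k] B}
    (h : ∀ i j, f (x k i j) = g (x k i j)) : f = g :=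
  RingQuot.ringQuot_ext' k f g (FreeAlgebra.hom_ext (funext fun p => h p.1 p.2))

/-- To prove a linear statement on `H₈` it is enough to check it at `1` and to see that it is
stable under left multiplication by generators. -/
theorem span_induction {P : H8 k → Prop} (h1 : P 1) (hadd : ∀ a b, P a → P b → P (a + b))
    (hsmul : ∀ (c : k) a, P a → P (c • a)) (hmul : ∀ i j a, P a → P (x k i j * a)) (a : H8 k) :
    P a := by
  have key : ∀ (p : FreeAlgebra k (Fin 2 × Fin 2)) (b : H8 k), P b →
      P (proj k p * b) := by
    intro p
    induction p using FreeAlgebra.induction with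
    | grade0 r =>
      intro b hb
      have e : proj k (algebraMap k _ r) * b = r • b := by
        rw [AlgHom.commutes]
        exact (Algebra.smul_def r b).symm
      rw [e]
      exact hsmul r b hb
    | grade1 v => exact fun b hb => hmul v.1 v.2 b hb
    | mul p q hp hq =>
      intro b hb
      rw [map_mul]
      have := hp _ (hq b hb)
      rwa [← mul_assoc] at this
    | add p q hp hq =>
      intro b hb
      rw [map_add]
      have := hadd _ _ (hp b hb) (hq b hb)
      rwa [← add_mul] at this
  obtain ⟨p, rfl⟩ := proj_surjective a
  have := key p 1 h1
  rwa [mul_one] at this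

variable (k) in
/-- The comultiplication `x i j ↦ x i 0 ⊗ x 0 j + x i 1 ⊗ x 1 j`. -/
def comulHom : H8 k →ₐ[k] H8 k ⊗[k] H8 k :=
  lift (fun i j => x k i 0 ⊗ₜ x k 0 j + x k i 1 ⊗ₜ x k 1 j)
    (by simp [add_mul, mul_add, mixed, sq_diag, sq_offdiag, add_comm])
    (by simp [add_mul, mul_add, mixed, sq_diag, sq_offdiag, add_comm])
    (by
      intro i j l m h
      fin_cases i <;> fin_cases j <;> fin_cases l <;> fin_cases m <;>
        first
        | exact absurd rfl h
        | simp [add_mul, mul_add, mixed])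
    (by
      rw [Algebra.TensorProduct.one_def, ← unit_rel]
      simp only [add_mul, mul_add, Algebra.TensorProduct.tmul_mul_tmul, TensorProduct.add_tmul,
        TensorProduct.tmul_add]
      simp [mixed, sq_offdiag, sq_diag]
      abel_nf)
    (by simp [add_mul, mul_add, mixed, comm_rel, anticomm_rel, neg_tmul, tmul_neg, add_comm])
    (by simp [add_mul, mul_add, mixed, comm_rel, anticomm_rel, neg_tmul, tmul_neg])

variable (k) in
/-- The counit `x i j ↦ δ i j`. -/
def counitHom : H8 k →ₐ[k] k :=
  lift (fun i j => if i = j then 1 else 0) (by simp) (by simp)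
    (by
      intro i j l m h
      fin_cases i <;> fin_cases j <;> fin_cases l <;> fin_cases m <;> simp at h ⊢)
    (by simp) (by simp) (by simp)

@[simp] theorem comulHom_x (i j : Fin 2) :
    comulHom k (x k i j) = x k i 0 ⊗ₜ x k 0 j + x k i 1 ⊗ₜ x k 1 j := lift_x ..

@[simp] theorem counitHom_x (i j : Fin 2) :
    counitHom k (x k i j) = if i = j then 1 else 0 := lift_x ..

instance : Bialgebra k (H8 k) :=
  Bialgebra.ofAlgHom (comulHom k) (counitHom k)
    (algHom_ext fun i j => by
      simp [add_tmul, tmul_add]; abel)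
    (algHom_ext fun i j => by
      fin_cases i <;> simp)
    (algHom_ext fun i j => by
      fin_cases j <;> simp)

@[simp] theorem comul_x (i j : Fin 2) :
    Coalgebra.comul (R := k) (x k i j) = x k i 0 ⊗ₜ x k 0 j + x k i 1 ⊗ₜ x k 1 j := comulHom_x i j

@[simp] theorem counit_x (i j : Fin 2) :
    Coalgebra.counit (R := k) (x k i j) = if i = j then 1 else 0 := counitHom_x i j

/-! ### The antipode -/

theorem unit_rel_right (a b : Fin 2) :
    x k a 0 * x k b 0 + x k a 1 * x k b 1 = if a = b then 1 else 0 := by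
  have h := unit_rel (k := k)
  fin_cases a <;> fin_cases b <;> simp [mixed, sq_diag, sq_offdiag, h]
  rw [add_comm, h]

theorem unit_rel_left (a b : Fin 2) :
    x k 0 a * x k 0 b + x k 1 a * x k 1 b = if a = b then 1 else 0 := by
  have h := unit_rel (k := k)
  fin_cases a <;> fin_cases b <;> simp [mixed, sq_diag, sq_offdiag, h]
  rw [add_comm, h]

variable (k) in
/-- The antipode `x i j ↦ x j i`, as an algebra homomorphism to the opposite algebra. (Note that
`x j i = (x j i)³` in `H₈`.) -/
def antipodeHom : H8 k →ₐ[k] (H8 k)ᵐᵒᵖ :=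
  lift (fun i j => MulOpposite.op (x k j i))
    (by simp [← MulOpposite.op_mul, sq_diag])
    (by simp [← MulOpposite.op_mul, sq_offdiag])
    (by
      intro i j l m h
      rw [← MulOpposite.op_mul, mixed, MulOpposite.op_zero]
      revert h
      revert i j l m
      decide)
    (by
      have h := unit_rel_right (k := k) 1 1
      simp only [sq_diag] at h
      rw [← MulOpposite.op_mul, ← MulOpposite.op_mul, ← MulOpposite.op_add, add_comm, h]
      rfl)
    (by simp [← MulOpposite.op_mul, comm_rel])
    (by simp [← MulOpposite.op_mul, ← MulOpposite.op_add, anticomm_rel])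

variable (k) in
/-- The antipode as a linear map. -/
def antipodeLin : H8 k →ₗ[k] H8 k :=
  (MulOpposite.opLinearEquiv k).symm.toLinearMap ∘ₗ (antipodeHom k).toLinearMap

@[simp] theorem antipodeLin_x (i j : Fin 2) : antipodeLin k (x k i j) = x k j i := by
  simp [antipodeLin, antipodeHom]

theorem antipodeLin_mul (a b : H8 k) :
    antipodeLin k (a * b) = antipodeLin k b * antipodeLin k a := by
  simp [antipodeLin]

theorem antipodeLin_one : antipodeLin k (1 : H8 k) = 1 := by
  simp [antipodeLin]

theorem comul_x_mul (i j : Fin 2) (a : H8 k) : Coalgebra.comul (R := k) (x k i j * a) =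
    (x k i 0 ⊗ₜ x k 0 j + x k i 1 ⊗ₜ x k 1 j) * Coalgebra.comul (R := k) a := by
  rw [Bialgebra.comul_mul, comul_x]

instance : HopfAlgebra k (H8 k) where
  antipode := antipodeLin k
  mul_antipode_rTensor_comul := by
    have key : ∀ (i j : Fin 2) (t : H8 k ⊗[k] H8 k),
        LinearMap.mul' k (H8 k) (LinearMap.rTensor (H8 k) (antipodeLin k)
          ((x k i 0 ⊗ₜ x k 0 j + x k i 1 ⊗ₜ x k 1 j) * t)) =
        (if i = j then (1 : k) else 0) •
          LinearMap.mul' k (H8 k) (LinearMap.rTensor (H8 k) (antipodeLin k) t) := by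
      intro i j t
      induction t with
      | zero => simp
      | add s t hs ht => simp only [mul_add, map_add, hs, ht, smul_add]
      | tmul c d =>
        have h := unit_rel_left (k := k) i j
        have h2 : antipodeLin k c * (x k 0 i * (x k 0 j * d)) +
            antipodeLin k c * (x k 1 i * (x k 1 j * d)) =
            antipodeLin k c * ((x k 0 i * x k 0 j + x k 1 i * x k 1 j) * d) := by
          simp only [mul_add, add_mul, mul_assoc]
        simp only [add_mul, Algebra.TensorProduct.tmul_mul_tmul, map_add,
          LinearMap.rTensor_tmul, LinearMap.mul'_apply, antipodeLin_mul, antipodeLin_x, mul_assoc]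
        rw [h2, h]
        split_ifs <;> simp
    refine LinearMap.ext fun a => ?_
    induction a using span_induction with
    | h1 => simp [Algebra.TensorProduct.one_def, antipodeLin_one]
    | hadd a b ha hb => simp only [map_add, ha, hb]
    | hsmul c a ha => simp only [map_smul, ha]
    | hmul i j a ha =>
      simp only [LinearMap.comp_apply] at ha ⊢
      rw [comul_x_mul, key, ha]
      by_cases h : i = j <;> simp [h]
  mul_antipode_lTensor_comul := by
    have key : ∀ (i j : Fin 2) (t : H8 k ⊗[k] H8 k),
        LinearMap.mul' k (H8 k) (LinearMap.lTensor (H8 k) (antipodeLin k)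
          ((x k i 0 ⊗ₜ x k 0 j + x k i 1 ⊗ₜ x k 1 j) * t)) =
        x k i 0 * LinearMap.mul' k (H8 k) (LinearMap.lTensor (H8 k) (antipodeLin k) t) * x k j 0 +
        x k i 1 * LinearMap.mul' k (H8 k) (LinearMap.lTensor (H8 k) (antipodeLin k) t) *
          x k j 1 := by
      intro i j t
      induction t with
      | zero => simp
      | add s t hs ht =>
        rw [mul_add, map_add, map_add, hs, ht]
        simp only [map_add, mul_add, add_mul]
        abel
      | tmul c d =>
        simp only [add_mul, Algebra.TensorProduct.tmul_mul_tmul, map_add,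
          LinearMap.lTensor_tmul, LinearMap.mul'_apply, antipodeLin_mul, antipodeLin_x, mul_assoc]
    refine LinearMap.ext fun a => ?_
    induction a using span_induction with
    | h1 => simp [Algebra.TensorProduct.one_def, antipodeLin_one]
    | hadd a b ha hb => simp only [map_add, ha, hb]
    | hsmul c a ha => simp only [map_smul, ha]
    | hmul i j a ha =>
      simp only [LinearMap.comp_apply, Algebra.linearMap_apply] at ha ⊢
      rw [comul_x_mul, key, ha, ← Algebra.commutes, ← Algebra.commutes, mul_assoc, mul_assoc,
        ← mul_add, unit_rel_right, Bialgebra.counit_mul, counit_x]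
      by_cases h : i = j <;> simp [h]

/-! ### Finite dimension -/

theorem cube_diag : x k 0 0 * (x k 0 0 * x k 0 0) = x k 0 0 := by
  have h := congrArg (fun z => x k 0 0 * z) (unit_rel (k := k))
  simpa [mul_add, ← mul_assoc (x k 0 0) (x k 0 1), mixed] using h

theorem cube_offdiag : x k 0 1 * (x k 0 1 * x k 0 1) = x k 0 1 := by
  have h := congrArg (fun z => x k 0 1 * z) (unit_rel (k := k))
  simpa [mul_add, ← mul_assoc (x k 0 1) (x k 0 0), mixed] using h

theorem diag_sq : x k 1 1 * (x k 0 0 * x k 0 0) = x k 1 1 := by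
  have h := congrArg (fun z => x k 1 1 * z) (unit_rel (k := k))
  simpa [mul_add, ← mul_assoc (x k 1 1) (x k 0 1), mixed] using h

theorem offdiag_sq : x k 1 0 * (x k 0 1 * x k 0 1) = x k 1 0 := by
  have h := congrArg (fun z => x k 1 0 * z) (unit_rel (k := k))
  simpa [mul_add, ← mul_assoc (x k 1 0) (x k 0 0), mixed] using h

theorem diag_mul : x k 0 0 * (x k 0 0 * x k 1 1) = x k 1 1 := by
  rw [← comm_rel, ← mul_assoc, ← comm_rel, mul_assoc, diag_sq]

theorem diag_mul' : x k 1 1 * (x k 0 0 * x k 1 1) = x k 0 0 := by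
  rw [← comm_rel, ← mul_assoc, sq_diag, mul_assoc, cube_diag]

theorem offdiag_mul' : x k 1 0 * (x k 0 1 * x k 1 0) = -x k 0 1 := by
  rw [← mul_assoc, anticomm_rel, neg_mul, mul_assoc, sq_offdiag, cube_offdiag]

theorem offdiag_mul : x k 0 1 * (x k 0 1 * x k 1 0) = x k 1 0 := by
  have h := anticomm_rel (k := k)
  rw [eq_neg_iff_add_eq_zero, add_comm, ← eq_neg_iff_add_eq_zero] at h
  rw [h, mul_neg, ← mul_assoc, h, neg_mul, neg_neg, mul_assoc, offdiag_sq]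

theorem mixed' {i j l m : Fin 2} (h : i - j ≠ l - m) (w : H8 k) :
    x k i j * (x k l m * w) = 0 := by
  rw [← mul_assoc, mixed h, zero_mul]

variable (k) in
/-- Eight elements that span `H₈`. -/
def gens : Fin 8 → H8 k :=
  ![x k 0 0, x k 1 1, x k 0 1, x k 1 0, x k 0 0 * x k 0 0, x k 0 1 * x k 0 1,
    x k 0 0 * x k 1 1, x k 0 1 * x k 1 0]

theorem x_mul_gens (S : Submodule k (H8 k)) (h0 : x k 0 0 ∈ S) (h1 : x k 1 1 ∈ S)
    (h2 : x k 0 1 ∈ S) (h3 : x k 1 0 ∈ S) (h4 : x k 0 0 * x k 0 0 ∈ S)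
    (h5 : x k 0 1 * x k 0 1 ∈ S) (h6 : x k 0 0 * x k 1 1 ∈ S) (h7 : x k 0 1 * x k 1 0 ∈ S)
    (i j : Fin 2) (n : Fin 8) : x k i j * gens k n ∈ S := by
  fin_cases i <;> fin_cases j <;> fin_cases n <;>
    simp [gens, mixed, mixed', sq_diag, sq_offdiag, comm_rel, anticomm_rel, cube_diag,
      cube_offdiag, diag_sq, offdiag_sq, diag_mul, diag_mul', offdiag_mul, offdiag_mul',
      h0, h1, h2, h3, h4, h5, h6, h7]

theorem span_gens : Submodule.span k (Set.range (gens k)) = ⊤ := by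
  have hg : ∀ n, gens k n ∈ Submodule.span k (Set.range (gens k)) :=
    fun n => Submodule.subset_span ⟨n, rfl⟩
  rw [eq_top_iff]
  rintro a -
  induction a using span_induction with
  | h1 => rw [← unit_rel]; exact add_mem (hg 4) (hg 5)
  | hadd a b ha hb => exact add_mem ha hb
  | hsmul c a ha => exact Submodule.smul_mem _ c ha
  | hmul i j a ha =>
    induction ha using Submodule.span_induction with
    | zero => rw [mul_zero]; exact zero_mem _
    | add a b _ _ ha hb => rw [mul_add]; exact add_mem ha hb
    | smul c a _ ha => rw [mul_smul_comm]; exact Submodule.smul_mem _ c ha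
    | mem z hz =>
      obtain ⟨n, rfl⟩ := hz
      exact x_mul_gens _ (hg 0) (hg 1) (hg 2) (hg 3) (hg 4) (hg 5) (hg 6) (hg 7) i j n

instance : Module.Finite k (H8 k) :=
  .of_fg_top (span_gens (k := k) ▸ Submodule.fg_span (Set.finite_range (gens k)))

end H8
end

noncomputable section
namespace H8
variable {k : Type u} [Field k]

/-- The group `ℤ/2 × ℤ/2`, written multiplicatively. -/
abbrev G : Type := Multiplicative (ZMod 2 × ZMod 2)

/-- The two standard generators of `ℤ/2 × ℤ/2`. -/
def e (i : Fin 2) : G := Multiplicative.ofAdd (if i = 0 then (1, 0) else (0, 1))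

/-- The bicharacter of `ℤ/2 × ℤ/2` with `(e₀, e₀) ↦ γ`, `(e₁, e₁) ↦ γ`, `(e₀, e₁) ↦ δ` and
`(e₁, e₀) ↦ -δ`. -/
def bichar (γ δ : ℤˣ) (p q : G) : ℤˣ :=
  γ ^ (p.toAdd.1 * q.toAdd.1 + p.toAdd.2 * q.toAdd.2).val *
    (δ ^ (p.toAdd.1 * q.toAdd.2).val * (-δ) ^ (p.toAdd.2 * q.toAdd.1).val)

theorem bichar_mul_left (γ δ : ℤˣ) (p q r : G) :
    bichar γ δ (p * q) r = bichar γ δ p r * bichar γ δ q r := by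
  revert γ δ p q r; decide

theorem bichar_mul_right (γ δ : ℤˣ) (p q r : G) :
    bichar γ δ p (q * r) = bichar γ δ p q * bichar γ δ p r := by
  revert γ δ p q r; decide

theorem bichar_one_left (γ δ : ℤˣ) (p : G) : bichar γ δ 1 p = 1 := by
  revert γ δ p; decide

theorem bichar_one_right (γ δ : ℤˣ) (p : G) : bichar γ δ p 1 = 1 := by
  revert γ δ p; decide

theorem bichar_mul_self (γ δ : ℤˣ) (p q : G) : bichar γ δ p q * bichar γ δ p q = 1 := by
  revert γ δ p q; decide

theorem bichar_e (γ δ : ℤˣ) (i l : Fin 2) : bichar γ δ (e i) (e l) =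
    if i = l then γ else if i = 0 then δ else -δ := by
  revert γ δ i l; decide

variable (k) in
/-- For `p` in `ℤ/2 × ℤ/2`, the character `q ↦ bichar p q` on the group algebra. -/
def charHom (γ δ : ℤˣ) (p : G) : MonoidAlgebra k G →ₐ[k] k :=
  MonoidAlgebra.lift k k G
    { toFun := fun q => ((bichar γ δ p q : ℤ) : k)
      map_one' := by rw [bichar_one_right]; simp
      map_mul' := fun q r => by rw [bichar_mul_right]; simp }

@[simp] theorem charHom_single (γ δ : ℤˣ) (p q : G) (c : k) :
    charHom k γ δ p (MonoidAlgebra.single q c) = c * ((bichar γ δ p q : ℤ) : k) := by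
  simp [charHom]

variable (k) in
/-- The bicharacter extended to the group algebra, `u ↦ (v ↦ β(u, v))`. -/
def bicharHom (γ δ : ℤˣ) : MonoidAlgebra k G →ₐ[k] DualAlg k (MonoidAlgebra k G) :=
  MonoidAlgebra.lift k (DualAlg k (MonoidAlgebra k G)) G
    { toFun := fun p => WithConv.toConv (charHom k γ δ p).toLinearMap
      map_one' := by
        refine WithConv.ext (MonoidAlgebra.lhom_ext' fun q => LinearMap.ext_ring ?_)
        simp [bichar_one_left, LinearMap.convOne_def]
      map_mul' := fun p p' => by
        refine WithConv.ext (MonoidAlgebra.lhom_ext' fun q => LinearMap.ext_ring ?_)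
        simp [bichar_mul_left] }

theorem bicharHom_single (γ δ : ℤˣ) (p : G) (c : k) (v : MonoidAlgebra k G) :
    bicharHom k γ δ (MonoidAlgebra.single p c) v = c * charHom k γ δ p v := by
  simp [bicharHom]

variable (k) in
/-- The bialgebra map `H₈ → k[ℤ/2 × ℤ/2]`, `x i i ↦ e i`, `x i j ↦ 0` for `i ≠ j`. -/
def toGroup : H8 k →ₐc[k] MonoidAlgebra k G :=
  BialgHom.ofAlgHom
    (lift (fun i j => if i = j then MonoidAlgebra.single (e i) 1 else 0)
      (by simp [MonoidAlgebra.single_mul_single]; rfl)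
      (by simp)
      (by
        intro i j l m h
        fin_cases i <;> fin_cases j <;> fin_cases l <;> fin_cases m <;> simp at h ⊢)
      (by simp [MonoidAlgebra.single_mul_single]; rfl)
      (by simp [MonoidAlgebra.single_mul_single]; rfl)
      (by simp))
    (algHom_ext fun i j => by
      fin_cases i <;> fin_cases j <;> simp)
    (algHom_ext fun i j => by
      fin_cases i <;> fin_cases j <;> simp)

@[simp] theorem toGroup_x (i j : Fin 2) :
    toGroup k (x k i j) = if i = j then MonoidAlgebra.single (e i) 1 else 0 := by
  exact lift_x ..

variable (k) in
/-- The bicharacter as a linear functional on `k[G] ⊗ k[G]`. -/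
def bicharForm (γ δ : ℤˣ) : MonoidAlgebra k G ⊗[k] MonoidAlgebra k G →ₗ[k] k :=
  TensorProduct.lift ((WithConv.linearEquiv k _).toLinearMap ∘ₗ (bicharHom k γ δ).toLinearMap)

theorem bicharForm_tmul (γ δ : ℤˣ) (u v : MonoidAlgebra k G) :
    bicharForm k γ δ (u ⊗ₜ v) = bicharHom k γ δ u v := rfl

theorem bicharForm_single (γ δ : ℤˣ) (p q : G) (c d : k) :
    bicharForm k γ δ (MonoidAlgebra.single p c ⊗ₜ MonoidAlgebra.single q d) =
      c * (d * ((bichar γ δ p q : ℤ) : k)) := by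
  rw [bicharForm_tmul, bicharHom_single, charHom_single]

theorem bicharForm_mul_left (γ δ : ℤˣ) (u v w : MonoidAlgebra k G) :
    bicharForm k γ δ ((u * v) ⊗ₜ w) =
      LinearMap.mul' k k (TensorProduct.map (bicharForm k γ δ ∘ₗ TensorProduct.mk k _ _ u)
        (bicharForm k γ δ ∘ₗ TensorProduct.mk k _ _ v) (Coalgebra.comul w)) := by
  rw [bicharForm_tmul, map_mul]
  rfl

theorem bicharForm_mul_right (γ δ : ℤˣ) (u v w : MonoidAlgebra k G) :
    bicharForm k γ δ (u ⊗ₜ (v * w)) =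
      LinearMap.mul' k k (TensorProduct.map
        (bicharForm k γ δ ∘ₗ (TensorProduct.mk k _ _).flip w)
        (bicharForm k γ δ ∘ₗ (TensorProduct.mk k _ _).flip v) (Coalgebra.comul u)) := by
  induction u using MonoidAlgebra.induction_linear with
  | zero => simp
  | add f g hf hg => simp only [add_tmul, map_add, hf, hg]
  | single p c =>
    rw [MonoidAlgebra.comul_single]
    simp [bicharForm_tmul, bicharHom_single]
    ring

theorem bicharForm_conv (γ δ : ℤˣ) : WithConv.toConv (bicharForm k γ δ) *
    WithConv.toConv (bicharForm k γ δ) = 1 := by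
  refine WithConv.ext (TensorProduct.ext (MonoidAlgebra.lhom_ext' fun p => LinearMap.ext_ring
    (MonoidAlgebra.lhom_ext' fun q => LinearMap.ext_ring ?_)))
  have h : ((bichar γ δ p q : ℤ) : k) * ((bichar γ δ p q : ℤ) : k) = 1 := by
    exact_mod_cast congrArg (fun z : ℤˣ => ((z : ℤ) : k)) (bichar_mul_self γ δ p q)
  simp [bicharForm_single, h, LinearMap.convOne_def]

variable (k) in
/-- The functional `x ⊗ y ↦ β(π x, π y)` on `H₈ ⊗ H₈`. -/
def tauForm (γ δ : ℤˣ) : H8 k ⊗[k] H8 k →ₗ[k] k :=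
  bicharForm k γ δ ∘ₗ TensorProduct.map (toGroup k : H8 k →ₐc[k] _).toCoalgHom.toLinearMap
    (toGroup k : H8 k →ₐc[k] _).toCoalgHom.toLinearMap

theorem tauForm_tmul (γ δ : ℤˣ) (a b : H8 k) :
    tauForm k γ δ (a ⊗ₜ b) = bicharForm k γ δ (toGroup k a ⊗ₜ toGroup k b) := rfl

theorem comul_toGroup (a : H8 k) : Coalgebra.comul (R := k) (toGroup k a) =
    TensorProduct.map (toGroup k : H8 k →ₐc[k] _).toCoalgHom.toLinearMap
      (toGroup k : H8 k →ₐc[k] _).toCoalgHom.toLinearMap (Coalgebra.comul (R := k) a) :=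
  (CoalgHomClass.map_comp_comul_apply (toGroup k) a).symm

theorem tauForm_conv (γ δ : ℤˣ) : WithConv.toConv (tauForm k γ δ) *
    WithConv.toConv (tauForm k γ δ) = 1 := by
  have h := congrArg WithConv.ofConv (bicharForm_conv (k := k) γ δ)
  let f : H8 k ⊗[k] H8 k →ₗc[k] MonoidAlgebra k G ⊗[k] MonoidAlgebra k G :=
    Coalgebra.TensorProduct.map (toGroup k : H8 k →ₐc[k] _).toCoalgHom
      (toGroup k : H8 k →ₐc[k] _).toCoalgHom
  have h2 := LinearMap.convMul_comp_coalgHom_distrib (WithConv.toConv (bicharForm k γ δ))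
    (WithConv.toConv (bicharForm k γ δ)) f
  rw [h] at h2
  refine WithConv.ext (h2.symm.trans ?_)
  exact congrArg (fun z => Algebra.linearMap k k ∘ₗ z) f.counit_comp

/-- `Word a g h`: `a` is a product of generators `x i j`, `g` is the product of the `e i` and `h`
the product of the `e j`. -/
inductive Word : H8 k → G → G → Prop
  | one : Word 1 1 1
  | cons (i j : Fin 2) {a : H8 k} {g h : G} (w : Word a g h) :
      Word (x k i j * a) (e i * g) (e j * h)

@[simp] theorem toGroup_toCoalgHom (a : H8 k) :
    (toGroup k : H8 k →ₐc[k] _).toCoalgHom a = toGroup k a := rfl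

theorem map_left_mul (s t : H8 k ⊗[k] H8 k) :
    TensorProduct.map (toGroup k : H8 k →ₐc[k] _).toCoalgHom.toLinearMap LinearMap.id (s * t) =
      TensorProduct.map (toGroup k : H8 k →ₐc[k] _).toCoalgHom.toLinearMap LinearMap.id s *
      TensorProduct.map (toGroup k : H8 k →ₐc[k] _).toCoalgHom.toLinearMap LinearMap.id t := by
  induction s with
  | zero => simp
  | add s s' hs hs' => simp only [add_mul, map_add, hs, hs']
  | tmul a b =>
    induction t with
    | zero => simp
    | add s s' hs hs' => simp only [mul_add, map_add, hs, hs']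
    | tmul c d => simp [map_mul]

theorem map_right_mul (s t : H8 k ⊗[k] H8 k) :
    TensorProduct.map LinearMap.id (toGroup k : H8 k →ₐc[k] _).toCoalgHom.toLinearMap (s * t) =
      TensorProduct.map LinearMap.id (toGroup k : H8 k →ₐc[k] _).toCoalgHom.toLinearMap s *
      TensorProduct.map LinearMap.id (toGroup k : H8 k →ₐc[k] _).toCoalgHom.toLinearMap t := by
  induction s with
  | zero => simp
  | add s s' hs hs' => simp only [add_mul, map_add, hs, hs']
  | tmul a b =>
    induction t with
    | zero => simp
    | add s s' hs hs' => simp only [mul_add, map_add, hs, hs']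
    | tmul c d => simp [map_mul]

theorem Word.comul_left {a : H8 k} {g h : G} (w : Word a g h) :
    TensorProduct.map (toGroup k : H8 k →ₐc[k] _).toCoalgHom.toLinearMap LinearMap.id
      (Coalgebra.comul (R := k) a) = MonoidAlgebra.single g 1 ⊗ₜ a := by
  induction w with
  | one => simp [Algebra.TensorProduct.one_def, MonoidAlgebra.one_def]
  | cons i j w ih =>
    rw [comul_x_mul, map_left_mul, ih]
    fin_cases i <;> simp [add_mul, MonoidAlgebra.single_mul_single]

theorem Word.comul_right {a : H8 k} {g h : G} (w : Word a g h) :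
    TensorProduct.map LinearMap.id (toGroup k : H8 k →ₐc[k] _).toCoalgHom.toLinearMap
      (Coalgebra.comul (R := k) a) = a ⊗ₜ MonoidAlgebra.single h 1 := by
  induction w with
  | one => simp [Algebra.TensorProduct.one_def, MonoidAlgebra.one_def]
  | cons i j w ih =>
    rw [comul_x_mul, map_right_mul, ih]
    fin_cases j <;> simp [add_mul, MonoidAlgebra.single_mul_single]

theorem gen_comm (γ δ : ℤˣ) (i j l m : Fin 2) :
    ((bichar γ δ (e i) (e l) : ℤ) : k) • (x k i j * x k l m) =
      ((bichar γ δ (e j) (e m) : ℤ) : k) • (x k l m * x k i j) := by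
  rw [bichar_e, bichar_e]
  fin_cases i <;> fin_cases j <;> fin_cases l <;> fin_cases m <;>
    simp [mixed, sq_diag, sq_offdiag, comm_rel, anticomm_rel]

theorem gen_word_comm (γ δ : ℤˣ) (i j : Fin 2) {b : H8 k} {g h : G} (w : Word b g h) :
    ((bichar γ δ (e i) g : ℤ) : k) • (x k i j * b) =
      ((bichar γ δ (e j) h : ℤ) : k) • (b * x k i j) := by
  induction w with
  | one => simp [bichar_one_right]
  | @cons l m b g h w ih =>
    have h1 := congrArg (fun z => ((bichar γ δ (e i) g : ℤ) : k) • (z * b)) (gen_comm γ δ i j l m)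
    have h2 := congrArg (fun z => ((bichar γ δ (e j) (e m) : ℤ) : k) • (x k l m * z)) ih
    simp only [bichar_mul_right, Units.val_mul, Int.cast_mul, smul_mul_assoc, mul_smul_comm,
      mul_assoc, smul_smul] at h1 h2 ⊢
    rw [mul_comm, h1, mul_comm, h2]

theorem word_comm (γ δ : ℤˣ) {a b : H8 k} {g h g' h' : G} (w : Word a g h) (w' : Word b g' h') :
    ((bichar γ δ g g' : ℤ) : k) • (a * b) = ((bichar γ δ h h' : ℤ) : k) • (b * a) := by
  induction w with
  | one => simp [bichar_one_left]
  | @cons i j a g h w ih =>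
    have h1 := congrArg (fun z => ((bichar γ δ (e i) g' : ℤ) : k) • (x k i j * z)) ih
    have h2 := congrArg (fun z => ((bichar γ δ h h' : ℤ) : k) • (z * a))
      (gen_word_comm γ δ i j w')
    simp only [bichar_mul_left, Units.val_mul, Int.cast_mul, smul_mul_assoc, mul_smul_comm,
      mul_assoc, smul_smul] at h1 h2 ⊢
    rw [h1, mul_comm, h2, mul_comm]

/-- To prove a linear statement on `H₈` it is enough to check it on words in the generators. -/
theorem word_induction {P : H8 k → Prop} (hw : ∀ {a g h}, Word a g h → P a)
    (hadd : ∀ a b, P a → P b → P (a + b)) (hsmul : ∀ (c : k) a, P a → P (c • a)) (a : H8 k) :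
    P a := by
  have key : a ∈ Submodule.span k {b : H8 k | ∃ g h, Word b g h} := by
    induction a using span_induction with
    | h1 => exact Submodule.subset_span ⟨1, 1, .one⟩
    | hadd a b ha hb => exact add_mem ha hb
    | hsmul c a ha => exact Submodule.smul_mem _ c ha
    | hmul i j a ha =>
      induction ha using Submodule.span_induction with
      | zero => rw [mul_zero]; exact zero_mem _
      | add a b _ _ ha hb => rw [mul_add]; exact add_mem ha hb
      | smul c a _ ha => rw [mul_smul_comm]; exact Submodule.smul_mem _ c ha
      | mem z hz =>
        obtain ⟨g, h, w⟩ := hz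
        exact Submodule.subset_span ⟨_, _, w.cons i j⟩
  induction key using Submodule.span_induction with
  | zero => have := hsmul 0 1 (hw .one); rwa [zero_smul] at this
  | add a b _ _ ha hb => exact hadd a b ha hb
  | smul c a _ ha => exact hsmul c a ha
  | mem z hz => obtain ⟨g, h, w⟩ := hz; exact hw w

theorem left_eq (γ δ : ℤˣ) (s t : H8 k ⊗[k] H8 k) :
    TensorProduct.lid k (H8 k) (TensorProduct.map (tauForm k γ δ) (LinearMap.mul' k (H8 k))
      (TensorProduct.tensorTensorTensorComm k _ _ _ _ (s ⊗ₜ t))) =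
    TensorProduct.lid k (H8 k) (TensorProduct.map (bicharForm k γ δ) (LinearMap.mul' k (H8 k))
      (TensorProduct.tensorTensorTensorComm k _ _ _ _
        (TensorProduct.map (toGroup k : H8 k →ₐc[k] _).toCoalgHom.toLinearMap LinearMap.id s ⊗ₜ
          TensorProduct.map (toGroup k : H8 k →ₐc[k] _).toCoalgHom.toLinearMap
            LinearMap.id t))) := by
  induction s with
  | zero => simp
  | add s s' hs hs' => simp only [add_tmul, map_add, hs, hs']
  | tmul a b =>
    induction t with
    | zero => simp
    | add s s' hs hs' => simp only [tmul_add, map_add, hs, hs']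
    | tmul c d => rfl

theorem right_eq (γ δ : ℤˣ) (s t : H8 k ⊗[k] H8 k) :
    TensorProduct.rid k (H8 k) (TensorProduct.map
      (LinearMap.mul' k (H8 k) ∘ₗ (TensorProduct.comm k (H8 k) (H8 k)).toLinearMap)
        (tauForm k γ δ) (TensorProduct.tensorTensorTensorComm k _ _ _ _ (s ⊗ₜ t))) =
    TensorProduct.rid k (H8 k) (TensorProduct.map
      (LinearMap.mul' k (H8 k) ∘ₗ (TensorProduct.comm k (H8 k) (H8 k)).toLinearMap)
        (bicharForm k γ δ) (TensorProduct.tensorTensorTensorComm k _ _ _ _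
        (TensorProduct.map LinearMap.id (toGroup k : H8 k →ₐc[k] _).toCoalgHom.toLinearMap s ⊗ₜ
          TensorProduct.map LinearMap.id
            (toGroup k : H8 k →ₐc[k] _).toCoalgHom.toLinearMap t))) := by
  induction s with
  | zero => simp
  | add s s' hs hs' => simp only [add_tmul, map_add, hs, hs']
  | tmul a b =>
    induction t with
    | zero => simp
    | add s s' hs hs' => simp only [tmul_add, map_add, hs, hs']
    | tmul c d => rfl

theorem comul_tmul' (a b : H8 k) : Coalgebra.comul (R := k) (a ⊗ₜ[k] b) =
    TensorProduct.tensorTensorTensorComm k _ _ _ _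
      (Coalgebra.comul (R := k) a ⊗ₜ[k] Coalgebra.comul (R := k) b) := rfl

variable (k) in
/-- The braiding `τ⁻_{γ,δ}` of `H₈`, for signs `γ` and `δ`: the braiding with
`τ(x₀₀, x₀₀) = τ(x₁₁, x₁₁) = γ`, `τ(x₀₀, x₁₁) = δ`, `τ(x₁₁, x₀₀) = -δ`, and value zero on all other
pairs of generators (see `tau_form_x`). -/
def tau (γ δ : ℤˣ) : Braiding k (H8 k) where
  form := tauForm k γ δ
  isUnit := ⟨⟨_, _, tauForm_conv γ δ, tauForm_conv γ δ⟩, rfl⟩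
  comm a b := by
    rw [comul_tmul', left_eq, right_eq]
    induction a using word_induction with
    | hadd a a' ha ha' => simp only [add_tmul, map_add, ha, ha']
    | hsmul c a ha => simp only [← smul_tmul', map_smul, ha]
    | @hw a g h w =>
      induction b using word_induction with
      | hadd a a' ha ha' => simp only [tmul_add, map_add, ha, ha']
      | hsmul c a ha => simp only [tmul_smul, map_smul, ha]
      | @hw b g' h' w' =>
        rw [w.comul_left, w'.comul_left, w.comul_right, w'.comul_right]
        simpa [bicharForm_single] using word_comm γ δ w w'
  mul_left a b c := by
    rw [tauForm_tmul, map_mul, bicharForm_mul_left, comul_toGroup]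
    exact congrArg _ (LinearMap.congr_fun (TensorProduct.map_comp _ _ _ _).symm _)
  mul_right a b c := by
    rw [tauForm_tmul, map_mul, bicharForm_mul_right, comul_toGroup]
    exact congrArg _ (LinearMap.congr_fun (TensorProduct.map_comp _ _ _ _).symm _)

theorem tau_form_x (γ δ : ℤˣ) (i j l m : Fin 2) :
    (tau k γ δ).form (x k i j ⊗ₜ x k l m) =
      if i = j ∧ l = m then
        ((((if i = l then γ else if i = 0 then δ else -δ) : ℤˣ) : ℤ) : k)
      else 0 := by
  change tauForm k γ δ _ = _
  rw [tauForm_tmul, toGroup_x, toGroup_x, ← bichar_e]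
  by_cases h : i = j <;> by_cases h' : l = m <;> simp [h, h', bicharForm_single]

end H8
end

/-!
For a braiding `σ` of `H₈`, let `a`, `b`, `c`, `d` be its values on the pairs `(x₀₀, x₀₀)`,
`(x₀₁, x₀₁)`, `(x₀₁, x₁₀)`, `(x₀₀, x₁₁)` of generators. The commutation condition and the linear
independence of the products of two generators express all other values on generators through these
four (`form_x_eq`), and multiplicativity leaves two possibilities (`form_cases`): either `b = c = 0`
and `a² = d² = 1`, which gives the four braidings `τ⁻_{γ,δ}`, or `a = d = 0`, `bc = 1` and
`b² + c² = 0`, so that `b⁴ = -1`. The second case is realized, for each of the four roots `b`, by a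
braiding `κ_b` (`kappa`): the functionals `κ_b(x i j, -)` are the matrix coefficients of a
two-dimensional representation of the opposite algebra of `H₈`, they satisfy the relations of `H₈`
under convolution, and the commutation condition is propagated from the generators to all of `H₈` by
means of the two regular actions of the dual algebra. So there are eight braidings
(`eq_tau_or_eq_kappa`).

The scalar `twist σ = a + b` is an invariant of the braided category of modules over the dual
algebra (`twist_eq_of_moritaEquivalent`). Indeed, the values `x i j` of functionals define a
two-dimensional simple module `V`, the invariants of `V ⊗ V` are the multiples of
`v₀ ⊗ v₀ + v₁ ⊗ v₁`, and the braiding of `V` with itself acts on them by `twist σ`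
(`braid_invVec`). Up to isomorphism, `V` is the only module with scalar endomorphisms whose tensor
square has other endomorphisms (`nonempty_iso_stdMod`), a condition that equivalences of `k`-linear
monoidal categories preserve.

The twists are `γ` for `τ⁻_{γ,δ}` and `b` for `κ_b`, so the six elements `1`, `-1` and the four roots
of `b⁴ = -1` all occur, and only `τ⁻_{γ,1}` and `τ⁻_{γ,-1}` share a twist. These two are equivalent,
since the automorphism `x i j ↦ x (1 - i) (1 - j)` of `H₈` exchanges them (`tau_equiv`).
-/

noncomputable section
namespace H8
variable {k : Type u} [Field k]

/-! ### A basis of the Kac–Paljutkin algebra -/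

theorem linear_ext {V : Type*} [AddCommGroup V] [Module k V] {f g : H8 k →ₗ[k] V}
    (h1 : ∀ i j, f (x k i j) = g (x k i j))
    (h2 : ∀ i j l m, f (x k i j * x k l m) = g (x k i j * x k l m)) : f = g := by
  refine LinearMap.ext_on (span_gens (k := k)) ?_
  rintro _ ⟨n, rfl⟩
  fin_cases n
  exacts [h1 _ _, h1 _ _, h1 _ _, h1 _ _, h2 _ _ _ _, h2 _ _ _ _, h2 _ _ _ _, h2 _ _ _ _]

variable (k) in
/-- The two-dimensional representation of `H₈` that vanishes at `x₀₀` and `x₁₁` and sends `x₀₁`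
and `x₁₀` to anticommuting involutions. -/
def offRep : H8 k →ₐ[k] Matrix (Fin 2) (Fin 2) k :=
  lift ![![0, !![0, 1; 1, 0]], ![!![1, 0; 0, -1], 0]]
    (by simp)
    (by simp)
    (by
      intro i j l m h
      fin_cases i <;> fin_cases j <;> fin_cases l <;> fin_cases m <;>
        first
        | exact absurd rfl h
        | simp)
    (by simp [Matrix.one_fin_two])
    (by simp)
    (by simp [← Matrix.ext_iff])

theorem offRep_x (i j : Fin 2) : offRep k (x k i j) =
    (![![0, !![0, 1; 1, 0]], ![!![1, 0; 0, -1], 0]] :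
      Fin 2 → Fin 2 → Matrix (Fin 2) (Fin 2) k) i j := lift_x ..

variable (k) in
/-- The coefficient at `g` of the image in the group algebra of `ℤ/2 × ℤ/2`. -/
def groupCoeff (g : G) : H8 k →ₗ[k] k where
  toFun a := (toGroup k a).coeff g
  map_add' a b := by simp
  map_smul' c a := by simp

variable (k) in
/-- A matrix coefficient of `offRep`. -/
def offCoeff (p q : Fin 2) : H8 k →ₗ[k] k where
  toFun a := offRep k a p q
  map_add' a b := by simp
  map_smul' c a := by simp

variable (k) in
/-- The coordinate functionals for the spanning family `gens`. -/
def coord : Fin 8 → H8 k →ₗ[k] k :=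
  ![groupCoeff k (e 0), groupCoeff k (e 1),
    (2⁻¹ : k) • (offCoeff k 0 1 + offCoeff k 1 0), (2⁻¹ : k) • (offCoeff k 0 0 - offCoeff k 1 1),
    groupCoeff k 1, (2⁻¹ : k) • (offCoeff k 0 0 + offCoeff k 1 1),
    groupCoeff k (e 0 * e 1), (2⁻¹ : k) • (offCoeff k 1 0 - offCoeff k 0 1)]

theorem coord_gens (h2 : (2 : k) ≠ 0) (n m : Fin 8) :
    coord k n (gens k m) = if n = m then 1 else 0 := by
  have h00 : (2⁻¹ : k) + 2⁻¹ = 1 := by rw [← two_mul]; exact mul_inv_cancel₀ h2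
  have e01 : e 0 ≠ e 1 := by decide
  have e0 : e 0 ≠ 1 := by decide
  have e1 : e 1 ≠ 1 := by decide
  have e00 : e 0 * e 0 = 1 := by decide
  have e011 : e 0 * e 1 ≠ 1 := by decide
  have e010 : e 0 * e 1 ≠ e 0 := by decide
  have e0101 : e 0 * e 1 ≠ e 1 := by decide
  fin_cases m <;> fin_cases n <;>
    simp [coord, gens, groupCoeff, offCoeff, offRep_x, MonoidAlgebra.single_mul_single,
      e01, e0, e1, e00, e011, e010, e0101, e01.symm, e0.symm, e1.symm,
      e011.symm, e010.symm, e0101.symm, h00, sub_eq_add_neg]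

end H8
end

noncomputable section
namespace H8
variable {k : Type u} [Field k]

/-! ### Matrix units and the integral in the dual algebra -/

theorem conv_apply_x (f g : DualAlg k (H8 k)) (i j : Fin 2) :
    (f * g) (x k i j) = f (x k i 0) * g (x k 0 j) + f (x k i 1) * g (x k 1 j) := by
  simp [LinearMap.convMul_apply]

theorem conv_apply_x_mul_x (f g : DualAlg k (H8 k)) (i j l m : Fin 2) :
    (f * g) (x k i j * x k l m) =
      f (x k i 0 * x k l 0) * g (x k 0 j * x k 0 m) +
      f (x k i 1 * x k l 0) * g (x k 1 j * x k 0 m) +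
      (f (x k i 0 * x k l 1) * g (x k 0 j * x k 1 m) +
      f (x k i 1 * x k l 1) * g (x k 1 j * x k 1 m)) := by
  simp [LinearMap.convMul_apply, add_mul, mul_add]

theorem dual_ext {f g : DualAlg k (H8 k)} (h1 : ∀ i j, f (x k i j) = g (x k i j))
    (h2 : ∀ i j l m, f (x k i j * x k l m) = g (x k i j * x k l m)) : f = g :=
  WithConv.ext (linear_ext h1 h2)

variable (k) in
/-- The functional on `H₈` dual to the generator `x i j` with respect to the basis `gens`. These
functionals are matrix units in the dual algebra. -/
def E (i j : Fin 2) : DualAlg k (H8 k) :=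
  WithConv.toConv (coord k (if i = j then if i = 0 then 0 else 1 else if i = 0 then 2 else 3))

theorem E_x (h2 : (2 : k) ≠ 0) (i j l m : Fin 2) :
    E k i j (x k l m) = if i = l ∧ j = m then 1 else 0 := by
  have h := coord_gens h2
  have h0 := fun n => h n 0
  have h1 := fun n => h n 1
  have h3 := fun n => h n 2
  have h4 := fun n => h n 3
  simp only [gens, Matrix.cons_val] at h0 h1 h3 h4
  fin_cases i <;> fin_cases j <;> fin_cases l <;> fin_cases m <;> simp [E, h0, h1, h3, h4]

theorem coord_x_mul_x (h2 : (2 : k) ≠ 0) (n : Fin 8) (i j l m : Fin 2) :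
    coord k n (x k i j * x k l m) =
      if i - j = l - m then
        if i = j then
          if i = l then (if n = 4 then 1 else 0) else if n = 6 then 1 else 0
        else
          if i = l then (if n = 5 then 1 else 0) else if n = 7 then (-1) ^ i.val else 0
      else 0 := by
  have h := coord_gens h2 n
  have h4 := h 4
  have h5 := h 5
  have h6 := h 6
  have h7 := h 7
  simp only [gens, Matrix.cons_val] at h4 h5 h6 h7
  by_cases hm : i - j = l - m
  · rw [if_pos hm]
    fin_cases i <;> fin_cases j <;> fin_cases l <;> fin_cases m <;>
      first
      | exact absurd hm (by decide)
      | simp [sq_diag, sq_offdiag, comm_rel, anticomm_rel, h4, h5, h6, h7]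
    split_ifs <;> simp
  · rw [if_neg hm, mixed hm, map_zero]

theorem E_x_mul_x (h2 : (2 : k) ≠ 0) (i j l m p q : Fin 2) :
    E k i j (x k l m * x k p q) = 0 := by
  fin_cases i <;> fin_cases j <;> simp [E, coord_x_mul_x h2]

/-- Left multiplication by `a` acts on the matrix units through the matrix `a (x l i)`. -/
theorem mul_E (h2 : (2 : k) ≠ 0) (a : DualAlg k (H8 k)) (i j : Fin 2) :
    a * E k i j = a (x k 0 i) • E k 0 j + a (x k 1 i) • E k 1 j := by
  refine dual_ext (fun l m => ?_) fun l m p q => ?_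
  · rw [conv_apply_x]
    simp only [E_x h2, WithConv.ofConv_add, WithConv.ofConv_smul, LinearMap.add_apply,
      LinearMap.smul_apply, smul_eq_mul]
    fin_cases i <;> fin_cases l <;> simp
  · rw [conv_apply_x_mul_x]
    simp only [E_x_mul_x h2, WithConv.ofConv_add, WithConv.ofConv_smul, LinearMap.add_apply,
      LinearMap.smul_apply, smul_zero, mul_zero, add_zero]

theorem E_mul (h2 : (2 : k) ≠ 0) (a : DualAlg k (H8 k)) (i j : Fin 2) :
    E k i j * a = a (x k j 0) • E k i 0 + a (x k j 1) • E k i 1 := by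
  refine dual_ext (fun l m => ?_) fun l m p q => ?_
  · rw [conv_apply_x]
    simp only [E_x h2, WithConv.ofConv_add, WithConv.ofConv_smul, LinearMap.add_apply,
      LinearMap.smul_apply, smul_eq_mul]
    fin_cases j <;> fin_cases m <;> simp
  · rw [conv_apply_x_mul_x]
    simp only [E_x_mul_x h2, WithConv.ofConv_add, WithConv.ofConv_smul, LinearMap.add_apply,
      LinearMap.smul_apply, smul_zero, zero_mul, add_zero]

theorem E_mul_E (h2 : (2 : k) ≠ 0) (i j l m : Fin 2) :
    E k i j * E k l m = if j = l then E k i m else 0 := by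
  rw [E_mul h2, E_x h2, E_x h2]
  fin_cases j <;> fin_cases l <;> fin_cases m <;> simp

/-- The span of the products `x i j * x l m` is a cocommutative subcoalgebra, so commutators in the
dual algebra are combinations of the matrix units. -/
theorem commutator_eq (h2 : (2 : k) ≠ 0) (a b : DualAlg k (H8 k)) :
    a * b - b * a = ∑ i, ∑ j, (a * b - b * a) (x k i j) • E k i j := by
  refine dual_ext (fun l m => ?_) fun i j l m => ?_
  · simp only [Fin.sum_univ_two, WithConv.ofConv_add, WithConv.ofConv_smul, LinearMap.add_apply,
      LinearMap.smul_apply, E_x h2]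
    fin_cases l <;> fin_cases m <;> simp
  · simp only [Fin.sum_univ_two, WithConv.ofConv_add, WithConv.ofConv_smul, LinearMap.add_apply,
      LinearMap.smul_apply, E_x_mul_x h2, smul_zero, add_zero, WithConv.ofConv_sub,
      LinearMap.sub_apply, conv_apply_x_mul_x]
    fin_cases i <;> fin_cases j <;> fin_cases l <;> fin_cases m <;>
      simp [mixed, sq_diag, sq_offdiag, comm_rel, anticomm_rel] <;> ring

variable (k) in
/-- The normalized integral on `H₈`, as an element of the dual algebra: the functional that is one on
the trivial group-like element `1 = x₀₀² + x₀₁²` and zero on the other simple subcoalgebras. -/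
def haar : DualAlg k (H8 k) := WithConv.toConv ((2⁻¹ : k) • (coord k 4 + coord k 5))

theorem haar_x_mul_x (h2 : (2 : k) ≠ 0) (i j l m : Fin 2) :
    haar k (x k i j * x k l m) = if i = l ∧ j = m then 2⁻¹ else 0 := by
  simp only [haar, LinearMap.smul_apply, LinearMap.add_apply, coord_x_mul_x h2]
  fin_cases i <;> fin_cases j <;> fin_cases l <;> fin_cases m <;> simp

theorem haar_one (h2 : (2 : k) ≠ 0) : haar k 1 = 1 := by
  rw [← unit_rel, map_add, haar_x_mul_x h2, haar_x_mul_x h2]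
  simp only [and_self, if_true]
  rw [← two_mul, mul_inv_cancel₀ h2]

end H8
end

noncomputable section
namespace Braiding
variable {k : Type u} [Field k] {A : Type u} [Ring A] [Bialgebra k A]

/-! ### Braidings are determined by their values on the generators -/

/-- The functional `σ(1, -)` is an invertible idempotent of the dual algebra. -/
theorem form_one_left (σ : Braiding k A) (z : A) :
    σ.form (1 ⊗ₜ z) = Coalgebra.counit (R := k) z := by
  obtain ⟨τ, hτ, -⟩ := isUnit_iff_exists.1 σ.isUnit
  let f : DualAlg k A := WithConv.toConv (σ.form ∘ₗ TensorProduct.mk k A A 1)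
  let g : DualAlg k A := WithConv.toConv (τ.ofConv ∘ₗ TensorProduct.mk k A A 1)
  have hff : f * f = f := WithConv.ext <| LinearMap.ext fun z => by
    have := σ.mul_left 1 1 z
    rw [mul_one] at this
    exact this.symm
  have hfg : f * g = 1 := WithConv.ext <| LinearMap.ext fun z => by
    have key : ∀ t : A ⊗[k] A, LinearMap.mul' k k (TensorProduct.map f.ofConv g.ofConv t) =
        LinearMap.mul' k k (TensorProduct.map σ.form τ.ofConv
          (AlgebraTensorModule.tensorTensorTensorComm k k k k A A A A ((1 ⊗ₜ 1) ⊗ₜ t))) := by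
      intro t
      induction t with
      | zero => simp
      | add s t hs ht => simp only [map_add, tmul_add, hs, ht]
      | tmul a b => rfl
    have h := LinearMap.congr_fun (congrArg WithConv.ofConv hτ) (1 ⊗ₜ z)
    rw [LinearMap.convMul_apply, LinearMap.convOne_apply] at h
    rw [LinearMap.convMul_apply, LinearMap.convOne_apply, key]
    refine Eq.trans ?_ (h.trans (by simp))
    rw [TensorProduct.comul_tmul]
    simp [Algebra.TensorProduct.one_def]
  have hf : f = 1 := by
    have := congrArg (· * g) hff
    simpa only [mul_assoc, hfg, mul_one] using this
  have := LinearMap.congr_fun (congrArg WithConv.ofConv hf) z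
  simpa [f] using this

/-- The functional `σ(-, 1)` is an invertible idempotent of the dual algebra. -/
theorem form_one_right (σ : Braiding k A) (z : A) :
    σ.form (z ⊗ₜ 1) = Coalgebra.counit (R := k) z := by
  obtain ⟨τ, hτ, -⟩ := isUnit_iff_exists.1 σ.isUnit
  let f : DualAlg k A := WithConv.toConv (σ.form ∘ₗ (TensorProduct.mk k A A).flip 1)
  let g : DualAlg k A := WithConv.toConv (τ.ofConv ∘ₗ (TensorProduct.mk k A A).flip 1)
  have hff : f * f = f := WithConv.ext <| LinearMap.ext fun z => by
    have := σ.mul_right z 1 1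
    rw [mul_one] at this
    exact this.symm
  have hfg : f * g = 1 := WithConv.ext <| LinearMap.ext fun z => by
    have key : ∀ t : A ⊗[k] A, LinearMap.mul' k k (TensorProduct.map f.ofConv g.ofConv t) =
        LinearMap.mul' k k (TensorProduct.map σ.form τ.ofConv
          (AlgebraTensorModule.tensorTensorTensorComm k k k k A A A A (t ⊗ₜ (1 ⊗ₜ 1)))) := by
      intro t
      induction t with
      | zero => simp
      | add s t hs ht => simp only [map_add, add_tmul, hs, ht]
      | tmul a b => rfl
    have h := LinearMap.congr_fun (congrArg WithConv.ofConv hτ) (z ⊗ₜ 1)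
    rw [LinearMap.convMul_apply, LinearMap.convOne_apply] at h
    rw [LinearMap.convMul_apply, LinearMap.convOne_apply, key]
    refine Eq.trans ?_ (h.trans (by simp))
    rw [TensorProduct.comul_tmul]
    simp [Algebra.TensorProduct.one_def]
  have hf : f = 1 := by
    have := congrArg (· * g) hff
    simpa only [mul_assoc, hfg, mul_one] using this
  have := LinearMap.congr_fun (congrArg WithConv.ofConv hf) z
  simpa [f] using this

end Braiding

namespace H8
variable {k : Type u} [Field k]

theorem form_x_mul_left (σ : Braiding k (H8 k)) (a b : H8 k) (p q : Fin 2) :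
    σ.form ((a * b) ⊗ₜ x k p q) = σ.form (a ⊗ₜ x k p 0) * σ.form (b ⊗ₜ x k 0 q) +
      σ.form (a ⊗ₜ x k p 1) * σ.form (b ⊗ₜ x k 1 q) := by
  rw [σ.mul_left]
  simp

theorem form_x_mul_right (σ : Braiding k (H8 k)) (a b : H8 k) (p q : Fin 2) :
    σ.form (x k p q ⊗ₜ (a * b)) = σ.form (x k p 0 ⊗ₜ b) * σ.form (x k 0 q ⊗ₜ a) +
      σ.form (x k p 1 ⊗ₜ b) * σ.form (x k 1 q ⊗ₜ a) := by
  rw [σ.mul_right]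
  simp

theorem braiding_ext {σ σ' : Braiding k (H8 k)}
    (h : ∀ i j l m, σ.form (x k i j ⊗ₜ x k l m) = σ'.form (x k i j ⊗ₜ x k l m)) : σ = σ' := by
  have h1 : ∀ b i j, σ.form (x k i j ⊗ₜ b) = σ'.form (x k i j ⊗ₜ b) := by
    intro b
    induction b using span_induction with
    | h1 => simp [Braiding.form_one_right]
    | hadd a b ha hb => simp only [tmul_add, map_add, ha, hb, implies_true]
    | hsmul c a ha => simp only [tmul_smul, map_smul, ha, implies_true]
    | hmul l m a ha => simp only [form_x_mul_right, ha, h, implies_true]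
  refine Braiding.ext (TensorProduct.ext' fun a b => ?_)
  induction a using span_induction generalizing b with
  | h1 => simp [Braiding.form_one_left]
  | hadd a b ha hb => simp only [add_tmul, map_add, ha, hb]
  | hsmul c a ha => simp only [← smul_tmul', map_smul, ha]
  | hmul i j a ha =>
    rw [σ.mul_left, σ'.mul_left]
    exact congrArg₂ (fun f g => LinearMap.mul' k k (TensorProduct.map f g _))
      (LinearMap.ext fun b => h1 b i j) (LinearMap.ext fun b => ha b)

/-- The commutation condition of a braiding for a pair of generators, tested with a functional. -/
theorem form_comm_x (σ : Braiding k (H8 k)) (f : H8 k →ₗ[k] k) (i j l m : Fin 2) :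
    ∑ a, ∑ b, σ.form (x k i a ⊗ₜ x k l b) * f (x k a j * x k b m) =
      ∑ a, ∑ b, σ.form (x k a j ⊗ₜ x k b m) * f (x k l b * x k i a) := by
  have h := congrArg f (σ.comm (x k i j) (x k l m))
  rw [comul_tmul'] at h
  simp only [comul_x, add_tmul, tmul_add, map_add, TensorProduct.tensorTensorTensorComm_tmul,
    TensorProduct.map_tmul, LinearMap.mul'_apply, TensorProduct.lid_tmul, TensorProduct.rid_tmul,
    map_smul, smul_eq_mul, LinearMap.comp_apply, LinearEquiv.coe_coe,
    TensorProduct.comm_tmul] at h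
  simp only [Fin.sum_univ_two]
  linear_combination h

/-- The shape of the matrix of a braiding of `H₈` on the generators: it is given by four
parameters. -/
theorem form_x_eq (h2 : (2 : k) ≠ 0) (σ : Braiding k (H8 k)) (i j l m : Fin 2) :
    σ.form (x k i j ⊗ₜ x k l m) =
      if i - j = l - m then
        if i = j then
          if i = l then σ.form (x k 0 0 ⊗ₜ x k 0 0)
          else (-1) ^ i.val * σ.form (x k 0 0 ⊗ₜ x k 1 1)
        else if i = l then σ.form (x k 0 1 ⊗ₜ x k 0 1) else σ.form (x k 0 1 ⊗ₜ x k 1 0)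
      else 0 := by
  have h := fun n i j l m => form_comm_x σ (coord k n) i j l m
  simp only [Fin.sum_univ_two, coord_x_mul_x h2] at h
  have hb := h 5 0 0 0 0
  have ha := h 5 0 1 0 1
  have hc := h 7 0 0 1 1
  have hd := h 7 0 1 1 0
  have z1 := h 4 0 0 1 0
  have z2 := h 5 0 0 1 0
  have z3 := h 4 1 0 0 0
  have z4 := h 5 1 0 0 0
  have z5 := h 4 0 0 0 1
  have z6 := h 5 0 0 0 1
  have z7 := h 4 0 1 0 0
  have z8 := h 5 0 1 0 0
  have n1 : (-1 : Fin 2) = 1 := rfl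
  simp [n1] at ha hb hc hd z1 z2 z3 z4 z5 z6 z7 z8
  fin_cases i <;> fin_cases j <;> fin_cases l <;> fin_cases m <;>
    simp [n1, ha, hb, hc, hd, z1, z2, z3, z4, z5.symm, z6.symm, z7.symm, z8.symm]

/-- The values of a braiding of `H₈` on the generators are either concentrated on the diagonal
generators or on the off-diagonal ones. -/
theorem form_cases (h2 : (2 : k) ≠ 0) (σ : Braiding k (H8 k)) :
    (σ.form (x k 0 1 ⊗ₜ x k 0 1) = 0 ∧ σ.form (x k 0 1 ⊗ₜ x k 1 0) = 0 ∧
      σ.form (x k 0 0 ⊗ₜ x k 0 0) ^ 2 = 1 ∧ σ.form (x k 0 0 ⊗ₜ x k 1 1) ^ 2 = 1) ∨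
    (σ.form (x k 0 0 ⊗ₜ x k 0 0) = 0 ∧ σ.form (x k 0 0 ⊗ₜ x k 1 1) = 0 ∧
      σ.form (x k 0 1 ⊗ₜ x k 0 1) * σ.form (x k 0 1 ⊗ₜ x k 1 0) = 1 ∧
      σ.form (x k 0 1 ⊗ₜ x k 0 1) ^ 2 + σ.form (x k 0 1 ⊗ₜ x k 1 0) ^ 2 = 0) := by
  -- Evaluate the defining relations of `H₈` in the first argument of `σ` at suitable `x p q`.
  have e1 := form_x_mul_left σ (x k 0 0) (x k 0 0) 0 0
  have e2 := form_x_mul_left σ (x k 1 1) (x k 1 1) 0 0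
  have e3 := form_x_mul_left σ (x k 0 0) (x k 0 1) 0 1
  have e4 := form_x_mul_left σ (x k 0 0) (x k 0 1) 1 0
  have e5 := form_x_mul_left σ (x k 0 1) (x k 0 1) 0 0
  have e6 := form_x_mul_left σ (x k 0 1) (x k 1 0) 0 0
  have e7 := form_x_mul_left σ (x k 1 0) (x k 0 1) 0 0
  have e8 := congrArg (fun z => σ.form (z ⊗ₜ x k 0 0)) (unit_rel (k := k))
  simp only [add_tmul, map_add, Braiding.form_one_left] at e8
  rw [mixed (by decide)] at e3 e4
  rw [sq_diag] at e2
  rw [anticomm_rel] at e7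
  rw [form_x_eq h2 σ 0 0 0 1, form_x_eq h2 σ 0 0 1 0] at e1
  rw [form_x_eq h2 σ 1 1 0 0, form_x_eq h2 σ 1 1 0 1, form_x_eq h2 σ 1 1 1 0] at e2
  rw [form_x_eq h2 σ 0 0 0 1] at e3
  rw [form_x_eq h2 σ 0 0 1 0] at e4
  rw [form_x_eq h2 σ 0 1 0 0] at e5
  rw [form_x_eq h2 σ 0 1 0 0, form_x_eq h2 σ 1 0 1 0] at e6
  rw [form_x_eq h2 σ 1 0 0 0, form_x_eq h2 σ 1 0 0 1] at e7
  have n1 : (-1 : Fin 2) = 1 := rfl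
  simp [n1, neg_tmul] at e1 e2 e3 e4 e5 e6 e7 e8
  generalize σ.form (x k 0 0 ⊗ₜ x k 0 0) = a at *
  generalize σ.form (x k 0 1 ⊗ₜ x k 0 1) = b at *
  generalize σ.form (x k 0 1 ⊗ₜ x k 1 0) = c at *
  generalize σ.form (x k 0 0 ⊗ₜ x k 1 1) = d at *
  have had : a * a = d * d := e1.symm.trans e2
  have hbc : a * a + b * c = 1 := by rw [← e1, ← e5, e8]
  have hb : b * b + c * c = 0 := by rw [← e6, ← e7, add_neg_cancel]
  rcases e3 with rfl | rfl
  · have hd : d = 0 := by simpa using had.symm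
    refine Or.inr ⟨rfl, hd, by simpa using hbc, by linear_combination hb⟩
  · have hc : c = 0 := by simpa using hb
    subst hc
    refine Or.inl ⟨rfl, rfl, by linear_combination hbc, by linear_combination hbc - had⟩

end H8
end

noncomputable section

namespace DualAlg
variable {k : Type u} [Field k] {A : Type u} [Ring A] [Bialgebra k A]

/-! ### The two regular actions of the dual algebra -/

/-- The right action of the dual algebra on `A`, `z ↦ ∑ f(z₁) z₂`. -/
def actL (f : DualAlg k A) : Module.End k A :=
  (TensorProduct.lid k A).toLinearMap ∘ₗ LinearMap.rTensor A f.ofConv ∘ₗ Coalgebra.comul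

/-- The left action of the dual algebra on `A`, `z ↦ ∑ z₁ f(z₂)`. -/
def actR (f : DualAlg k A) : Module.End k A :=
  (TensorProduct.rid k A).toLinearMap ∘ₗ LinearMap.lTensor A f.ofConv ∘ₗ Coalgebra.comul

theorem actL_apply (f : DualAlg k A) (z : A) : actL f z =
    TensorProduct.lid k A (LinearMap.rTensor A f.ofConv (Coalgebra.comul z)) := rfl

theorem actR_apply (f : DualAlg k A) (z : A) : actR f z =
    TensorProduct.rid k A (LinearMap.lTensor A f.ofConv (Coalgebra.comul z)) := rfl

theorem actL_mul (f g : DualAlg k A) : actL (f * g) = actL g * actL f := by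
  let ψ : A ⊗[k] (A ⊗[k] A) →ₗ[k] A := (TensorProduct.lid k A).toLinearMap ∘ₗ
    TensorProduct.map f.ofConv ((TensorProduct.lid k A).toLinearMap ∘ₗ
      LinearMap.rTensor A g.ofConv)
  have h1 : ∀ t : A ⊗[k] A, TensorProduct.lid k A (LinearMap.rTensor A (f * g).ofConv t) =
      ψ (TensorProduct.assoc k A A A (LinearMap.rTensor A Coalgebra.comul t)) := by
    intro t
    induction t with
    | zero => simp
    | add s t hs ht => simp only [map_add, hs, ht]
    | tmul a b =>
      simp only [LinearMap.rTensor_tmul, TensorProduct.lid_tmul, LinearMap.convMul_apply]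
      induction (Coalgebra.comul a : A ⊗[k] A) with
      | zero => simp
      | add s t hs ht => simp only [map_add, add_tmul, add_smul, hs, ht]
      | tmul c d => simp [ψ, mul_smul, smul_comm (f.ofConv c)]
  have h2 : ∀ t : A ⊗[k] A, actL g (TensorProduct.lid k A (LinearMap.rTensor A f.ofConv t)) =
      ψ (LinearMap.lTensor A Coalgebra.comul t) := by
    intro t
    induction t with
    | zero => simp
    | add s t hs ht => simp only [map_add, hs, ht]
    | tmul a b => simp [ψ, actL_apply]
  refine LinearMap.ext fun z => ?_
  rw [Module.End.mul_apply, actL_apply f, h2, actL_apply, h1, Coalgebra.coassoc_apply]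

theorem actR_mul (f g : DualAlg k A) : actR (f * g) = actR f * actR g := by
  let ψ : A ⊗[k] (A ⊗[k] A) →ₗ[k] A := (TensorProduct.rid k A).toLinearMap ∘ₗ
    LinearMap.lTensor A (LinearMap.mul' k k ∘ₗ TensorProduct.map f.ofConv g.ofConv)
  have h1 : ∀ t : A ⊗[k] A, TensorProduct.rid k A (LinearMap.lTensor A (f * g).ofConv t) =
      ψ (LinearMap.lTensor A Coalgebra.comul t) := by
    intro t
    induction t with
    | zero => simp
    | add s t hs ht => simp only [map_add, hs, ht]
    | tmul a b => simp [ψ, LinearMap.convMul_apply]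
  have h2 : ∀ t : A ⊗[k] A, actR f (TensorProduct.rid k A (LinearMap.lTensor A g.ofConv t)) =
      ψ (TensorProduct.assoc k A A A (LinearMap.rTensor A Coalgebra.comul t)) := by
    intro t
    induction t with
    | zero => simp
    | add s t hs ht => simp only [map_add, hs, ht]
    | tmul a b =>
      simp only [LinearMap.rTensor_tmul, LinearMap.lTensor_tmul, TensorProduct.rid_tmul, map_smul,
        actR_apply]
      induction (Coalgebra.comul a : A ⊗[k] A) with
      | zero => simp
      | add s t hs ht => simp only [map_add, add_tmul, smul_add, hs, ht]
      | tmul c d => simp [ψ, mul_smul, smul_comm (g.ofConv b)]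
  refine LinearMap.ext fun z => ?_
  rw [Module.End.mul_apply, actR_apply g, h2, actR_apply, h1, Coalgebra.coassoc_apply]

theorem actL_comm_actR (f g : DualAlg k A) : actL f * actR g = actR g * actL f := by
  let ψ : A ⊗[k] (A ⊗[k] A) →ₗ[k] A := (TensorProduct.lid k A).toLinearMap ∘ₗ
    TensorProduct.map f.ofConv ((TensorProduct.rid k A).toLinearMap ∘ₗ
      LinearMap.lTensor A g.ofConv)
  have h1 : ∀ t : A ⊗[k] A, actR g (TensorProduct.lid k A (LinearMap.rTensor A f.ofConv t)) =
      ψ (LinearMap.lTensor A Coalgebra.comul t) := by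
    intro t
    induction t with
    | zero => simp
    | add s t hs ht => simp only [map_add, hs, ht]
    | tmul a b => simp [ψ, actR_apply]
  have h2 : ∀ t : A ⊗[k] A, actL f (TensorProduct.rid k A (LinearMap.lTensor A g.ofConv t)) =
      ψ (TensorProduct.assoc k A A A (LinearMap.rTensor A Coalgebra.comul t)) := by
    intro t
    induction t with
    | zero => simp
    | add s t hs ht => simp only [map_add, hs, ht]
    | tmul a b =>
      simp only [LinearMap.rTensor_tmul, LinearMap.lTensor_tmul, TensorProduct.rid_tmul, map_smul,
        actL_apply]
      induction (Coalgebra.comul a : A ⊗[k] A) with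
      | zero => simp
      | add s t hs ht => simp only [map_add, add_tmul, smul_add, hs, ht]
      | tmul c d => simp [ψ, smul_comm (g.ofConv b)]
  refine LinearMap.ext fun z => ?_
  rw [Module.End.mul_apply, Module.End.mul_apply, actR_apply g z, h2, actL_apply f z, h1,
    Coalgebra.coassoc_apply]

end DualAlg

namespace H8
variable {k : Type u} [Field k]
open DualAlg

/-! ### The four braidings concentrated on the off-diagonal generators -/

/-- The matrix of values `κ_b(x i j, x l m)` on the generators, as a matrix in `i, j`. -/
def kappaMatrix (b : k) (l m : Fin 2) : Matrix (Fin 2) (Fin 2) k :=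
  if l = m then 0 else if l = 0 then !![0, b; -b ^ 3, 0] else !![0, -b ^ 3; b, 0]

/-- The representation of the opposite algebra of `H₈` given by `kappaMatrix`. -/
def kappaRep {b : k} (hb : b ^ 4 = -1) : H8 k →ₐ[k] (Matrix (Fin 2) (Fin 2) k)ᵐᵒᵖ :=
  have h4 : b * b ^ 3 = -1 := by rw [← hb]; ring
  have h4' : b ^ 3 * b = -1 := by rw [← hb]; ring
  have h6 : b ^ 3 * b ^ 3 = -(b * b) := by linear_combination b ^ 2 * hb
  lift (fun l m => MulOpposite.op (kappaMatrix b l m))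
    (by simp [kappaMatrix])
    (by
      rw [← MulOpposite.op_mul, ← MulOpposite.op_mul]
      simp [kappaMatrix, h4, h4'])
    (by
      intro i j l m h
      rw [← MulOpposite.op_mul]
      fin_cases i <;> fin_cases j <;> fin_cases l <;> fin_cases m <;>
        first
        | exact absurd rfl h
        | simp [kappaMatrix])
    (by
      rw [← MulOpposite.op_mul, ← MulOpposite.op_mul, ← MulOpposite.op_add, ← MulOpposite.op_one]
      simp [kappaMatrix, h4, h4', Matrix.one_fin_two])
    (by simp [kappaMatrix])
    (by
      rw [← MulOpposite.op_mul, ← MulOpposite.op_mul, ← MulOpposite.op_add, ← MulOpposite.op_zero]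
      simp [kappaMatrix, h6, ← Matrix.ext_iff])

/-- The functional `κ_b(x i j, -)`, a matrix coefficient of `kappaRep`. -/
def phi {b : k} (hb : b ^ 4 = -1) (i j : Fin 2) : DualAlg k (H8 k) :=
  WithConv.toConv
    { toFun := fun y => (kappaRep hb y).unop i j
      map_add' := fun _ _ => by simp
      map_smul' := fun _ _ => by simp }

theorem phi_apply {b : k} (hb : b ^ 4 = -1) (i j : Fin 2) (y : H8 k) :
    phi hb i j y = (kappaRep hb y).unop i j := rfl

theorem phi_x {b : k} (hb : b ^ 4 = -1) (i j l m : Fin 2) :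
    phi hb i j (x k l m) = kappaMatrix b l m i j := by
  rw [phi_apply, kappaRep, lift_x, MulOpposite.unop_op]

theorem phi_one {b : k} (hb : b ^ 4 = -1) (i j : Fin 2) :
    phi hb i j 1 = if i = j then 1 else 0 := by
  rw [phi_apply, map_one, MulOpposite.unop_one, Matrix.one_apply]

theorem phi_mul {b : k} (hb : b ^ 4 = -1) (i j : Fin 2) (y z : H8 k) :
    phi hb i j (y * z) = phi hb i 0 z * phi hb 0 j y + phi hb i 1 z * phi hb 1 j y := by
  simp only [phi_apply, map_mul, MulOpposite.unop_mul, Matrix.mul_apply, Fin.sum_univ_two]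

theorem phi_x_mul_x {b : k} (hb : b ^ 4 = -1) (i j l m p q : Fin 2) :
    phi hb i j (x k l m * x k p q) =
      if i = j ∧ l ≠ m ∧ p ≠ q then if l = p then 1 else if l = i then -(b * b) else b * b
      else 0 := by
  have h4 : b * b ^ 3 = -1 := by rw [← hb]; ring
  have h4' : b ^ 3 * b = -1 := by rw [← hb]; ring
  have h6 : b ^ 3 * b ^ 3 = -(b * b) := by linear_combination b ^ 2 * hb
  simp only [phi_mul, phi_x]
  fin_cases l <;> fin_cases m <;> fin_cases p <;> fin_cases q <;> fin_cases i <;> fin_cases j <;>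
    simp [kappaMatrix, h4, h4', h6]

/-- The algebra homomorphism `x ↦ κ_b(x, -)` from `H₈` to its dual. -/
def kappaHom {b : k} (hb : b ^ 4 = -1) : H8 k →ₐ[k] DualAlg k (H8 k) :=
  have hbb : b * b * (b * b) = -1 := by rw [← hb]; ring
  have h4 : b * b ^ 3 = -1 := by rw [← hb]; ring
  have h4' : b ^ 3 * b = -1 := by rw [← hb]; ring
  have h6 : b ^ 3 * b ^ 3 = -(b * b) := by linear_combination b ^ 2 * hb
  lift (phi hb)
    (dual_ext
      (fun p q => by
        simp only [conv_apply_x, phi_x]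
        fin_cases p <;> fin_cases q <;> simp [kappaMatrix])
      (fun p q r s => by
        simp only [conv_apply_x_mul_x, phi_x_mul_x]
        fin_cases p <;> fin_cases q <;> fin_cases r <;> fin_cases s <;> simp [hbb]))
    (dual_ext
      (fun p q => by
        simp only [conv_apply_x, phi_x]
        fin_cases p <;> fin_cases q <;> simp [kappaMatrix, mul_comm])
      (fun p q r s => by
        simp only [conv_apply_x_mul_x, phi_x_mul_x]
        fin_cases p <;> fin_cases q <;> fin_cases r <;> fin_cases s <;> simp))
    (fun i j l m h => dual_ext
      (fun p q => by
        simp only [conv_apply_x, phi_x]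
        fin_cases i <;> fin_cases j <;> fin_cases l <;> fin_cases m <;>
          first
          | exact absurd rfl h
          | fin_cases p <;> fin_cases q <;> simp [kappaMatrix])
      (fun p q r s => by
        simp only [conv_apply_x_mul_x, phi_x_mul_x]
        fin_cases i <;> fin_cases j <;> fin_cases l <;> fin_cases m <;>
          first
          | exact absurd rfl h
          | simp))
    (dual_ext
      (fun p q => by
        simp only [WithConv.ofConv_add, LinearMap.add_apply, conv_apply_x, phi_x,
          LinearMap.convOne_apply]
        fin_cases p <;> fin_cases q <;> simp [kappaMatrix, h4, h4'])
      (fun p q r s => by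
        simp only [WithConv.ofConv_add, LinearMap.add_apply, conv_apply_x_mul_x, phi_x_mul_x,
          LinearMap.convOne_apply]
        fin_cases p <;> fin_cases q <;> fin_cases r <;> fin_cases s <;> simp [hbb]))
    (dual_ext
      (fun p q => by
        simp only [conv_apply_x, phi_x]
        fin_cases p <;> fin_cases q <;> simp [kappaMatrix])
      (fun p q r s => by
        simp only [conv_apply_x_mul_x, phi_x_mul_x]
        fin_cases p <;> fin_cases q <;> fin_cases r <;> fin_cases s <;> simp [hbb]))
    (dual_ext
      (fun p q => by
        simp only [WithConv.ofConv_add, LinearMap.add_apply, conv_apply_x, phi_x]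
        fin_cases p <;> fin_cases q <;> simp [kappaMatrix, h6])
      (fun p q r s => by
        simp only [WithConv.ofConv_add, LinearMap.add_apply, conv_apply_x_mul_x, phi_x_mul_x]
        fin_cases p <;> fin_cases q <;> fin_cases r <;> fin_cases s <;> simp))

theorem kappaHom_x {b : k} (hb : b ^ 4 = -1) (i j : Fin 2) :
    kappaHom hb (x k i j) = phi hb i j := by
  rw [kappaHom, lift_x]

end H8
end

noncomputable section
namespace H8
variable {k : Type u} [Field k]
open DualAlg

/-- The functional `x ⊗ y ↦ κ_b(x, y)`. -/
def kappaForm {b : k} (hb : b ^ 4 = -1) : H8 k ⊗[k] H8 k →ₗ[k] k :=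
  TensorProduct.lift ((WithConv.linearEquiv k _).toLinearMap ∘ₗ (kappaHom hb).toLinearMap)

theorem kappaForm_tmul {b : k} (hb : b ^ 4 = -1) (a c : H8 k) :
    kappaForm hb (a ⊗ₜ c) = kappaHom hb a c := rfl

theorem kappaForm_mul_left {b : k} (hb : b ^ 4 = -1) (x y z : H8 k) :
    kappaForm hb ((x * y) ⊗ₜ z) =
      LinearMap.mul' k k (TensorProduct.map (kappaForm hb ∘ₗ TensorProduct.mk k _ _ x)
        (kappaForm hb ∘ₗ TensorProduct.mk k _ _ y) (Coalgebra.comul z)) := by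
  rw [kappaForm_tmul, map_mul, LinearMap.convMul_apply]
  rfl

/-- The map `kappaHom` reverses the comultiplication. -/
theorem comulHom_kappaHom {b : k} (hb : b ^ 4 = -1) (a : H8 k) :
    DualAlg.comulHom k (H8 k) (kappaHom hb a) = Algebra.TensorProduct.comm k _ _
      (Algebra.TensorProduct.map (kappaHom hb) (kappaHom hb) (H8.comulHom k a)) := by
  have gen : ∀ i j, DualAlg.comulHom k (H8 k) (kappaHom hb (x k i j)) =
      Algebra.TensorProduct.comm k (DualAlg k (H8 k)) (DualAlg k (H8 k))
        (Algebra.TensorProduct.map (kappaHom hb) (kappaHom hb) (H8.comulHom k (x k i j))) := by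
    intro i j
    refine ext_pair (k := k) (A := H8 k) fun y z => ?_
    simp only [kappaHom_x, pairHom_comulHom_tmul, phi_mul, comulHom_x, map_add,
      Algebra.TensorProduct.map_tmul, Algebra.TensorProduct.comm_tmul, WithConv.ofConv_add,
      LinearMap.add_apply, pairHom_tmul_tmul, mul_comm]
  have h : (DualAlg.comulHom k (H8 k)).comp (kappaHom hb) =
      (Algebra.TensorProduct.comm k (DualAlg k (H8 k)) (DualAlg k (H8 k))).toAlgHom.comp
        ((Algebra.TensorProduct.map (kappaHom hb) (kappaHom hb)).comp (H8.comulHom k)) :=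
    algHom_ext (B := DualAlg k (H8 k) ⊗[k] DualAlg k (H8 k)) gen
  exact AlgHom.congr_fun h a

theorem kappaForm_mul_right {b : k} (hb : b ^ 4 = -1) (x y z : H8 k) :
    kappaForm hb (x ⊗ₜ (y * z)) =
      LinearMap.mul' k k (TensorProduct.map (kappaForm hb ∘ₗ (TensorProduct.mk k _ _).flip z)
        (kappaForm hb ∘ₗ (TensorProduct.mk k _ _).flip y) (Coalgebra.comul x)) := by
  have key : ∀ t : H8 k ⊗[k] H8 k, pairHom k _ _ (Algebra.TensorProduct.comm k _ _
      (Algebra.TensorProduct.map (kappaHom hb) (kappaHom hb) t)) (y ⊗ₜ z) =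
      LinearMap.mul' k k (TensorProduct.map (kappaForm hb ∘ₗ (TensorProduct.mk k _ _).flip z)
        (kappaForm hb ∘ₗ (TensorProduct.mk k _ _).flip y) t) := by
    intro t
    induction t with
    | zero => simp
    | add s t hs ht => simp only [map_add, WithConv.ofConv_add, LinearMap.add_apply, hs, ht]
    | tmul u v => simp [kappaForm_tmul, mul_comm]
  rw [kappaForm_tmul, ← pairHom_comulHom_tmul, comulHom_kappaHom, key]
  rfl

theorem kappaForm_isUnit {b : k} (hb : b ^ 4 = -1) :
    IsUnit (WithConv.toConv (kappaForm hb)) := by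
  -- The inverse is `x ⊗ y ↦ κ_b(S x, y)`.
  let τ : H8 k ⊗[k] H8 k →ₗ[k] k := kappaForm hb ∘ₗ LinearMap.rTensor _ (antipodeLin k)
  have key : ∀ (f g : H8 k →ₗ[k] H8 k) (s : H8 k ⊗[k] H8 k) (y : H8 k),
      LinearMap.mul' k k (TensorProduct.map (kappaForm hb ∘ₗ LinearMap.rTensor _ f)
        (kappaForm hb ∘ₗ LinearMap.rTensor _ g)
        (AlgebraTensorModule.tensorTensorTensorComm k k k k _ _ _ _
          (s ⊗ₜ (Coalgebra.comul (R := k) y)))) =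
      kappaHom hb (LinearMap.mul' k _ (TensorProduct.map f g s)) y := by
    intro f g s y
    induction s with
    | zero => simp
    | add s t hs ht =>
      simp only [map_add, add_tmul, hs, ht, WithConv.ofConv_add, LinearMap.add_apply]
    | tmul a c =>
      rw [TensorProduct.map_tmul, LinearMap.mul'_apply, map_mul, LinearMap.convMul_apply]
      induction (Coalgebra.comul y : H8 k ⊗[k] H8 k) with
      | zero => simp
      | add s t hs ht => simp only [map_add, tmul_add, hs, ht]
      | tmul u v => simp [kappaForm_tmul]
  have hid : kappaForm hb = kappaForm hb ∘ₗ LinearMap.rTensor _ LinearMap.id := by simp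
  have hone : ∀ c (y : H8 k),
      kappaHom hb (algebraMap k _ c) y = c * Coalgebra.counit (R := k) y := by
    intro c y
    rw [AlgHom.commutes, Algebra.algebraMap_eq_smul_one, WithConv.ofConv_smul,
      LinearMap.smul_apply, LinearMap.convOne_apply]
    rfl
  refine isUnit_iff_exists.2 ⟨WithConv.toConv τ, WithConv.ext (TensorProduct.ext' fun a y => ?_),
    WithConv.ext (TensorProduct.ext' fun a y => ?_)⟩
  · rw [LinearMap.convMul_apply, LinearMap.convOne_apply, TensorProduct.comul_tmul]
    have h := key LinearMap.id (antipodeLin k) (Coalgebra.comul a) y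
    rw [← hid] at h
    refine h.trans ?_
    have := HopfAlgebra.mul_antipode_lTensor_comul_apply (R := k) a
    refine (congrArg (fun z => kappaHom hb z y) this).trans ?_
    rw [hone]
    simp [mul_comm]
  · rw [LinearMap.convMul_apply, LinearMap.convOne_apply, TensorProduct.comul_tmul]
    have h := key (antipodeLin k) LinearMap.id (Coalgebra.comul a) y
    rw [← hid] at h
    refine h.trans ?_
    have := HopfAlgebra.mul_antipode_rTensor_comul_apply (R := k) a
    refine (congrArg (fun z => kappaHom hb z y) this).trans ?_
    rw [hone]
    simp [mul_comm]

/-- The commutation condition of a braiding for a pair of generators. -/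
theorem phi_comm_x {b : k} (hb : b ^ 4 = -1) (r j l m : Fin 2) :
    ∑ a, ∑ p, phi hb r a (x k l p) • (x k a j * x k p m) =
      ∑ a, ∑ p, phi hb a j (x k p m) • (x k l p * x k r a) := by
  simp only [phi_x, Fin.sum_univ_two]
  fin_cases r <;> fin_cases j <;> fin_cases l <;> fin_cases m <;>
    simp [kappaMatrix, mixed, sq_diag, sq_offdiag, comm_rel, anticomm_rel]

theorem actL_phi_x_mul {b : k} (hb : b ^ 4 = -1) (i a l m : Fin 2) (w : H8 k) :
    actL (phi hb i a) (x k l m * w) =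
      ∑ p, ∑ r, phi hb r a (x k l p) • (x k p m * actL (phi hb i r) w) := by
  rw [actL_apply, comul_x_mul]
  simp only [actL_apply]
  induction (Coalgebra.comul w : H8 k ⊗[k] H8 k) with
  | zero => simp
  | add s t hs ht =>
    simp only [mul_add, map_add, hs, ht, smul_add, Finset.sum_add_distrib]
  | tmul u v =>
    simp only [add_mul, Algebra.TensorProduct.tmul_mul_tmul, map_add, LinearMap.rTensor_tmul,
      TensorProduct.lid_tmul, phi_mul, Fin.sum_univ_two, add_smul, mul_smul_comm, smul_smul]
    simp only [mul_comm]

theorem actR_phi_x_mul {b : k} (hb : b ^ 4 = -1) (a j l m : Fin 2) (w : H8 k) :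
    actR (phi hb a j) (x k l m * w) =
      ∑ p, ∑ r, phi hb r j (x k p m) • (x k l p * actR (phi hb a r) w) := by
  rw [actR_apply, comul_x_mul]
  simp only [actR_apply]
  induction (Coalgebra.comul w : H8 k ⊗[k] H8 k) with
  | zero => simp
  | add s t hs ht =>
    simp only [mul_add, map_add, hs, ht, smul_add, Finset.sum_add_distrib]
  | tmul u v =>
    simp only [add_mul, Algebra.TensorProduct.tmul_mul_tmul, map_add, LinearMap.lTensor_tmul,
      TensorProduct.rid_tmul, phi_mul, Fin.sum_univ_two, add_smul, mul_smul_comm, smul_smul]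
    simp only [mul_comm]

/-- The commutation condition of a braiding for a generator and an arbitrary element. -/
theorem phi_comm {b : k} (hb : b ^ 4 = -1) (i j : Fin 2) (z : H8 k) :
    ∑ a, x k a j * actL (phi hb i a) z = ∑ a, actR (phi hb a j) z * x k i a := by
  induction z using span_induction generalizing i j with
  | h1 =>
    have h := phi_one (k := k) hb
    simp only [actL_apply, actR_apply, Bialgebra.comul_one, Algebra.TensorProduct.one_def,
      LinearMap.rTensor_tmul, LinearMap.lTensor_tmul, TensorProduct.lid_tmul,
      TensorProduct.rid_tmul, h, Fin.sum_univ_two]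
    fin_cases i <;> fin_cases j <;> simp
  | hadd a b ha hb => simp only [map_add, mul_add, add_mul, Finset.sum_add_distrib, ha, hb]
  | hsmul c a ha =>
    simp only [map_smul, mul_smul_comm, smul_mul_assoc, ← Finset.smul_sum, ha]
  | hmul l m w ih =>
    have h1 := fun r => congrArg (fun z => z * actL (phi hb i r) w) (phi_comm_x hb r j l m)
    have h2 := fun a p => congrArg (fun z => phi hb a j (x k p m) • (x k l p * z)) (ih i a)
    have h10 := h1 0
    have h11 := h1 1
    have h200 := h2 0 0
    have h201 := h2 0 1
    have h210 := h2 1 0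
    have h211 := h2 1 1
    simp only [actL_phi_x_mul, actR_phi_x_mul, Fin.sum_univ_two, mul_add, add_mul, smul_add,
      mul_smul_comm, smul_mul_assoc, mul_assoc] at *
    linear_combination (norm := module) h10 + h11 + h200 + h201 + h210 + h211

/-- The left-hand side of the commutation condition, for `∑ x₁ ⊗ x₂` a general tensor. -/
def commL {b : k} (hb : b ^ 4 = -1) : H8 k ⊗[k] H8 k →ₗ[k] Module.End k (H8 k) :=
  TensorProduct.lift (LinearMap.mk₂ k (fun u v => LinearMap.mulLeft k v * actL (kappaHom hb u))
    (fun u u' v => by ext; simp [actL, LinearMap.rTensor_add, mul_add])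
    (fun c u v => by ext; simp [actL, LinearMap.rTensor_smul])
    (fun u v v' => by ext; simp [add_mul])
    (fun c u v => by ext; simp))

/-- The right-hand side of the commutation condition, for `∑ x₁ ⊗ x₂` a general tensor. -/
def commR {b : k} (hb : b ^ 4 = -1) : H8 k ⊗[k] H8 k →ₗ[k] Module.End k (H8 k) :=
  TensorProduct.lift (LinearMap.mk₂ k (fun u v => LinearMap.mulRight k u * actR (kappaHom hb v))
    (fun u u' v => by ext; simp [mul_add])
    (fun c u v => by ext; simp)
    (fun u v v' => by ext; simp [actR, LinearMap.lTensor_add, add_mul])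
    (fun c u v => by ext; simp [actR, LinearMap.lTensor_smul]))

theorem commL_tmul {b : k} (hb : b ^ 4 = -1) (u v : H8 k) :
    commL hb (u ⊗ₜ v) = LinearMap.mulLeft k v * actL (kappaHom hb u) := rfl

theorem commR_tmul {b : k} (hb : b ^ 4 = -1) (u v : H8 k) :
    commR hb (u ⊗ₜ v) = LinearMap.mulRight k u * actR (kappaHom hb v) := rfl

theorem commL_mul {b : k} (hb : b ^ 4 = -1) (u v : H8 k) (t : H8 k ⊗[k] H8 k) :
    commL hb ((u ⊗ₜ v) * t) = LinearMap.mulLeft k v * commL hb t * actL (kappaHom hb u) := by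
  induction t with
  | zero => simp
  | add s t hs ht => simp only [mul_add, add_mul, map_add, hs, ht]
  | tmul a c =>
    rw [Algebra.TensorProduct.tmul_mul_tmul, commL_tmul, commL_tmul, map_mul, actL_mul,
      LinearMap.mulLeft_mul]
    rfl

/-- The right-hand side of the commutation condition obeys the same recursion as the left-hand side,
by the commutation condition for a generator and the commutation of the two actions. -/
theorem commR_x_mul {b : k} (hb : b ^ 4 = -1) (i j : Fin 2) (t : H8 k ⊗[k] H8 k) :
    commR hb ((x k i 0 ⊗ₜ x k 0 j + x k i 1 ⊗ₜ x k 1 j) * t) =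
      ∑ a, LinearMap.mulLeft k (x k a j) * commR hb t * actL (phi hb i a) := by
  induction t with
  | zero => simp
  | add s t hs ht =>
    simp only [mul_add, add_mul, map_add, Finset.sum_add_distrib] at hs ht ⊢
    rw [← hs, ← ht]
  | tmul u v =>
    refine LinearMap.ext fun z => ?_
    have h := phi_comm hb i j (actR (kappaHom hb v) z)
    have hc := fun a => LinearMap.congr_fun (actL_comm_actR (phi hb i a) (kappaHom hb v)) z
    simp only [Module.End.mul_apply, Fin.sum_univ_two] at h hc
    have h' := congrArg (fun z => z * u) h
    simp only [add_mul, mul_assoc] at h'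
    simp only [add_mul, Algebra.TensorProduct.tmul_mul_tmul, map_add, commR_tmul, map_mul,
      actR_mul, kappaHom_x, Fin.sum_univ_two, LinearMap.add_apply, Module.End.mul_apply,
      LinearMap.mulLeft_apply, LinearMap.mulRight_apply, ← hc]
    rw [h']

theorem commL_comul_eq {b : k} (hb : b ^ 4 = -1) (a : H8 k) :
    commL hb (Coalgebra.comul (R := k) a) = commR hb (Coalgebra.comul (R := k) a) := by
  induction a using span_induction with
  | h1 =>
    ext z
    simp [Algebra.TensorProduct.one_def, commL_tmul, commR_tmul, actL_apply, actR_apply,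
      LinearMap.convOne_def]
  | hadd a c ha hc => simp only [map_add, ha, hc]
  | hsmul c a ha => simp only [map_smul, ha]
  | hmul i j a ha =>
    rw [comul_x_mul, commR_x_mul, add_mul, map_add, commL_mul, commL_mul, ha, kappaHom_x,
      kappaHom_x, Fin.sum_univ_two]

/-- The braiding `κ_b` of `H₈`, for `b` with `b⁴ = -1`: the braiding with
`κ(x₀₁, x₀₁) = κ(x₁₀, x₁₀) = b`, `κ(x₀₁, x₁₀) = κ(x₁₀, x₀₁) = b⁻¹ = -b³`, and value zero on all
other pairs of generators (see `kappa_form_x`). -/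
def kappa {b : k} (hb : b ^ 4 = -1) : Braiding k (H8 k) where
  form := kappaForm hb
  isUnit := kappaForm_isUnit hb
  comm a c := by
    rw [comul_tmul']
    have hL : ∀ t : H8 k ⊗[k] H8 k, TensorProduct.lid k (H8 k) (TensorProduct.map
        (kappaForm hb) (LinearMap.mul' k (H8 k)) (TensorProduct.tensorTensorTensorComm k _ _ _ _
          (t ⊗ₜ Coalgebra.comul (R := k) c))) = commL hb t c := by
      intro t
      induction t with
      | zero => simp
      | add s t hs ht => simp only [add_tmul, map_add, hs, ht, LinearMap.add_apply]
      | tmul u v =>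
        rw [commL_tmul, Module.End.mul_apply, actL_apply]
        induction (Coalgebra.comul c : H8 k ⊗[k] H8 k) with
        | zero => simp
        | add s t hs ht => simp only [tmul_add, map_add, hs, ht]
        | tmul p q => simp [kappaForm_tmul]
    have hR : ∀ t : H8 k ⊗[k] H8 k, TensorProduct.rid k (H8 k) (TensorProduct.map
        (LinearMap.mul' k (H8 k) ∘ₗ (TensorProduct.comm k (H8 k) (H8 k)).toLinearMap)
        (kappaForm hb) (TensorProduct.tensorTensorTensorComm k _ _ _ _
          (t ⊗ₜ Coalgebra.comul (R := k) c))) = commR hb t c := by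
      intro t
      induction t with
      | zero => simp
      | add s t hs ht => simp only [add_tmul, map_add, hs, ht, LinearMap.add_apply]
      | tmul u v =>
        rw [commR_tmul, Module.End.mul_apply, actR_apply]
        induction (Coalgebra.comul c : H8 k ⊗[k] H8 k) with
        | zero => simp
        | add s t hs ht => simp only [tmul_add, map_add, hs, ht]
        | tmul p q => simp [kappaForm_tmul]
    rw [hL, hR, commL_comul_eq]
  mul_left := kappaForm_mul_left hb
  mul_right := kappaForm_mul_right hb

theorem kappa_form_x {b : k} (hb : b ^ 4 = -1) (i j l m : Fin 2) :
    (kappa hb).form (x k i j ⊗ₜ x k l m) = kappaMatrix b l m i j := by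
  change kappaForm hb _ = _
  rw [kappaForm_tmul, kappaHom_x, phi_x]

/-! ### The list of braidings -/

/-- The invariant of a braiding `σ` of `H₈` that classifies it up to braided Morita equivalence:
the scalar by which the braiding of the two-dimensional simple module `V` with itself acts on
the invariants of `V ⊗ V` (see `braid_invVec`). -/
def twist (σ : Braiding k (H8 k)) : k :=
  σ.form (x k 0 0 ⊗ₜ x k 0 0) + σ.form (x k 0 1 ⊗ₜ x k 0 1)

theorem twist_tau (γ δ : ℤˣ) : twist (tau k γ δ) = ((γ : ℤ) : k) := by
  simp [twist, tau_form_x]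

theorem twist_kappa {b : k} (hb : b ^ 4 = -1) : twist (kappa hb) = b := by
  simp [twist, kappa_form_x, kappaMatrix]

/-- There are exactly two families of braidings of `H₈`, one for each case of `form_cases`. -/
theorem eq_tau_or_eq_kappa (h2 : (2 : k) ≠ 0) (σ : Braiding k (H8 k)) :
    (∃ γ δ : ℤˣ, σ = tau k γ δ) ∨ ∃ (b : k) (hb : b ^ 4 = -1), σ = kappa hb := by
  have sign : ∀ a : k, a ^ 2 = 1 → ∃ γ : ℤˣ, a = ((γ : ℤ) : k) := fun a ha =>
    (mul_self_eq_one_iff.1 ((pow_two a).symm.trans ha)).elim (fun h => ⟨1, by simp [h]⟩)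
      fun h => ⟨-1, by simp [h]⟩
  rcases form_cases h2 σ with ⟨hb, hc, ha, hd⟩ | ⟨ha, hd, hbc, h⟩
  · obtain ⟨γ, hγ⟩ := sign _ ha
    obtain ⟨δ, hδ⟩ := sign _ hd
    refine Or.inl ⟨γ, δ, braiding_ext fun i j l m => ?_⟩
    rw [form_x_eq h2, tau_form_x, hb, hc, hγ, hδ]
    fin_cases i <;> fin_cases j <;> fin_cases l <;> fin_cases m <;> simp
  · have hb : σ.form (x k 0 1 ⊗ₜ x k 0 1) ^ 4 = -1 := by
      linear_combination σ.form (x k 0 1 ⊗ₜ x k 0 1) ^ 2 * h -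
        (σ.form (x k 0 1 ⊗ₜ x k 0 1) * σ.form (x k 0 1 ⊗ₜ x k 1 0) + 1) * hbc
    have hc : σ.form (x k 0 1 ⊗ₜ x k 1 0) = -σ.form (x k 0 1 ⊗ₜ x k 0 1) ^ 3 := by
      linear_combination σ.form (x k 0 1 ⊗ₜ x k 1 0) * hb -
        σ.form (x k 0 1 ⊗ₜ x k 0 1) ^ 3 * hbc
    refine Or.inr ⟨_, hb, braiding_ext fun i j l m => ?_⟩
    have n1 : (-1 : Fin 2) = 1 := rfl
    rw [form_x_eq h2, kappa_form_x, ha, hd, hc]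
    fin_cases i <;> fin_cases j <;> fin_cases l <;> fin_cases m <;> simp [kappaMatrix, n1]

end H8
end

noncomputable section

namespace QTMod
variable {k : Type u} [Field k] {A B : Type u} [Ring A] [Bialgebra k A] [Ring B] [Bialgebra k B]

/-! ### Restriction along an isomorphism of quasitriangular bialgebras -/

/-- Restriction of modules along an algebra isomorphism. -/
def restrict (R : RMatrix k A) (R' : RMatrix k B) (φ : B ≃ₐ[k] A) : QTMod R ⥤ QTMod R' where
  obj M := { V := M.V, ρ := M.ρ.comp φ.toAlgHom }
  map f := ⟨f.lin, fun b m => f.comm (φ b) m⟩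

variable (R : RMatrix k A) (R' : RMatrix k B) (φ : B ≃ₐ[k] A)

instance : (restrict R R' φ).Faithful where
  map_injective {M N} _ _ h := hom_ext (congrArg
    (fun f : (restrict R R' φ).obj M ⟶ (restrict R R' φ).obj N => Hom.lin f) h)

instance : (restrict R R' φ).Full where
  map_surjective {M N} f := ⟨⟨f.lin, fun a m => by
    have h := f.comm (φ.symm a) m
    change f.lin (M.ρ (φ (φ.symm a)) m) = N.ρ (φ (φ.symm a)) (f.lin m) at h
    rwa [φ.apply_symm_apply] at h⟩, rfl⟩

instance : (restrict R R' φ).EssSurj where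
  mem_essImage N := ⟨{ V := N.V, ρ := N.ρ.comp φ.symm.toAlgHom },
    ⟨mkIso (LinearEquiv.refl k N.V) fun b m => by
      change N.ρ (φ.symm (φ b)) m = N.ρ b m
      rw [φ.symm_apply_apply]⟩⟩

instance : (restrict R R' φ).IsEquivalence where

instance : (restrict R R' φ).Additive where

instance : (restrict R R' φ).Linear k where

variable {R R' φ}

theorem tensorAct_restrict {V W : Type u} [AddCommGroup V] [Module k V] [AddCommGroup W]
    [Module k W] (ρ : A →ₐ[k] Module.End k V) (σ : A →ₐ[k] Module.End k W) (t : B ⊗[k] B) :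
    tensorAct (ρ.comp φ.toAlgHom) (σ.comp φ.toAlgHom) t =
      tensorAct ρ σ (Algebra.TensorProduct.map φ.toAlgHom φ.toAlgHom t) :=
  tensorAct_comp ρ σ φ.toAlgHom φ.toAlgHom t

/-- Restriction along an isomorphism of bialgebras is a monoidal functor, with identities as
structure morphisms. -/
def restrictCoreMonoidal
    (hΔ : ∀ b, Algebra.TensorProduct.map φ.toAlgHom φ.toAlgHom (Bialgebra.comulAlgHom k B b) =
      Bialgebra.comulAlgHom k A (φ b))
    (hε : ∀ b, Coalgebra.counit (R := k) (φ b) = Coalgebra.counit (R := k) b) :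
    (restrict R R' φ).CoreMonoidal where
  εIso := mkIso (LinearEquiv.refl k k) fun b c => by
    change Coalgebra.counit (R := k) b • c = Coalgebra.counit (R := k) (φ b) • c
    rw [hε]
  μIso M N := mkIso (LinearEquiv.refl k (M.V ⊗[k] N.V)) fun b x => by
    change tensorAct (M.ρ.comp φ.toAlgHom) (N.ρ.comp φ.toAlgHom) (Bialgebra.comulAlgHom k B b) x =
      tensorAct M.ρ N.ρ (Bialgebra.comulAlgHom k A (φ b)) x
    rw [tensorAct_restrict, hΔ]
  μIso_hom_natural_left f X := rfl
  μIso_hom_natural_right X f := rfl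
  associativity X Y Z := hom_ext <| TensorProduct.ext_threefold fun x y z => by
    change TensorProduct.assoc k X.V Y.V Z.V ((x ⊗ₜ y) ⊗ₜ z) =
      TensorProduct.map LinearMap.id LinearMap.id
        (TensorProduct.assoc k X.V Y.V Z.V ((x ⊗ₜ y) ⊗ₜ z))
    rfl
  left_unitality X := hom_ext <| TensorProduct.ext' fun _ _ => rfl
  right_unitality X := hom_ext <| TensorProduct.ext' fun _ _ => rfl

theorem restrict_braided
    (hΔ : ∀ b, Algebra.TensorProduct.map φ.toAlgHom φ.toAlgHom (Bialgebra.comulAlgHom k B b) =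
      Bialgebra.comulAlgHom k A (φ b))
    (hε : ∀ b, Coalgebra.counit (R := k) (φ b) = Coalgebra.counit (R := k) b)
    (hR : Algebra.TensorProduct.map φ.toAlgHom φ.toAlgHom R'.elt = R.elt) :
    Nonempty (restrict R R' φ).Braided := by
  let _ : (restrict R R' φ).Monoidal := (restrictCoreMonoidal hΔ hε).toMonoidal
  refine ⟨⟨fun M N => hom_ext <| LinearMap.ext fun x => ?_⟩⟩
  change TensorProduct.comm k M.V N.V (tensorAct M.ρ N.ρ R.elt x) =
    TensorProduct.comm k M.V N.V
      (tensorAct (M.ρ.comp φ.toAlgHom) (N.ρ.comp φ.toAlgHom) R'.elt x)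
  rw [tensorAct_restrict, hR]

end QTMod

namespace Braiding
open DualAlg
variable {k : Type u} [Field k] {A : Type u} [Ring A] [Bialgebra k A]

/-- The algebra endomorphism `f ↦ f ∘ θ` of the dual algebra. -/
def dualMap (θ : A →ₐc[k] A) : DualAlg k A →ₐ[k] DualAlg k A :=
  AlgHom.ofLinearMap
    ((WithConv.linearEquiv k _).symm.toLinearMap ∘ₗ
      LinearMap.lcomp k k (θ.toCoalgHom.toLinearMap) ∘ₗ (WithConv.linearEquiv k _).toLinearMap)
    (WithConv.ext <| LinearMap.ext fun a => by
      simp [LinearMap.convOne_def])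
    (fun f g => WithConv.ext (LinearMap.convMul_comp_coalgHom_distrib f g θ.toCoalgHom))

theorem dualMap_apply (θ : A →ₐc[k] A) (f : DualAlg k A) (a : A) : dualMap θ f a = f (θ a) := rfl

theorem pairHom_map_dualMap (θ : A →ₐc[k] A) (t : DualAlg k A ⊗[k] DualAlg k A) (a b : A) :
    pairHom k A A (Algebra.TensorProduct.map (dualMap θ) (dualMap θ) t) (a ⊗ₜ b) =
      pairHom k A A t (θ a ⊗ₜ θ b) := by
  induction t with
  | zero => simp
  | add s t hs ht => simp only [map_add, WithConv.ofConv_add, LinearMap.add_apply, hs, ht]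
  | tmul f g => simp [dualMap_apply]

variable [Module.Finite k A]

/-- Braidings that correspond to each other under an involution of the bialgebra `A` are braided
Morita equivalent. -/
theorem moritaEquivalent_of_involutive (θ : A →ₐc[k] A) (hθ : Function.Involutive θ)
    (σ σ' : Braiding k A) (h : ∀ a b, σ'.form (θ a ⊗ₜ θ b) = σ.form (a ⊗ₜ b)) :
    MoritaEquivalent σ σ' := by
  have hd : (dualMap θ).comp (dualMap θ) = AlgHom.id k (DualAlg k A) :=
    AlgHom.ext fun f => WithConv.ext <| LinearMap.ext fun a => congrArg f.ofConv (hθ a)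
  let φ : DualAlg k A ≃ₐ[k] DualAlg k A := AlgEquiv.ofAlgHom (dualMap θ) (dualMap θ) hd hd
  refine ⟨QTMod.restrict _ _ φ, inferInstance, inferInstance, inferInstance,
    QTMod.restrict_braided (fun f => ?_) (fun f => ?_) ?_⟩
  · refine ext_pair fun a b => ?_
    refine (pairHom_map_dualMap θ _ a b).trans ?_
    rw [comulAlgHom_eq, pairHom_comulHom_tmul, pairHom_comulHom_tmul]
    change _ = f (θ (a * b))
    rw [map_mul θ]
  · change f (θ 1) = f 1
    rw [map_one]
  · refine ext_pair fun a b => ?_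
    refine (pairHom_map_dualMap θ _ a b).trans ?_
    have e : ∀ τ : Braiding k A, pairHom k A A τ.toRMatrix.elt = WithConv.toConv τ.form :=
      fun τ => (pairEquiv k A A).apply_symm_apply _
    rw [e, e]
    exact h a b

end Braiding

namespace H8
variable {k : Type u} [Field k]

variable (k) in
/-- The automorphism `x i j ↦ x (1 - i) (1 - j)` of `H₈`. -/
def swap : H8 k →ₐc[k] H8 k :=
  BialgHom.ofAlgHom
    (lift (fun i j => x k (1 - i) (1 - j))
      (by simp [sq_diag])
      (by simp [sq_offdiag])
      (fun i j l m h => mixed (by revert i j l m; decide))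
      (by
        have h := unit_rel_right (k := k) 1 1
        rw [add_comm] at h
        simpa using h)
      (by simp [comm_rel])
      (by simp [anticomm_rel]))
    (algHom_ext fun i j => by simp)
    (algHom_ext fun i j => by
      simp [add_comm])

@[simp] theorem swap_x (i j : Fin 2) : swap k (x k i j) = x k (1 - i) (1 - j) := lift_x ..

theorem swap_involutive : Function.Involutive (swap k) := by
  have h : (swap k : H8 k →ₐ[k] H8 k).comp (swap k : H8 k →ₐ[k] H8 k) = AlgHom.id k (H8 k) :=
    algHom_ext fun i j => by simp
  exact fun a => AlgHom.congr_fun h a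

/-- The automorphism of `ℤ/2 × ℤ/2` that exchanges the two factors. -/
def groupSwap : G →* G :=
  AddMonoidHom.toMultiplicative (AddMonoidHom.prod (AddMonoidHom.snd (ZMod 2) (ZMod 2))
    (AddMonoidHom.fst (ZMod 2) (ZMod 2)))

theorem bichar_groupSwap (γ δ : ℤˣ) (p q : G) :
    bichar γ (-δ) (groupSwap p) (groupSwap q) = bichar γ δ p q := by
  revert γ δ p q; decide

theorem toGroup_swap (a : H8 k) : toGroup k (swap k a) =
    MonoidAlgebra.mapDomainAlgHom k k groupSwap (toGroup k a) := by
  have h : ((toGroup k : H8 k →ₐc[k] _) : H8 k →ₐ[k] _).comp (swap k : H8 k →ₐ[k] H8 k) =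
      (MonoidAlgebra.mapDomainAlgHom k k groupSwap).comp
        ((toGroup k : H8 k →ₐc[k] _) : H8 k →ₐ[k] _) :=
    algHom_ext fun i j => by
      have e0 : groupSwap (e 0) = e 1 := by decide
      have e1 : groupSwap (e 1) = e 0 := by decide
      fin_cases i <;> fin_cases j <;> simp [e0, e1]
  exact AlgHom.congr_fun h a

/-- The automorphism `swap` turns `τ⁻_{γ,δ}` into `τ⁻_{γ,-δ}`. -/
theorem tau_equiv (γ δ : ℤˣ) : Braiding.MoritaEquivalent (tau k γ δ) (tau k γ (-δ)) := by
  refine Braiding.moritaEquivalent_of_involutive (swap k) swap_involutive _ _ fun a b => ?_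
  change tauForm k γ (-δ) _ = tauForm k γ δ _
  rw [tauForm_tmul, tauForm_tmul, toGroup_swap, toGroup_swap]
  induction toGroup k a using MonoidAlgebra.induction_linear with
  | zero => simp
  | add u v hu hv => simp only [map_add, add_tmul, hu, hv]
  | single p c =>
    induction toGroup k b using MonoidAlgebra.induction_linear with
    | zero => simp
    | add u v hu hv => simp only [map_add, tmul_add, hu, hv]
    | single q d => simp [bicharForm_single, bichar_groupSwap]

end H8
end

noncomputable section

open MonoidalCategory in
/-- The scalar `w` is a twist of the quasitriangular bialgebra `(A, R)` if the braiding acts by `w`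
on a nonzero morphism `1 ⟶ W ⊗ W`, for an object `W` that has only scalar endomorphisms while
`W ⊗ W` has others. The last condition excludes the one-dimensional modules. -/
def HasTwist {k : Type u} [Field k] {A : Type u} [Ring A] [Bialgebra k A] (R : RMatrix k A)
    (w : k) : Prop :=
  ∃ W : QTMod R, (∀ f : W ⟶ W, ∃ c : k, f = c • 𝟙 W) ∧
    (∃ g : W ⊗ W ⟶ W ⊗ W, ∀ c : k, g ≠ c • 𝟙 (W ⊗ W)) ∧
    ∃ h : 𝟙_ (QTMod R) ⟶ W ⊗ W, h ≠ 0 ∧ h ≫ (β_ W W).hom = w • h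

open MonoidalCategory Functor.LaxMonoidal Functor.OplaxMonoidal in
/-- Twists are preserved by braided Morita equivalence. -/
theorem HasTwist.of_equivalent {k : Type u} [Field k] {A B : Type u} [Ring A] [Bialgebra k A]
    [Ring B] [Bialgebra k B] {R : RMatrix k A} {R' : RMatrix k B} {w : k} (hw : HasTwist R w)
    (h : BraidedMoritaEquivalent R R') : HasTwist R' w := by
  obtain ⟨F, _, _, _, ⟨_⟩⟩ := h
  obtain ⟨W, hend, ⟨g, hg⟩, h, h0, hβ⟩ := hw
  refine ⟨F.obj W, fun f => ?_, ⟨μ F W W ≫ F.map g ≫ δ F W W, fun c hc => hg c ?_⟩,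
    ε F ≫ F.map h ≫ δ F W W, fun h00 => h0 ?_, ?_⟩
  · obtain ⟨f, rfl⟩ := F.map_surjective f
    obtain ⟨c, rfl⟩ := hend f
    exact ⟨c, by rw [F.map_smul, F.map_id]⟩
  · apply F.map_injective
    have := congrArg (fun z => δ F W W ≫ z ≫ μ F W W) hc
    simpa [F.map_smul] using this
  · apply F.map_injective
    have := congrArg (fun z => η F ≫ z ≫ μ F W W) h00
    simpa using this
  · have e : δ F W W ≫ (β_ (F.obj W) (F.obj W)).hom = F.map (β_ W W).hom ≫ δ F W W := by
      simp [Functor.map_braiding]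
    rw [Category.assoc, Category.assoc, e, ← F.map_comp_assoc, hβ, F.map_smul, Linear.smul_comp,
      Linear.comp_smul]

namespace H8
variable {k : Type u} [Field k]
open DualAlg

/-! ### The two-dimensional simple module -/

variable (k) in
/-- The two-dimensional representation of the dual algebra with matrix `(a (x i j))`. -/
def stdRep : DualAlg k (H8 k) →ₐ[k] Module.End k (Fin 2 → k) :=
  Matrix.toLinAlgEquiv'.toAlgHom.comp <| AlgHom.ofLinearMap
    { toFun := fun a => Matrix.of fun i j => a (x k i j)
      map_add' := fun _ _ => rfl
      map_smul' := fun _ _ => rfl }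
    (by
      refine Matrix.ext fun i j => ?_
      change (1 : DualAlg k (H8 k)) (x k i j) = (1 : Matrix (Fin 2) (Fin 2) k) i j
      simp [Matrix.one_apply])
    (fun a b => by
      refine Matrix.ext fun i j => ?_
      change (a * b) (x k i j) = ((Matrix.of fun i j => a (x k i j)) *
        (Matrix.of fun i j => b (x k i j)) : Matrix (Fin 2) (Fin 2) k) i j
      rw [conv_apply_x, Matrix.mul_apply, Fin.sum_univ_two]
      rfl)

theorem stdRep_apply (a : DualAlg k (H8 k)) (v : Fin 2 → k) (i : Fin 2) :
    stdRep k a v i = a (x k i 0) * v 0 + a (x k i 1) * v 1 := by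
  change Matrix.mulVec (Matrix.of fun i j => a (x k i j)) v i = _
  simp [Matrix.mulVec, dotProduct]

/-- The standard basis vectors of the two-dimensional module. -/
abbrev vec (i : Fin 2) : Fin 2 → k := Pi.single i 1

theorem stdRep_vec (a : DualAlg k (H8 k)) (i : Fin 2) :
    stdRep k a (vec i) = a (x k 0 i) • vec 0 + a (x k 1 i) • vec 1 := by
  ext j
  rw [stdRep_apply]
  fin_cases i <;> fin_cases j <;> simp [vec]

theorem tensorAct_vec (t : DualAlg k (H8 k) ⊗[k] DualAlg k (H8 k)) (i l : Fin 2) :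
    QTMod.tensorAct (stdRep k) (stdRep k) t (vec i ⊗ₜ vec l) =
      ∑ p, ∑ q, pairHom k _ _ t (x k p i ⊗ₜ x k q l) • (vec p ⊗ₜ[k] vec q) := by
  induction t with
  | zero => simp
  | add s t hs ht =>
    simp only [map_add, LinearMap.add_apply, WithConv.ofConv_add, hs, ht, add_smul,
      Finset.sum_add_distrib]
  | tmul a b =>
    rw [QTMod.tensorAct_tmul, stdRep_vec, stdRep_vec]
    simp only [Fin.sum_univ_two, pairHom_tmul_tmul, add_tmul, tmul_add, smul_tmul_smul]
    abel

/-- The two-dimensional simple module over the dual of `(H₈, σ)`. -/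
def stdMod (σ : Braiding k (H8 k)) : QTMod σ.toRMatrix where
  V := Fin 2 → k
  ρ := stdRep k

variable (k) in
/-- The invariant vector of the tensor square of the two-dimensional module. -/
def invVec : (Fin 2 → k) ⊗[k] (Fin 2 → k) := vec 0 ⊗ₜ vec 0 + vec 1 ⊗ₜ vec 1

/-- Linear forms on the tensor square of the two-dimensional module that read off coordinates. -/
def tensorCoord (i l : Fin 2) : (Fin 2 → k) ⊗[k] (Fin 2 → k) →ₗ[k] k :=
  LinearMap.mul' k k ∘ₗ TensorProduct.map (LinearMap.proj i) (LinearMap.proj l)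

theorem invVec_ne_zero : invVec k ≠ 0 := fun h => by
  have := congrArg (tensorCoord 0 0) h
  simp [invVec, tensorCoord] at this

theorem act_invVec (a : DualAlg k (H8 k)) :
    QTMod.tensorAct (stdRep k) (stdRep k) (Bialgebra.comulAlgHom k _ a) (invVec k) =
      a 1 • invVec k := by
  have h := fun p q => congrArg a.ofConv (unit_rel_right (k := k) p q)
  simp only [map_add] at h
  have h00 := h 0 0
  have h01 := h 0 1
  have h10 := h 1 0
  have h11 := h 1 1
  simp only [if_true, zero_ne_one, one_ne_zero, if_false, map_zero] at h00 h01 h10 h11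
  rw [invVec, map_add, tensorAct_vec, tensorAct_vec, comulAlgHom_eq]
  simp only [pairHom_comulHom_tmul, Fin.sum_univ_two]
  rw [eq_neg_of_add_eq_zero_left h01, eq_neg_of_add_eq_zero_left h10, ← h00,
    eq_sub_of_add_eq (h11.trans h00.symm)]
  module

/-- The integral projects the tensor square onto the line of invariants. -/
theorem haar_act (h2 : (2 : k) ≠ 0) (v : (Fin 2 → k) ⊗[k] (Fin 2 → k)) :
    ∃ c : k, QTMod.tensorAct (stdRep k) (stdRep k) (Bialgebra.comulAlgHom k _ (haar k)) v =
      c • invVec k := by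
  have h : ∀ i l, QTMod.tensorAct (stdRep k) (stdRep k) (Bialgebra.comulAlgHom k _ (haar k))
      (vec i ⊗ₜ vec l) = (if i = l then 2⁻¹ else 0 : k) • invVec k := by
    intro i l
    rw [tensorAct_vec, comulAlgHom_eq]
    simp only [pairHom_comulHom_tmul, Fin.sum_univ_two, haar_x_mul_x h2, invVec]
    by_cases hil : i = l <;> simp [hil]
  have hv : ∀ v : Fin 2 → k, v = v 0 • vec 0 + v 1 • vec 1 := fun v => by
    ext i
    fin_cases i <;> simp [vec]
  induction v with
  | zero => exact ⟨0, by simp⟩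
  | add s t hs ht =>
    obtain ⟨c, hc⟩ := hs
    obtain ⟨d, hd⟩ := ht
    exact ⟨c + d, by rw [map_add, hc, hd, add_smul]⟩
  | tmul v w =>
    rw [hv v, hv w]
    simp only [add_tmul, tmul_add, smul_tmul_smul, map_add, map_smul, h, smul_smul, ← add_smul]
    exact ⟨_, rfl⟩

theorem act_elt (σ : Braiding k (H8 k)) (i l : Fin 2) :
    QTMod.tensorAct (stdRep k) (stdRep k) σ.toRMatrix.elt (vec i ⊗ₜ vec l) =
      ∑ p, ∑ q, σ.form (x k p i ⊗ₜ x k q l) • (vec p ⊗ₜ[k] vec q) := by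
  have hσ : pairHom k _ _ σ.toRMatrix.elt = WithConv.toConv σ.form :=
    (pairEquiv k _ _).apply_symm_apply _
  rw [tensorAct_vec, hσ]

theorem braid_invVec (h2 : (2 : k) ≠ 0) (σ : Braiding k (H8 k)) :
    TensorProduct.comm k _ _ (QTMod.tensorAct (stdRep k) (stdRep k) σ.toRMatrix.elt (invVec k)) =
      twist σ • invVec k := by
  have n1 : (-1 : Fin 2) = 1 := rfl
  rw [invVec, map_add, act_elt, act_elt, twist]
  simp only [Fin.sum_univ_two]
  rw [form_x_eq h2 σ 0 0 1 0, form_x_eq h2 σ 1 0 0 0, form_x_eq h2 σ 1 0 1 0,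
    form_x_eq h2 σ 0 1 1 1, form_x_eq h2 σ 1 1 0 1, form_x_eq h2 σ 1 1 1 1]
  simp [n1]
  module

theorem stdRep_E (h2 : (2 : k) ≠ 0) (i j : Fin 2) (v : Fin 2 → k) :
    stdRep k (E k i j) v = v j • vec i := by
  ext l
  rw [stdRep_apply, E_x h2, E_x h2]
  fin_cases i <;> fin_cases j <;> fin_cases l <;> simp [vec]

/-- Endomorphisms commute with the matrix units, so they are scalar. -/
theorem eq_smul_id_of_comm (h2 : (2 : k) ≠ 0) (f : (Fin 2 → k) →ₗ[k] (Fin 2 → k))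
    (hf : ∀ a v, f (stdRep k a v) = stdRep k a (f v)) : f = f (vec 0) 0 • LinearMap.id := by
  refine LinearMap.pi_ext' fun i => LinearMap.ext_ring ?_
  have h := hf (E k i 0) (vec 0)
  rw [stdRep_E h2, stdRep_E h2] at h
  simpa using h

/-- The braiding of the two-dimensional module with itself is not scalar: its coordinates off the
diagonal are values of `σ` that do not all vanish. -/
theorem braid_ne_smul_id (h2 : (2 : k) ≠ 0) (σ : Braiding k (H8 k)) (c : k) :
    (TensorProduct.comm k (Fin 2 → k) (Fin 2 → k)).toLinearMap ∘ₗ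
      QTMod.tensorAct (stdRep k) (stdRep k) σ.toRMatrix.elt ≠ c • LinearMap.id := by
  intro hc
  have h := fun i l => LinearMap.congr_fun hc (vec i ⊗ₜ vec l)
  simp only [LinearMap.comp_apply, LinearEquiv.coe_coe, act_elt] at h
  have hb := congrArg (tensorCoord 1 1) (h 0 0)
  have hd := congrArg (tensorCoord 1 0) (h 0 1)
  simp [tensorCoord, form_x_eq h2 σ 1 0 1 0] at hb hd
  rcases form_cases h2 σ with h | h
  · have := h.2.2.2
    simp [hd] at this
  · have := h.2.2.1
    simp [hb] at this

open MonoidalCategory in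
theorem hasTwist_twist (h2 : (2 : k) ≠ 0) (σ : Braiding k (H8 k)) :
    HasTwist σ.toRMatrix (twist σ) := by
  refine ⟨stdMod σ, fun f => ⟨_, QTMod.hom_ext (eq_smul_id_of_comm h2 f.lin f.comm)⟩,
    ⟨(β_ (stdMod σ) (stdMod σ)).hom, fun c hc =>
      braid_ne_smul_id h2 σ c (congrArg QTMod.Hom.lin hc)⟩,
    ⟨LinearMap.toSpanSingleton k _ (invVec k), fun a (m : k) => ?_⟩, fun h => ?_,
    QTMod.hom_ext (LinearMap.ext_ring ?_)⟩
  · change (a 1 * m) • invVec k =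
      QTMod.tensorAct (stdRep k) (stdRep k) (Bialgebra.comulAlgHom k _ a) (m • invVec k)
    rw [map_smul, act_invVec, smul_smul, mul_comm]
  · refine invVec_ne_zero (k := k) ?_
    have := LinearMap.congr_fun (congrArg QTMod.Hom.lin h) (1 : k)
    exact (one_smul k (invVec k)).symm.trans this
  · change TensorProduct.comm k _ _ (QTMod.tensorAct (stdRep k) (stdRep k) σ.toRMatrix.elt
      ((1 : k) • invVec k)) = twist σ • (1 : k) • invVec k
    rw [one_smul, braid_invVec h2]

/-- A functional that takes the value one at a given nonzero vector. -/
theorem exists_apply_eq_one {V : Type*} [AddCommGroup V] [Module k V] {v : V} (hv : v ≠ 0) :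
    ∃ f : V →ₗ[k] k, f v = 1 := by
  obtain ⟨f, hf⟩ := not_forall.1 (mt (Module.forall_dual_apply_eq_zero_iff k v).1 hv)
  exact ⟨(f v)⁻¹ • f, by simp [hf]⟩

open MonoidalCategory in
/-- A module with only scalar endomorphisms on which the matrix unit `E 0 0` does not vanish is
isomorphic to the two-dimensional module. -/
theorem nonempty_iso_stdMod_of_ne_zero (h2 : (2 : k) ≠ 0) {σ : Braiding k (H8 k)}
    (W : QTMod σ.toRMatrix) (hend : ∀ f : W ⟶ W, ∃ c : k, f = c • 𝟙 W) {w : W.V}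
    (hw : W.ρ (E k 0 0) w ≠ 0) : Nonempty (W ≅ stdMod σ) := by
  obtain ⟨f, hf⟩ := exists_apply_eq_one (k := k) hw
  have hmul : ∀ a b m, W.ρ a (W.ρ b m) = W.ρ (a * b) m := fun a b m => by
    rw [map_mul, Module.End.mul_apply]
  let T' : (Fin 2 → k) →ₗ[k] W.V := ∑ i, (LinearMap.proj i).smulRight (W.ρ (E k i 0) w)
  have hT' : ∀ v, T' v = v 0 • W.ρ (E k 0 0) w + v 1 • W.ρ (E k 1 0) w := fun v => by simp [T']
  let T : stdMod σ ⟶ W := ⟨T', fun a (v : Fin 2 → k) => by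
    change T' (stdRep k a v) = W.ρ a (T' v)
    rw [hT', hT', map_add, map_smul, map_smul, hmul, hmul, mul_E h2, mul_E h2, stdRep_apply,
      stdRep_apply]
    simp only [map_add, map_smul, LinearMap.add_apply, LinearMap.smul_apply]
    module⟩
  let S' : W.V →ₗ[k] (Fin 2 → k) := LinearMap.pi fun i => f ∘ₗ W.ρ (E k 0 i)
  have hS' : ∀ m i, S' m i = f (W.ρ (E k 0 i) m) := fun _ _ => rfl
  let S : W ⟶ stdMod σ := ⟨S', fun a m => funext fun i => by
    change S' (W.ρ a m) i = stdRep k a (S' m) i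
    rw [stdRep_apply, hS', hS', hS', hmul, E_mul h2]
    simp⟩
  have hTS : T ≫ S = 𝟙 _ := QTMod.hom_ext <| LinearMap.ext fun (v : Fin 2 → k) => funext fun i => by
    change S' (T' v) i = v i
    rw [hS', hT', map_add, map_smul, map_smul, hmul, hmul, E_mul_E h2, E_mul_E h2]
    fin_cases i <;> simp [hf]
  obtain ⟨c, hc⟩ := hend (S ≫ T)
  have hc1 : c = 1 := by
    have h : T ≫ (S ≫ T) = T := by rw [← Category.assoc, hTS, Category.id_comp]
    rw [hc, Linear.comp_smul, Category.comp_id] at h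
    have h' : c • T' (vec 0) = T' (vec 0) :=
      LinearMap.congr_fun (congrArg QTMod.Hom.lin h) (vec 0)
    have h'' := congrArg f h'
    simpa [hT', hf, vec] using h''
  refine ⟨⟨S, T, by rw [hc, hc1, one_smul], hTS⟩⟩

open MonoidalCategory in
/-- The two-dimensional simple module is characterized up to isomorphism by the conditions in the
definition of `HasTwist`. -/
theorem nonempty_iso_stdMod (h2 : (2 : k) ≠ 0) {σ : Braiding k (H8 k)} (W : QTMod σ.toRMatrix)
    (hend : ∀ f : W ⟶ W, ∃ c : k, f = c • 𝟙 W)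
    (hg : ∃ g : W ⊗ W ⟶ W ⊗ W, ∀ c : k, g ≠ c • 𝟙 (W ⊗ W)) : Nonempty (W ≅ stdMod σ) := by
  by_cases h : ∃ w, W.ρ (E k 0 0) w ≠ 0
  · obtain ⟨w, hw⟩ := h
    exact nonempty_iso_stdMod_of_ne_zero h2 W hend hw
  -- Otherwise the matrix units act by zero, so the dual algebra acts through a commutative quotient,
  -- hence by scalars, and all linear maps are endomorphisms.
  exfalso
  push Not at h
  have h00 : W.ρ (E k 0 0) = 0 := LinearMap.ext h
  have hE : ∀ i j, W.ρ (E k i j) = 0 := fun i j => by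
    have : E k i j = E k i 0 * E k 0 0 * E k 0 j := by simp [E_mul_E h2]
    rw [this, map_mul, map_mul, h00, mul_zero, zero_mul]
  have hcomm : ∀ a b, W.ρ a * W.ρ b = W.ρ b * W.ρ a := fun a b => by
    rw [← sub_eq_zero, ← map_mul, ← map_mul, ← map_sub, commutator_eq h2]
    simp [hE]
  have hscalar : ∀ a, ∃ c : k, W.ρ a = c • LinearMap.id := fun a => by
    obtain ⟨c, hc⟩ := hend ⟨W.ρ a, fun b m => LinearMap.congr_fun (hcomm a b) m⟩
    exact ⟨c, congrArg QTMod.Hom.lin hc⟩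
  have hlin : ∀ f : W.V →ₗ[k] W.V, ∃ c : k, f = c • LinearMap.id := fun f => by
    obtain ⟨c, hc⟩ := hend ⟨f, fun a m => by
      obtain ⟨c, hc⟩ := hscalar a
      simp [hc]⟩
    exact ⟨c, congrArg QTMod.Hom.lin hc⟩
  obtain ⟨w₀, hspan⟩ : ∃ w₀ : W.V, ∀ w, ∃ c : k, w = c • w₀ := by
    by_cases hW : ∃ w₀ : W.V, w₀ ≠ 0
    · obtain ⟨w₀, hw₀⟩ := hW
      obtain ⟨f, hf⟩ := exists_apply_eq_one (k := k) hw₀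
      refine ⟨w₀, fun w => ?_⟩
      obtain ⟨c, hc⟩ := hlin (f.smulRight w)
      have := LinearMap.congr_fun hc w₀
      exact ⟨c, by simpa [hf] using this⟩
    · push Not at hW
      exact ⟨0, fun w => ⟨0, by simp [hW w]⟩⟩
  have hspan2 : ∀ t : W.V ⊗[k] W.V, ∃ c : k, t = c • (w₀ ⊗ₜ[k] w₀) := by
    intro t
    induction t with
    | zero => exact ⟨0, by simp⟩
    | add s t hs ht =>
      obtain ⟨c, rfl⟩ := hs
      obtain ⟨d, rfl⟩ := ht
      exact ⟨c + d, (add_smul _ _ _).symm⟩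
    | tmul v w =>
      obtain ⟨c, rfl⟩ := hspan v
      obtain ⟨d, rfl⟩ := hspan w
      exact ⟨c * d, smul_tmul_smul _ _ _ _⟩
  obtain ⟨g, hg⟩ := hg
  let g' : W.V ⊗[k] W.V →ₗ[k] W.V ⊗[k] W.V := g.lin
  obtain ⟨c, hc⟩ := hspan2 (g' (w₀ ⊗ₜ w₀))
  refine hg c (QTMod.hom_ext ?_)
  change g' = c • LinearMap.id
  refine LinearMap.ext fun t => ?_
  obtain ⟨d, rfl⟩ := hspan2 t
  rw [map_smul, hc, smul_comm]
  rfl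

open MonoidalCategory in
theorem HasTwist.eq_twist (h2 : (2 : k) ≠ 0) {σ : Braiding k (H8 k)} {w : k}
    (hw : HasTwist σ.toRMatrix w) : w = twist σ := by
  obtain ⟨W, hend, hg, h, h0, hβ⟩ := hw
  obtain ⟨e⟩ := nonempty_iso_stdMod h2 W hend hg
  let h' : 𝟙_ _ ⟶ stdMod σ ⊗ stdMod σ := h ≫ (e.hom ⊗ₘ e.hom)
  have h0' : h' ≠ 0 := fun h00 => h0 <| by
    have := congrArg (fun z => z ≫ (e.inv ⊗ₘ e.inv)) h00
    simpa [h'] using this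
  have hβ' : h' ≫ (β_ _ _).hom = w • h' := by
    rw [Category.assoc, BraidedCategory.braiding_naturality, ← Category.assoc, hβ,
      Linear.smul_comp]
  let v : (Fin 2 → k) ⊗[k] (Fin 2 → k) := h'.lin (1 : k)
  have hv0 : v ≠ 0 := fun hv => h0' (QTMod.hom_ext (LinearMap.ext_ring hv))
  have hv : QTMod.tensorAct (stdRep k) (stdRep k) (Bialgebra.comulAlgHom k _ (haar k)) v = v := by
    refine (h'.comm (haar k) (1 : k)).symm.trans ?_
    change h'.lin (haar k 1 * (1 : k)) = h'.lin (1 : k)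
    rw [haar_one h2, one_mul]
  have hβv : TensorProduct.comm k _ _ (QTMod.tensorAct (stdRep k) (stdRep k) σ.toRMatrix.elt v) =
      w • v := LinearMap.congr_fun (congrArg QTMod.Hom.lin hβ') (1 : k)
  obtain ⟨c, hc⟩ := haar_act h2 v
  rw [hv] at hc
  rw [hc, map_smul, map_smul, braid_invVec h2, smul_comm c, ← hc] at hβv
  exact (smul_left_injective k hv0 hβv).symm

/-- Braided Morita equivalent braidings of `H₈` have the same twist. -/
theorem twist_eq_of_moritaEquivalent (h2 : (2 : k) ≠ 0) {σ σ' : Braiding k (H8 k)}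
    (h : Braiding.MoritaEquivalent σ σ') : twist σ = twist σ' :=
  HasTwist.eq_twist h2 ((hasTwist_twist h2 σ).of_equivalent h)

end H8
end

noncomputable section
namespace H8
variable {k : Type u} [Field k]

/-! ### The classification -/

theorem intCast_unit_injective (h2 : (2 : k) ≠ 0) {γ γ' : ℤˣ}
    (h : ((γ : ℤ) : k) = ((γ' : ℤ) : k)) : γ = γ' := by
  have hne : (1 : k) ≠ -1 := fun h => h2 (by linear_combination h)
  rcases Int.units_eq_one_or γ with rfl | rfl <;> rcases Int.units_eq_one_or γ' with rfl | rfl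
  · rfl
  · exact absurd (by simpa using h) hne
  · exact absurd (by simpa using h.symm) hne
  · rfl

theorem intCast_unit_pow_four (γ : ℤˣ) : ((γ : ℤ) : k) ^ 4 = 1 := by
  rcases Int.units_eq_one_or γ with rfl | rfl <;> norm_num

/-- Braidings of `H₈` with the same twist are equal, except that `τ⁻_{γ,δ}` and `τ⁻_{γ,-δ}` have
the same twist. -/
theorem eq_or_of_twist_eq (h2 : (2 : k) ≠ 0) {σ σ' : Braiding k (H8 k)}
    (h : twist σ = twist σ') :
    σ = σ' ∨ ∃ γ δ : ℤˣ, σ = tau k γ δ ∧ σ' = tau k γ (-δ) := by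
  have hne : (1 : k) ≠ -1 := fun h => h2 (by linear_combination h)
  rcases eq_tau_or_eq_kappa h2 σ with ⟨γ, δ, rfl⟩ | ⟨b, hb, rfl⟩ <;>
    rcases eq_tau_or_eq_kappa h2 σ' with ⟨γ', δ', rfl⟩ | ⟨b', hb', rfl⟩
  · rw [twist_tau, twist_tau] at h
    obtain rfl := intCast_unit_injective h2 h
    by_cases hδ : δ = δ'
    · exact Or.inl (by rw [hδ])
    · refine Or.inr ⟨γ, δ, rfl, ?_⟩
      rw [Int.units_ne_iff_eq_neg.1 (Ne.symm hδ)]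
  · rw [twist_tau, twist_kappa] at h
    rw [← h, intCast_unit_pow_four] at hb'
    exact absurd hb' hne
  · rw [twist_tau, twist_kappa] at h
    rw [h, intCast_unit_pow_four] at hb
    exact absurd hb hne
  · rw [twist_kappa, twist_kappa] at h
    subst h
    exact Or.inl rfl

theorem moritaEquivalent_iff_twist_eq (h2 : (2 : k) ≠ 0) {σ σ' : Braiding k (H8 k)} :
    Braiding.MoritaEquivalent σ σ' ↔ twist σ = twist σ' := by
  refine ⟨twist_eq_of_moritaEquivalent h2, fun h => ?_⟩
  rcases eq_or_of_twist_eq h2 h with rfl | ⟨γ, δ, rfl, rfl⟩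
  · exact .refl _
  · exact tau_equiv γ δ

theorem moritaEquivalent_iff (h2 : (2 : k) ≠ 0) (σ σ' : Braiding k (H8 k)) :
    Braiding.MoritaEquivalent σ σ' ↔
      σ = σ' ∨
      ({σ, σ'} : Set (Braiding k (H8 k))) = {tau k 1 1, tau k 1 (-1)} ∨
      ({σ, σ'} : Set (Braiding k (H8 k))) = {tau k (-1) 1, tau k (-1) (-1)} := by
  rw [moritaEquivalent_iff_twist_eq h2]
  constructor
  · intro h
    rcases eq_or_of_twist_eq h2 h with h | ⟨γ, δ, rfl, rfl⟩
    · exact Or.inl h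
    · right
      rcases Int.units_eq_one_or γ with rfl | rfl <;>
        rcases Int.units_eq_one_or δ with rfl | rfl <;> simp [Set.pair_comm]
  · rintro (rfl | h | h)
    · rfl
    all_goals
      rcases Set.pair_eq_pair_iff.1 h with ⟨rfl, rfl⟩ | ⟨rfl, rfl⟩ <;> simp [twist_tau]

theorem range_twist (h2 : (2 : k) ≠ 0) {ζ : k} (hζ : ζ ^ 4 = -1) :
    Set.range (twist : Braiding k (H8 k) → k) =
      (({1, -1, ζ, -ζ, ζ ^ 3, -ζ ^ 3} : Set k)) := by
  ext w
  simp only [Set.mem_range, Set.mem_insert_iff, Set.mem_singleton_iff]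
  constructor
  · rintro ⟨σ, rfl⟩
    rcases eq_tau_or_eq_kappa h2 σ with ⟨γ, δ, rfl⟩ | ⟨b, hb, rfl⟩
    · rw [twist_tau]
      rcases Int.units_eq_one_or γ with rfl | rfl <;> simp
    · rw [twist_kappa]
      have h : (b - ζ) * (b + ζ) * ((b - ζ ^ 3) * (b + ζ ^ 3)) = 0 := by
        linear_combination hb + (ζ ^ 4 - 1 - b ^ 2 * ζ ^ 2) * hζ
      simp only [mul_eq_zero, sub_eq_zero, add_eq_zero_iff_eq_neg] at h
      tauto
  · have hk : ∀ w : k, w ^ 4 = -1 → ∃ σ : Braiding k (H8 k), twist σ = w :=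
      fun w hw => ⟨kappa hw, twist_kappa hw⟩
    rintro (rfl | rfl | rfl | rfl | rfl | rfl)
    · exact ⟨tau k 1 1, by simp [twist_tau]⟩
    · exact ⟨tau k (-1) 1, by simp [twist_tau]⟩
    all_goals
      apply hk
    · exact hζ
    · linear_combination hζ
    · linear_combination (ζ ^ 8 - ζ ^ 4 + 1) * hζ
    · linear_combination (ζ ^ 8 - ζ ^ 4 + 1) * hζ

theorem ncard_range_twist (h2 : (2 : k) ≠ 0) {ζ : k} (hζ : ζ ^ 4 = -1) :
    (Set.range (twist : Braiding k (H8 k) → k)).ncard = 6 := by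
  classical
  -- Coincidences among the six values would force `2 = 0`.
  have h0 : ζ ≠ 0 := fun h => by simp [h] at hζ
  have key : ∀ w : k, w ^ 4 = -1 → w ≠ 1 ∧ w ≠ -1 := fun w hw =>
    ⟨fun h => h2 (by rw [h] at hw; linear_combination hw),
      fun h => h2 (by rw [h] at hw; linear_combination hw)⟩
  have k1 := key ζ hζ
  have k2 := key (-ζ) (by linear_combination hζ)
  have k3 := key (ζ ^ 3) (by linear_combination (ζ ^ 8 - ζ ^ 4 + 1) * hζ)
  have k4 := key (-ζ ^ 3) (by linear_combination (ζ ^ 8 - ζ ^ 4 + 1) * hζ)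
  have h11 : (1 : k) ≠ -1 := fun h => h2 (by linear_combination h)
  have hneg : ∀ w : k, w ≠ 0 → w ≠ -w := fun w hw h =>
    mul_ne_zero h2 hw (by linear_combination h)
  have h13 : ζ ≠ ζ ^ 3 := fun h => h2 <| by
    have : ζ ^ 2 = 1 := mul_left_cancel₀ h0 (by linear_combination -h)
    linear_combination hζ - (ζ ^ 2 + 1) * this
  have h13' : ζ ≠ -ζ ^ 3 := fun h => h2 <| by
    have : ζ ^ 2 = -1 := mul_left_cancel₀ h0 (by linear_combination h)
    linear_combination hζ - (ζ ^ 2 - 1) * this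
  have h23 : -ζ ≠ ζ ^ 3 := fun h => h13' (by linear_combination -h)
  have h24 : -ζ ≠ -ζ ^ 3 := fun h => h13 (by linear_combination -h)
  have hs : ({1, -1, ζ, -ζ, ζ ^ 3, -ζ ^ 3} : Set k) =
      (({1, -1, ζ, -ζ, ζ ^ 3, -ζ ^ 3} : Finset k) : Set k) := by simp
  rw [range_twist h2 hζ, hs, Set.ncard_coe_finset]
  rw [Finset.card_insert_of_notMem, Finset.card_insert_of_notMem, Finset.card_insert_of_notMem,
    Finset.card_insert_of_notMem, Finset.card_insert_of_notMem, Finset.card_singleton]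
  · simpa using hneg _ (pow_ne_zero 3 h0)
  · simp only [Finset.mem_insert, Finset.mem_singleton, not_or]
    exact ⟨h23, h24⟩
  · simp only [Finset.mem_insert, Finset.mem_singleton, not_or]
    exact ⟨hneg _ h0, h13, h13'⟩
  · simp only [Finset.mem_insert, Finset.mem_singleton, not_or]
    exact ⟨k1.2.symm, k2.2.symm, k3.2.symm, k4.2.symm⟩
  · simp only [Finset.mem_insert, Finset.mem_singleton, not_or]
    exact ⟨h11, k1.1.symm, k2.1.symm, k3.1.symm, k4.1.symm⟩

theorem card_quotient [IsAlgClosed k] (h2 : (2 : k) ≠ 0) :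
    Nat.card (Quotient (Braiding.moritaSetoid k (H8 k))) = 6 := by
  obtain ⟨ζ, hζ⟩ := IsAlgClosed.exists_pow_nat_eq (-1 : k) (n := 4) (by norm_num)
  have e : Braiding.moritaSetoid k (H8 k) = Setoid.ker twist :=
    Setoid.ext fun σ σ' => moritaEquivalent_iff_twist_eq h2
  rw [e, Nat.card_congr (Setoid.quotientKerEquivRange _), Nat.card_coe_set_eq,
    ncard_range_twist h2 hζ]

end H8
end

theorem mainTheorem1 (k : Type u) [Field k] [IsAlgClosed k] (hk : ringChar k ≠ 2) :
    (∀ σ σ' : Braiding k (H8 k), Braiding.MoritaEquivalent σ σ' ↔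
      σ = σ' ∨
      ({σ, σ'} : Set (Braiding k (H8 k))) = {H8.tau k 1 1, H8.tau k 1 (-1)} ∨
      ({σ, σ'} : Set (Braiding k (H8 k))) = {H8.tau k (-1) 1, H8.tau k (-1) (-1)}) ∧
    Nat.card (Quotient (Braiding.moritaSetoid k (H8 k))) = 6 :=
  have h2 : (2 : k) ≠ 0 := Ring.two_ne_zero hk
  ⟨H8.moritaEquivalent_iff h2, H8.card_quotient h2⟩
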